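/- Let $(M,\mathfrak c)$ be a conformal manifold of dimension $n\ge 1$ and signature $(p,q)$, let $\mathcal G=\{(x,g_x): x\in M,\ g\in\mathfrak c\}$, and put $\delta_\lambda(x,g_x,\rho)=(x,\lambda^2g_x,\rho)$ on $\mathcal G\times\mathbb R$ for $\lambda>0$, $\iota(x,g_x)=(x,g_x,0)$ and $\pi(x,g_x)=x$. Let $(\widetilde{\mathcal G},\widetilde g)$ be an ambient space for $(M,\mathfrak c)$: $\widetilde{\mathcal G}\subseteq\mathcal G\times\mathbb R$ is a dilation-invariant open set containing $\iota(\mathcal G)$, and $\widetilde g$ is a smooth pseudo-Riemannian metric of signature $(p+1,q+1)$ on $\widetilde{\mathcal G}$ such that $\delta_\lambda^*\widetilde g=\lambda^2\widetilde g$, such that $\iota^*\widetilde g$ is the canonical degenerate metric $(X,Y)\mapsto g_x(\pi_*X,\pi_*Y)$ on $\mathcal G$, and such that $\mathrm{Ric}(\widetilde g)\in O(\rho^\infty)$ if $n$ is odd and $\mathrm{Ric}(\widetilde g)\in O^+(\rho^{n/2-1})$ if $n$ is even. (Here $S\in O(\rho^\infty)$ means that $\rho^{-m}S$ extends continuously to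 $\iota(\mathcal G)$ for every $m$, and $S\in O^+(\rho^m)$ means that $\rho^{-m}S$ extends continuously to $\iota(\mathcal G)$ and that at each $z=(x,g_x)\in\mathcal G$ one has $\iota^*(\rho^{-m}S)=\pi^*s$ for some $s\in S^2T_x^*M$ with $\mathrm{tr}_{g_x}s=0$.) For $w\in\mathbb R$ let $\widetilde{\mathcal E}[w]=\{\widetilde u\in C^\infty(\widetilde{\mathcal G}):\delta_\lambda^*\widetilde u=\lambda^w\widetilde u \text{ for all }\lambda>0\}$, and let $\widetilde\Delta$ be the Laplacian of $\widetilde g$. Let $k$ be a non-negative integer. If $n$ is even and $k>n/2$, assume additionally that $\widetilde g$ is straight, i.e. that each dilation orbit $\lambda\mapsto\delta_\lambda z$ is a geodesic of $\widetilde g$. Let $w,w'\in\mathbb R$ and $\widetilde f\in\widetilde{\mathcal E}[w']$, and for $\widetilde u\in\widetilde{\mathcal E}[w]$ put $$\widetilde D_{2k,w,\widetilde f}(\widetilde u)=\sum_{j=0}^k a_j\,\widetilde\Delta^{k-j}\bigl(\widetilde f\,\widetilde\Delta^j\widetilde u\bigr),\qquad a_j=\binom kj\frac{\Gamma\bigl(j+k-w-w'-\frac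 n2\bigr)\,\Gamma\bigl(\frac n2+w-j\bigr)}{\Gamma\bigl(k-w-w'-\frac n2\bigr)\,\Gamma\bigl(\frac n2+w-k\bigr)},$$ where the quotients of Gamma values are read as the rising factorials $\bigl(k-w-w'-\frac n2\bigr)_j$ and $\bigl(\frac n2+w-k\bigr)_{k-j}$ also where the Gamma function has poles. Then $\widetilde D_{2k,w,\widetilde f}$ maps $\widetilde{\mathcal E}[w]$ into $\widetilde{\mathcal E}[w+w'-2k]$, and $\iota^*\widetilde D_{2k,w,\widetilde f}(\widetilde u)$ depends only on $\iota^*\widetilde u$, $\widetilde f$ and $\widetilde g$: if $\widetilde u_1,\widetilde u_2\in\widetilde{\mathcal E}[w]$ satisfy $\iota^*\widetilde u_1=\iota^*\widetilde u_2$, then $\iota^*\widetilde D_{2k,w,\widetilde f}(\widetilde u_1)=\iota^*\widetilde D_{2k,w,\widetilde f}(\widetilde u_2)$. -/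

import Mathlib

open Set Bundle
open scoped Manifold ContDiff

noncomputable section

/-! ### Bilinear forms -/

section Forms

variable {V : Type*} [AddCommGroup V] [Module ℝ V] [TopologicalSpace V]

/-- The trace of the bilinear form `B` with respect to the metric `G`. -/
def metricTrace (G B : V →L[ℝ] V →L[ℝ] ℝ) : ℝ :=
  LinearMap.trace ℝ V (G.inverse ∘L B : V →L[ℝ] V)

/-- The bilinear form `B` has signature `(p, q)`: there is an orthonormal basis with `p` vectors of
square `1` and `q` vectors of square `-1`. In particular `B` is symmetric and nondegenerate, and
`p + q = dim V`. -/
def HasSignature (p q : ℕ) (B : V →L[ℝ] V →L[ℝ] ℝ) : Prop :=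
  ∃ b : Module.Basis (Fin p ⊕ Fin q) ℝ V,
    ∀ i j, B (b i) (b j) = if i = j then Sum.elim (fun _ => 1) (fun _ => -1) i else 0

end Forms

/-! ### Pseudo-Riemannian geometry in a coordinate domain

`V` is the model vector space and `G : V → (V →L[ℝ] V →L[ℝ] ℝ)` is the coordinate expression of a
metric. Everything is evaluated at a point `y : V` and only depends on the germ of the data there. -/

section Coordinates

set_option synthInstance.maxHeartbeats 400000
set_option maxHeartbeats 1000000

variable {V : Type*} [NormedAddCommGroup V] [NormedSpace ℝ V]

/-- Christoffel symbols `Γ(X, Y)` of the Levi-Civita connection of `G` at `y`: the vector with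
`G(Γ(X,Y), Z) = (∂_X G(Y,Z) + ∂_Y G(X,Z) - ∂_Z G(X,Y)) / 2` for all `Z`. In the code,
`A(X, Y) = G⁻¹ (Z ↦ ∂_X G(Y,Z))` and `K(X, Y) = G⁻¹ (Z ↦ ∂_Z G(X,Y))`. -/
def coordChristoffel (G : V → V →L[ℝ] V →L[ℝ] ℝ) (y : V) : V →L[ℝ] V →L[ℝ] V :=
  let L : (V →L[ℝ] V →L[ℝ] ℝ) →L[ℝ] (V →L[ℝ] V) :=
    ContinuousLinearMap.compL ℝ V (V →L[ℝ] ℝ) V (G y).inverse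
  let A : V →L[ℝ] V →L[ℝ] V := L ∘L fderiv ℝ G y
  let K : V →L[ℝ] V →L[ℝ] V :=
    (L ∘L (ContinuousLinearMap.flipₗᵢ ℝ V V ℝ).toContinuousLinearEquiv.toContinuousLinearMap) ∘L
      (fderiv ℝ G y).flip
  (1 / 2 : ℝ) • (A + A.flip - K)

theorem coordChristoffel_spec (G : V → V →L[ℝ] V →L[ℝ] ℝ) (y : V) (hG : (G y).IsInvertible)
    (X Y Z : V) : G y (coordChristoffel G y X Y) Z =
      (fderiv ℝ G y X Y Z + fderiv ℝ G y Y X Z - fderiv ℝ G y Z X Y) / 2 := by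
  simp [coordChristoffel, hG]
  ring

/-- The Hessian `(X, Y) ↦ ∂_X ∂_Y u - ∂_{Γ(X,Y)} u` of a function at `y`. -/
def coordHessian (G : V → V →L[ℝ] V →L[ℝ] ℝ) (u : V → ℝ) (y : V) : V →L[ℝ] V →L[ℝ] ℝ :=
  fderiv ℝ (fderiv ℝ u) y -
    (ContinuousLinearMap.compL ℝ V V ℝ (fderiv ℝ u y)) ∘L coordChristoffel G y

/-- The Laplace-Beltrami operator `Δ u = tr_G ∇² u` (so `Δ = div grad`) at `y`. -/
def coordLaplacian (G : V → V →L[ℝ] V →L[ℝ] ℝ) (u : V → ℝ) (y : V) : ℝ :=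
  metricTrace (G y) (coordHessian G u y)

/-- The curvature endomorphism `X ↦ R(X, Y) Z` at `y`, where
`R(X, Y) Z = ∇_X ∇_Y Z - ∇_Y ∇_X Z - ∇_[X,Y] Z`. -/
def coordCurvature (G : V → V →L[ℝ] V →L[ℝ] ℝ) (y Y Z : V) : V →L[ℝ] V :=
  ((fderiv ℝ (coordChristoffel G) y).flip Y).flip Z
    - (fderiv ℝ (coordChristoffel G) y Y).flip Z
    + (coordChristoffel G y).flip (coordChristoffel G y Y Z)
    - (coordChristoffel G y Y) ∘L (coordChristoffel G y).flip Z

/-- The Ricci tensor `Ric(Y, Z) = tr (X ↦ R(X, Y) Z)` at `y`. -/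
def coordRicci (G : V → V →L[ℝ] V →L[ℝ] ℝ) (y Y Z : V) : ℝ :=
  LinearMap.trace ℝ V (coordCurvature G y Y Z : V →L[ℝ] V)

end Coordinates

/-! ### Pseudo-Riemannian geometry on a manifold -/

section Manifold

variable {V : Type*} [NormedAddCommGroup V] [NormedSpace ℝ V]
  {H : Type*} [TopologicalSpace H] (I : ModelWithCorners ℝ V H)
  {X : Type*} [TopologicalSpace X] [ChartedSpace H X]

/-- A field of bilinear forms on the tangent spaces of `X`. -/
abbrev BilinField (X : Type*) [TopologicalSpace X] [ChartedSpace H X] : Type _ :=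
  ∀ p : X, TangentSpace I p →L[ℝ] TangentSpace I p →L[ℝ] ℝ

/-- Smoothness on the set `U`, as a section of the bundle `T*X ⊗ T*X`. -/
def BilinField.SmoothOn [IsManifold I ∞ X] (g : BilinField I X) (U : Set X) : Prop :=
  haveI : IsManifold I 1 X := IsManifold.of_le (n := ∞) (by norm_cast)
  ContMDiffOn I (I.prod 𝓘(ℝ, V →L[ℝ] V →L[ℝ] ℝ)) ∞
    (fun p => TotalSpace.mk' (V →L[ℝ] V →L[ℝ] ℝ)
      (E := fun p : X => TangentSpace I p →L[ℝ] TangentSpace I p →L[ℝ] ℝ) p (g p)) U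

/-- Continuity on the set `U`, as a section of the bundle `T*X ⊗ T*X`. -/
def BilinField.ContOn [IsManifold I ∞ X] (g : BilinField I X) (U : Set X) : Prop :=
  haveI : IsManifold I 1 X := IsManifold.of_le (n := ∞) (by norm_cast)
  ContinuousOn (fun p => TotalSpace.mk' (V →L[ℝ] V →L[ℝ] ℝ)
      (E := fun p : X => TangentSpace I p →L[ℝ] TangentSpace I p →L[ℝ] ℝ) p (g p)) U

/-- The field `g` is a smooth pseudo-Riemannian metric of signature `(p, q)` on the set `U`. -/
structure IsPseudoRiemannianOn [IsManifold I ∞ X] (p q : ℕ) (g : BilinField I X) (U : Set X) :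
    Prop where
  smooth : g.SmoothOn I U
  signature : ∀ x ∈ U, HasSignature p q (g x)

/-- The coordinate expression of `g` in the preferred chart at `p`, that is, its pullback under the
inverse of that chart. -/
def chartMetric (g : BilinField I X) (p : X) (y : V) : V →L[ℝ] V →L[ℝ] ℝ :=
  let D : V →L[ℝ] TangentSpace I ((extChartAt I p).symm y) :=
    mfderivWithin 𝓘(ℝ, V) I (extChartAt I p).symm (range I) y
  (ContinuousLinearMap.precomp ℝ D) ∘L (g ((extChartAt I p).symm y)) ∘L D

/-- The Laplace-Beltrami operator of `g`, applied to the function `u`. -/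
def laplacian (g : BilinField I X) (u : X → ℝ) (p : X) : ℝ :=
  coordLaplacian (chartMetric I g p) (u ∘ (extChartAt I p).symm) (extChartAt I p p)

/-- The Ricci tensor of `g` at `p`. -/
def ricci (g : BilinField I X) (p : X) (Y Z : TangentSpace I p) : ℝ :=
  coordRicci (chartMetric I g p) (extChartAt I p p)
    (mfderiv I 𝓘(ℝ, V) (extChartAt I p) p Y) (mfderiv I 𝓘(ℝ, V) (extChartAt I p) p Z)

/-- The curve `γ` satisfies the geodesic equation `c'' + Γ(c', c') = 0` of `g` at time `s`, where
`c` is the coordinate expression of `γ` in the preferred chart at `γ s`. -/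
def GeodesicAt (g : BilinField I X) (γ : ℝ → X) (s : ℝ) : Prop :=
  let c : ℝ → V := fun r => extChartAt I (γ s) (γ r)
  deriv (deriv c) s + coordChristoffel (chartMetric I g (γ s)) (c s) (deriv c s) (deriv c s) = 0

end Manifold

/-! ### Ambient spaces

Let `M` be a manifold of dimension `n` with a metric `g`. The conformal class of `g` gives the
`ℝ₊`-bundle `𝓖 = {(x, t² g_x)}`, identified with `M × ℝ₊` by `(x, t) ↔ (x, t² g_x)`, and
`𝓖 × ℝ` is the set of all points `(x, t, ρ)` of `M × ℝ × ℝ` with `t > 0`. -/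

section Ambient

/-- The model with corners of `M × ℝ × ℝ`. -/
abbrev ambI (n : ℕ) : ModelWithCorners ℝ (EuclideanSpace ℝ (Fin n) × (ℝ × ℝ))
    (ModelProd (EuclideanSpace ℝ (Fin n)) (ℝ × ℝ)) :=
  (𝓡 n).prod 𝓘(ℝ, ℝ × ℝ)

/-- The model with corners of `M × ℝ`. -/
abbrev coneI (n : ℕ) : ModelWithCorners ℝ (EuclideanSpace ℝ (Fin n) × ℝ)
    (ModelProd (EuclideanSpace ℝ (Fin n)) ℝ) :=
  (𝓡 n).prod 𝓘(ℝ, ℝ)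

/-- The dilation `δ_s (x, t, ρ) = (x, s t, ρ)`, which is `(x, t² g_x, ρ) ↦ (x, s² t² g_x, ρ)`. -/
def dilation {M : Type*} (s : ℝ) (p : M × (ℝ × ℝ)) : M × (ℝ × ℝ) := (p.1, (s * p.2.1, p.2.2))

/-- The inclusion `ι (x, t) = (x, t, 0)` of `𝓖` in `𝓖 × ℝ`. -/
def coneIncl {M : Type*} (z : M × ℝ) : M × (ℝ × ℝ) := (z.1, (z.2, 0))

variable {n : ℕ} {M : Type*} [TopologicalSpace M] [ChartedSpace (EuclideanSpace ℝ (Fin n)) M]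

/-- The pullback `ι^* S` of a field of bilinear forms to `𝓖`. -/
def conePullback (S : BilinField (ambI n) (M × (ℝ × ℝ))) (z : M × ℝ)
    (Y Z : TangentSpace (coneI n) z) : ℝ :=
  S (coneIncl z) (mfderiv (coneI n) (ambI n) coneIncl z Y)
    (mfderiv (coneI n) (ambI n) coneIncl z Z)

/-- The differential of the projection `π : 𝓖 → M`. -/
def coneProj (z : M × ℝ) : TangentSpace (coneI n) z →L[ℝ] TangentSpace (𝓡 n) z.1 :=
  mfderiv (coneI n) (𝓡 n) (Prod.fst : M × ℝ → M) z

variable [IsManifold (𝓡 n) ∞ M]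

/-- `(U, gt)` is a pre-ambient space for the conformal class, of signature `(p, q)`, of `g`: the set
`U` is a dilation-invariant open neighbourhood of `ι(𝓖)` in `𝓖 × ℝ`, and `gt` is a smooth metric of
signature `(p + 1, q + 1)` on `U` with `δ_s^* gt = s² gt` and with `ι^* gt` the canonical degenerate
metric `t² π^* g` of `𝓖`. -/
structure IsPreAmbientSpace (p q : ℕ) (g : BilinField (𝓡 n) M) (U : Set (M × (ℝ × ℝ)))
    (gt : BilinField (ambI n) (M × (ℝ × ℝ))) : Prop where
  isOpen : IsOpen U
  pos : ∀ z ∈ U, 0 < z.2.1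
  dilation_mem : ∀ z ∈ U, ∀ s : ℝ, 0 < s → dilation s z ∈ U
  cone_mem : ∀ (x : M) (t : ℝ), 0 < t → coneIncl (x, t) ∈ U
  metric : IsPseudoRiemannianOn (ambI n) (p + 1) (q + 1) gt U
  homogeneous : ∀ z ∈ U, ∀ s : ℝ, 0 < s → ∀ Y Z : TangentSpace (ambI n) z,
    gt (dilation s z) (mfderiv (ambI n) (ambI n) (dilation s) z Y)
      (mfderiv (ambI n) (ambI n) (dilation s) z Z) = s ^ 2 * gt z Y Z
  pullback : ∀ (x : M) (t : ℝ), 0 < t → ∀ Y Z : TangentSpace (coneI n) (x, t),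
    conePullback gt (x, t) Y Z = t ^ 2 * g x (coneProj (x, t) Y) (coneProj (x, t) Z)

/-- `S' = ρ^{-m} S`, extended continuously across `ρ = 0` in `U`. -/
def IsQuotientByRho (U : Set (M × (ℝ × ℝ))) (m : ℕ)
    (S : ∀ z : M × (ℝ × ℝ), TangentSpace (ambI n) z → TangentSpace (ambI n) z → ℝ)
    (S' : BilinField (ambI n) (M × (ℝ × ℝ))) : Prop :=
  S'.ContOn (ambI n) U ∧
    ∀ z ∈ U, ∀ Y Z : TangentSpace (ambI n) z, S z Y Z = z.2.2 ^ m * S' z Y Z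

/-- `S ∈ O(ρ^∞)`. -/
def IsORhoInfty (U : Set (M × (ℝ × ℝ)))
    (S : ∀ z : M × (ℝ × ℝ), TangentSpace (ambI n) z → TangentSpace (ambI n) z → ℝ) : Prop :=
  ∀ m : ℕ, ∃ S' : BilinField (ambI n) (M × (ℝ × ℝ)), IsQuotientByRho U m S S'

/-- `S ∈ O⁺(ρ^m)`: the quotient `ρ^{-m} S` extends continuously to `ι(𝓖)`, and at each point of `𝓖`
its pullback by `ι` is the pullback by `π` of a symmetric form that is trace-free with respect to
`g` (equivalently, with respect to `t² g`). -/
def IsOPlusRho (g : BilinField (𝓡 n) M) (U : Set (M × (ℝ × ℝ))) (m : ℕ)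
    (S : ∀ z : M × (ℝ × ℝ), TangentSpace (ambI n) z → TangentSpace (ambI n) z → ℝ) : Prop :=
  ∃ S' : BilinField (ambI n) (M × (ℝ × ℝ)), IsQuotientByRho U m S S' ∧
    ∀ (x : M) (t : ℝ), 0 < t →
      ∃ s : TangentSpace (𝓡 n) x →L[ℝ] TangentSpace (𝓡 n) x →L[ℝ] ℝ,
        (∀ Y Z, s Y Z = s Z Y) ∧
        metricTrace (g x) s = 0 ∧
        ∀ Y Z : TangentSpace (coneI n) (x, t),
          conePullback S' (x, t) Y Z = s (coneProj (x, t) Y) (coneProj (x, t) Z)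

/-- `(U, gt)` is an ambient space for the conformal class of `g`: a pre-ambient space which is
formally Ricci flat. -/
structure IsAmbientSpace (p q : ℕ) (g : BilinField (𝓡 n) M) (U : Set (M × (ℝ × ℝ)))
    (gt : BilinField (ambI n) (M × (ℝ × ℝ))) : Prop
    extends IsPreAmbientSpace p q g U gt where
  ricci_odd : Odd n → IsORhoInfty U (ricci (ambI n) gt)
  ricci_even : Even n → IsOPlusRho g U (n / 2 - 1) (ricci (ambI n) gt)

/-- The ambient metric is straight: every dilation orbit `s ↦ δ_s z` is a geodesic. -/
def IsStraight (U : Set (M × (ℝ × ℝ))) (gt : BilinField (ambI n) (M × (ℝ × ℝ))) : Prop :=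
  ∀ z ∈ U, ∀ s : ℝ, 0 < s → GeodesicAt (ambI n) gt (fun r => dilation r z) s

variable (n) in
/-- `u ∈ Ẽ[w]`: the function `u` is smooth on `U` and homogeneous of weight `w`. Values of `u`
outside `U` are irrelevant. -/
structure IsHomogeneous (U : Set (M × (ℝ × ℝ))) (w : ℝ) (u : M × (ℝ × ℝ) → ℝ) : Prop where
  smooth : ContMDiffOn (ambI n) 𝓘(ℝ, ℝ) ∞ u U
  homogeneous : ∀ z ∈ U, ∀ s : ℝ, 0 < s → u (dilation s z) = s ^ w * u z

/-- The coefficient `a_j`. The ratios `Γ(j + k - w - w' - n/2) / Γ(k - w - w' - n/2)` and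
`Γ(n/2 + w - j) / Γ(n/2 + w - k)` are the rising factorials `(k - w - w' - n/2)_j` and
`(n/2 + w - k)_{k-j}`, also where the Gamma function has a pole. -/
def opCoeff (n k : ℕ) (w w' : ℝ) (j : ℕ) : ℝ :=
  (k.choose j : ℝ) * (ascPochhammer ℝ j).eval (k - w - w' - n / 2)
    * (ascPochhammer ℝ (k - j)).eval (n / 2 + w - k)

/-- The operator `u ↦ ∑_{j=0}^k a_j Δ^{k-j} (f Δ^j u)` of `gt`. -/
def ambientOp (gt : BilinField (ambI n) (M × (ℝ × ℝ))) (k : ℕ) (w w' : ℝ)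
    (f u : M × (ℝ × ℝ) → ℝ) (z : M × (ℝ × ℝ)) : ℝ :=
  ∑ j ∈ Finset.range (k + 1), opCoeff n k w w' j *
    ((laplacian (ambI n) gt)^[k - j] (fun y => f y * (laplacian (ambI n) gt)^[j] u y)) z

end Ambient

theorem gamma_ratio_eq (a : ℝ) (ha : ∀ m : ℕ, a ≠ -m) (j : ℕ) :
    (ascPochhammer ℝ j).eval a = Real.Gamma (a + j) / Real.Gamma a := by
  have h0 : Real.Gamma a ≠ 0 := Real.Gamma_ne_zero ha
  induction j with
  | zero => simp [h0]
  | succ j ih =>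
    have h1 : a + j ≠ 0 := fun h => ha j (by linarith)
    rw [ascPochhammer_succ_right]
    simp only [Polynomial.eval_mul, Polynomial.eval_add, Polynomial.eval_X,
      Polynomial.eval_natCast, ih]
    have : a + ((j + 1 : ℕ) : ℝ) = (a + j) + 1 := by push_cast; ring
    rw [this, Real.Gamma_add_one h1]
    ring

/-- Away from the poles, `opCoeff` is the quotient of Gamma values. -/
theorem opCoeff_eq_gamma (n k : ℕ) (w w' : ℝ) (j : ℕ) (hj : j ≤ k)
    (hA : ∀ m : ℕ, k - w - w' - n / 2 ≠ -(m : ℝ)) (hB : ∀ m : ℕ, n / 2 + w - k ≠ -(m : ℝ)) :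
    opCoeff n k w w' j = (k.choose j : ℝ) *
      (Real.Gamma (j + k - w - w' - n / 2) * Real.Gamma (n / 2 + w - j)) /
      (Real.Gamma (k - w - w' - n / 2) * Real.Gamma (n / 2 + w - k)) := by
  rw [opCoeff, gamma_ratio_eq _ hA, gamma_ratio_eq _ hB, Nat.cast_sub hj]
  have h1 : (k - w - w' - n / 2 + j : ℝ) = j + k - w - w' - n / 2 := by ring
  have h2 : (n / 2 + w - k + (k - j) : ℝ) = n / 2 + w - j := by ring
  rw [h1, h2]
  ring

end

noncomputable section

/-! ### Smooth functions on open sets -/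

section Smooth

variable {V : Type*} [NormedAddCommGroup V] [NormedSpace ℝ V]
  {W : Type*} [NormedAddCommGroup W] [NormedSpace ℝ W] {Ω : Set V}

/-! Write X for the generator of the dilations, α for its dual one-form, Q = g̃(X, X) and N = n + 2.

Suppose first that the metric is straight. Then dQ = 2α and div X = N, so [Δ, Q] = 4∇_X + 2N, which
acts on functions of weight s as the number 4s + 2N. Iterating, Δ^j(Qv) = QΔ^j v + 4j(s + N/2 + 1 -
j)Δ^{j-1}v. Since Q vanishes simply on the cone, u₁ - u₂ = Qv with v of weight w - 2
(`exists_eq_sq_mul_of_hom`). With P_j = Δ^{k-j-1}(f Δ^j v), the j-th summand of the operator applied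
to Qv restricts to the cone as d_j P_j + b_j P_{j-1} for explicit numbers d_j, b_j. The coefficients
a_j solve a_{j+1} b_{j+1} = -a_j d_j (`opCoeff_succ`), so the sum telescopes to zero
(`coordOp_sq_mul`).

In general the defect β = α - dQ/2 does not vanish. Homogeneity gives ∇X = id + F with F skew, F
being dβ/2 with an index raised, and β = ½ i_X dβ. As div X is constant, the contracted Ricci
identity becomes div(FZ) = tr(F ∘ ∇Z) + Ric(Z, X) (`diverg_skew`), a Maxwell equation whose source
is small by the Ricci conditions. It is solved order by order along the cone.
`defect_eq_zero_on_cone` gives β = 0 there, whence Q is a defining function. If β = Q^m γ,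
`exists_succ` shows that γ vanishes on the cone unless 2m = N or 2m + 2 = N. For odd n this never
happens; for even n the step fails at m = n/2, and the Ricci condition stops there as well, which is
why straightness is assumed for k > n/2. The outcome is β = Q^k γ (`exists_isDefectQuotient`).

The commutator [Δ, Q] then has an error Q^k times a first-order operator. A Laplacian costs one
power of Q (`sqDvd_laplacian`) and at most k - 1 further Laplacians follow, so every error still
contains a factor Q and is invisible on the cone.

All this happens in one chart, in which dilations are linear. Since the Laplacian and Ricci tensor
are defined by the preferred chart at each point, their invariance under changes of coordinates is
needed to pass to a fixed chart. -/

theorem ContDiffOn.fderiv_infty (hΩ : IsOpen Ω) {f : V → W} (hf : ContDiffOn ℝ ∞ f Ω) :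
    ContDiffOn ℝ ∞ (fderiv ℝ f) Ω :=
  hf.fderiv_of_isOpen hΩ (by norm_cast)

theorem ContDiffOn.contDiffAt_infty (hΩ : IsOpen Ω) {f : V → W} (hf : ContDiffOn ℝ ∞ f Ω) {y : V}
    (hy : y ∈ Ω) : ContDiffAt ℝ ∞ f y :=
  hf.contDiffAt (hΩ.mem_nhds hy)

theorem ContDiffOn.differentiableAt_infty (hΩ : IsOpen Ω) {f : V → W} (hf : ContDiffOn ℝ ∞ f Ω)
    {y : V} (hy : y ∈ Ω) : DifferentiableAt ℝ f y :=
  (hf.contDiffAt_infty hΩ hy).differentiableAt (by simp)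

/-- A smooth function has a symmetric second derivative. -/
theorem ContDiffOn.fderiv_fderiv_comm (hΩ : IsOpen Ω) {f : V → W} (hf : ContDiffOn ℝ ∞ f Ω)
    {y : V} (hy : y ∈ Ω) (Y Z : V) :
    fderiv ℝ (fderiv ℝ f) y Y Z = fderiv ℝ (fderiv ℝ f) y Z Y :=
  ((hf.contDiffAt_infty hΩ hy).isSymmSndFDerivAt
    (by simp only [minSmoothness_of_isRCLikeNormedField]; norm_cast)) Y Z

theorem fderiv_congr_on (hΩ : IsOpen Ω) {f g : V → W} (h : EqOn f g Ω) {y : V} (hy : y ∈ Ω) :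
    fderiv ℝ f y = fderiv ℝ g y :=
  (Filter.eventuallyEq_of_mem (hΩ.mem_nhds hy) h).fderiv_eq

end Smooth

/-! ### Metrics on open sets of a vector space -/

section Calculus

set_option synthInstance.maxHeartbeats 400000

variable {V : Type*} [NormedAddCommGroup V] [NormedSpace ℝ V]

/-- `G` is a smooth nondegenerate symmetric bilinear form on the open set `Ω`. -/
structure IsMetricOn (G : V → V →L[ℝ] V →L[ℝ] ℝ) (Ω : Set V) : Prop where
  isOpen : IsOpen Ω
  smooth : ContDiffOn ℝ ∞ G Ω
  symm : ∀ y ∈ Ω, ∀ Y Z, G y Y Z = G y Z Y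
  invertible : ∀ y ∈ Ω, (G y).IsInvertible

/-- The covariant derivative `Y ↦ ∇_Y ξ` of a vector field. -/
def covD (G : V → V →L[ℝ] V →L[ℝ] ℝ) (ξ : V → V) (y : V) : V →L[ℝ] V :=
  fderiv ℝ ξ y + (coordChristoffel G y).flip (ξ y)

/-- The divergence of a vector field. -/
def diverg (G : V → V →L[ℝ] V →L[ℝ] ℝ) (ξ : V → V) (y : V) : ℝ :=
  LinearMap.trace ℝ V (covD G ξ y : V →L[ℝ] V)

/-- The vector field dual to a one-form. -/
def sharp (G : V → V →L[ℝ] V →L[ℝ] ℝ) (γ : V → V →L[ℝ] ℝ) (y : V) : V :=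
  (G y).inverse (γ y)

/-- The exterior derivative of a one-form. -/
def curl (γ : V → V →L[ℝ] ℝ) (y : V) : V →L[ℝ] V →L[ℝ] ℝ :=
  fderiv ℝ γ y - (fderiv ℝ γ y).flip

variable {G : V → V →L[ℝ] V →L[ℝ] ℝ} {Ω : Set V} {y : V}

theorem covD_apply (ξ : V → V) (y Y : V) :
    covD G ξ y Y = fderiv ℝ ξ y Y + coordChristoffel G y Y (ξ y) := by
  simp [covD]

theorem curl_apply (γ : V → V →L[ℝ] ℝ) (y Y Z : V) :
    curl γ y Y Z = fderiv ℝ γ y Y Z - fderiv ℝ γ y Z Y := by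
  simp [curl]

theorem curl_swap (γ : V → V →L[ℝ] ℝ) (y Y Z : V) : curl γ y Y Z = - curl γ y Z Y := by
  simp [curl]

namespace IsMetricOn

theorem sharp_spec (h : IsMetricOn G Ω) (hy : y ∈ Ω) (γ : V → V →L[ℝ] ℝ) : G y (sharp G γ y) = γ y := by
  simp [sharp, (h.invertible y hy)]

theorem ext (h : IsMetricOn G Ω) (hy : y ∈ Ω) {Y Y' : V} (hYY : ∀ Z, G y Y Z = G y Y' Z) : Y = Y' :=
  (h.invertible y hy).injective (ContinuousLinearMap.ext hYY)

theorem fderiv_symm (h : IsMetricOn G Ω) (hy : y ∈ Ω) (X Y Z : V) : fderiv ℝ G y X Y Z = fderiv ℝ G y X Z Y := by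
  have hd : DifferentiableAt ℝ G y := h.smooth.differentiableAt_infty h.isOpen hy
  have e : ∀ A B : V, fderiv ℝ (fun z => G z A B) y X = fderiv ℝ G y X A B := by
    intro A B
    rw [fderiv_clm_apply (hd.clm_apply (by fun_prop)) (by fun_prop),
      fderiv_clm_apply hd (by fun_prop)]
    simp
  rw [← e, ← e]
  congr 1
  exact fderiv_congr_on h.isOpen (fun z hz => h.symm z hz Y Z) hy

theorem christoffel_spec (h : IsMetricOn G Ω) (hy : y ∈ Ω) (X Y Z : V) : G y (coordChristoffel G y X Y) Z =
    (fderiv ℝ G y X Y Z + fderiv ℝ G y Y X Z - fderiv ℝ G y Z X Y) / 2 :=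
  coordChristoffel_spec G y (h.invertible y hy) X Y Z

theorem christoffel_symm (h : IsMetricOn G Ω) (hy : y ∈ Ω) (X Y : V) :
    coordChristoffel G y X Y = coordChristoffel G y Y X := by
  refine h.ext hy fun Z => ?_
  rw [h.christoffel_spec hy, h.christoffel_spec hy, h.fderiv_symm hy Z X Y]
  ring

theorem fderiv_eq (h : IsMetricOn G Ω) (hy : y ∈ Ω) (X Y Z : V) : fderiv ℝ G y X Y Z =
    G y (coordChristoffel G y X Y) Z + G y (coordChristoffel G y X Z) Y := by
  rw [h.christoffel_spec hy, h.christoffel_spec hy, h.fderiv_symm hy X Z Y,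
    h.fderiv_symm hy Y X Z, h.fderiv_symm hy Z X Y]
  ring

/-- The Levi-Civita connection preserves the metric. -/
theorem fderiv_inner (h : IsMetricOn G Ω) (hy : y ∈ Ω) {ξ ζ : V → V} (hξ : DifferentiableAt ℝ ξ y)
    (hζ : DifferentiableAt ℝ ζ y) (Y : V) :
    fderiv ℝ (fun z => G z (ξ z) (ζ z)) y Y =
      G y (covD G ξ y Y) (ζ y) + G y (ξ y) (covD G ζ y Y) := by
  have hd : DifferentiableAt ℝ G y := h.smooth.differentiableAt_infty h.isOpen hy
  rw [fderiv_clm_apply (hd.clm_apply hξ) hζ, fderiv_clm_apply hd hξ]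
  simp only [covD_apply, _root_.add_apply, ContinuousLinearMap.comp_apply,
    ContinuousLinearMap.flip_apply, map_add, h.fderiv_eq hy Y]
  rw [h.symm y hy _ (ξ y)]
  ring

theorem fderiv_flat (h : IsMetricOn G Ω) (hy : y ∈ Ω) {ξ : V → V} (hξ : DifferentiableAt ℝ ξ y) (Y Z : V) :
    fderiv ℝ (fun z => G z (ξ z)) y Y Z =
      G y (covD G ξ y Y) Z + G y (ξ y) (coordChristoffel G y Y Z) := by
  have hd : DifferentiableAt ℝ G y := h.smooth.differentiableAt_infty h.isOpen hy
  rw [fderiv_clm_apply hd hξ]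
  simp only [covD_apply, _root_.add_apply, ContinuousLinearMap.comp_apply,
    ContinuousLinearMap.flip_apply, map_add, h.fderiv_eq hy Y]
  rw [h.symm y hy _ (ξ y)]
  ring

theorem smooth_flat (h : IsMetricOn G Ω) {ξ : V → V} (hξ : ContDiffOn ℝ ∞ ξ Ω) :
    ContDiffOn ℝ ∞ (fun y => G y (ξ y)) Ω :=
  h.smooth.clm_apply hξ

/-- The exterior derivative is the skew part of the covariant derivative. -/
theorem curl_flat (h : IsMetricOn G Ω) (hy : y ∈ Ω) {ξ : V → V} (hξ : DifferentiableAt ℝ ξ y) (Y Z : V) :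
    curl (fun z => G z (ξ z)) y Y Z = G y (covD G ξ y Y) Z - G y (covD G ξ y Z) Y := by
  rw [curl_apply, h.fderiv_flat hy hξ, h.fderiv_flat hy hξ, h.christoffel_symm hy Z Y]
  ring

end IsMetricOn

theorem covD_smul {f : V → ℝ} {ξ : V → V} (hf : DifferentiableAt ℝ f y)
    (hξ : DifferentiableAt ℝ ξ y) (Y : V) :
    covD G (fun z => f z • ξ z) y Y = f y • covD G ξ y Y + fderiv ℝ f y Y • ξ y := by
  rw [covD_apply, covD_apply, fderiv_fun_smul hf hξ]
  simp
  abel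

theorem covD_add {ξ ζ : V → V} (hξ : DifferentiableAt ℝ ξ y)
    (hζ : DifferentiableAt ℝ ζ y) :
    covD G (fun z => ξ z + ζ z) y = covD G ξ y + covD G ζ y := by
  ext Y
  simp only [_root_.add_apply]
  rw [covD_apply, covD_apply, covD_apply, fderiv_fun_add hξ hζ]
  simp
  abel

theorem covD_const_smul {ξ : V → V} (c : ℝ) (hξ : DifferentiableAt ℝ ξ y) :
    covD G (fun z => c • ξ z) y = c • covD G ξ y := by
  ext Y
  rw [covD_smul (differentiableAt_const c) hξ]
  simp

theorem diverg_add {ξ ζ : V → V} (hξ : DifferentiableAt ℝ ξ y)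
    (hζ : DifferentiableAt ℝ ζ y) :
    diverg G (fun z => ξ z + ζ z) y = diverg G ξ y + diverg G ζ y := by
  simp [diverg, covD_add hξ hζ]

theorem diverg_const_smul {ξ : V → V} (c : ℝ) (hξ : DifferentiableAt ℝ ξ y) :
    diverg G (fun z => c • ξ z) y = c * diverg G ξ y := by
  simp [diverg, covD_const_smul c hξ]

theorem diverg_sub {ξ ζ : V → V} (hξ : DifferentiableAt ℝ ξ y)
    (hζ : DifferentiableAt ℝ ζ y) :
    diverg G (fun z => ξ z - ζ z) y = diverg G ξ y - diverg G ζ y := by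
  have := diverg_add (G := G) hξ ((hζ.const_smul (-1 : ℝ)))
  have h2 := diverg_const_smul (G := G) (-1) hζ
  rw [show (-1 : ℝ) • ζ = fun z => (-1 : ℝ) • ζ z from rfl, h2] at this
  simpa [sub_eq_add_neg] using this

theorem covD_congr (hΩ : IsOpen Ω) (hy : y ∈ Ω) {ξ ζ : V → V} (hξ : EqOn ξ ζ Ω) :
    covD G ξ y = covD G ζ y := by
  rw [covD, covD, fderiv_congr_on hΩ hξ hy, hξ hy]

theorem diverg_congr (hΩ : IsOpen Ω) (hy : y ∈ Ω) {ξ ζ : V → V} (hξ : EqOn ξ ζ Ω) :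
    diverg G ξ y = diverg G ζ y := by
  rw [diverg, diverg, covD_congr hΩ hy hξ]

variable [FiniteDimensional ℝ V]

theorem trace_smulRight (φ : V →L[ℝ] ℝ) (v : V) :
    LinearMap.trace ℝ V (φ.smulRight v : V →L[ℝ] V) = φ v := by
  have : ((φ.smulRight v : V →L[ℝ] V) : V →ₗ[ℝ] V) =
      dualTensorHom ℝ V V ((φ : V →ₗ[ℝ] ℝ) ⊗ₜ[ℝ] v) := by
    ext; simp
  rw [this, LinearMap.trace_eq_contract_apply]
  simp

theorem diverg_smul {f : V → ℝ} {ξ : V → V} (hf : DifferentiableAt ℝ f y)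
    (hξ : DifferentiableAt ℝ ξ y) :
    diverg G (fun z => f z • ξ z) y = f y * diverg G ξ y + fderiv ℝ f y (ξ y) := by
  have : covD G (fun z => f z • ξ z) y = f y • covD G ξ y + (fderiv ℝ f y).smulRight (ξ y) := by
    ext Y
    rw [covD_smul hf hξ]
    simp
  rw [diverg, this, diverg, ContinuousLinearMap.toLinearMap_add, map_add,
    ContinuousLinearMap.toLinearMap_smul, map_smul, trace_smulRight, smul_eq_mul]

namespace IsMetricOn

theorem smooth_inverse (h : IsMetricOn G Ω) : ContDiffOn ℝ ∞ (fun y => (G y).inverse) Ω := by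
  have := FiniteDimensional.complete ℝ V
  intro y hy
  exact ((h.invertible y hy).contDiffAt_map_inverse.comp y
    (h.smooth.contDiffAt_infty h.isOpen hy)).contDiffWithinAt

theorem smooth_sharp (h : IsMetricOn G Ω) {γ : V → V →L[ℝ] ℝ} (hγ : ContDiffOn ℝ ∞ γ Ω) :
    ContDiffOn ℝ ∞ (sharp G γ) Ω :=
  h.smooth_inverse.clm_apply hγ

theorem smooth_christoffel (h : IsMetricOn G Ω) : ContDiffOn ℝ ∞ (coordChristoffel G) Ω := by
  have hG := h.smooth.fderiv_infty h.isOpen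
  have hI := h.smooth_inverse
  refine contDiffOn_clm_apply.2 fun X => contDiffOn_clm_apply.2 fun Y => ?_
  have e : ∀ y, coordChristoffel G y X Y = (1 / 2 : ℝ) • ((G y).inverse (fderiv ℝ G y X Y)
      + (G y).inverse (fderiv ℝ G y Y X) - (G y).inverse ((fderiv ℝ G y).flip X |>.flip Y)) := by
    intro y
    simp [coordChristoffel]
  simp only [e]
  have hX : ContDiffOn ℝ ∞ (fun y => fderiv ℝ G y X Y) Ω :=
    (hG.clm_apply contDiffOn_const).clm_apply contDiffOn_const
  have hY : ContDiffOn ℝ ∞ (fun y => fderiv ℝ G y Y X) Ω :=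
    (hG.clm_apply contDiffOn_const).clm_apply contDiffOn_const
  have hK : ContDiffOn ℝ ∞ (fun y => ((fderiv ℝ G y).flip X).flip Y) Ω := by
    refine contDiffOn_clm_apply.2 fun Z => ?_
    simp only [ContinuousLinearMap.flip_apply]
    exact ((hG.clm_apply contDiffOn_const).clm_apply contDiffOn_const).clm_apply contDiffOn_const
  exact (((hI.clm_apply hX).add (hI.clm_apply hY)).sub (hI.clm_apply hK)).const_smul _

theorem smooth_covD (h : IsMetricOn G Ω) {ξ : V → V} (hξ : ContDiffOn ℝ ∞ ξ Ω) : ContDiffOn ℝ ∞ (covD G ξ) Ω := by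
  refine contDiffOn_clm_apply.2 fun Y => ?_
  simp only [covD_apply]
  exact ((hξ.fderiv_infty h.isOpen).clm_apply contDiffOn_const).add
    ((h.smooth_christoffel.clm_apply contDiffOn_const).clm_apply hξ)

theorem smooth_diverg (h : IsMetricOn G Ω) {ξ : V → V} (hξ : ContDiffOn ℝ ∞ ξ Ω) : ContDiffOn ℝ ∞ (diverg G ξ) Ω := by
  have : diverg G ξ = (LinearMap.trace ℝ V ∘ₗ ContinuousLinearMap.coeLM ℝ).toContinuousLinearMap
      ∘ covD G ξ := by
    ext y; simp [diverg]
  rw [this]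
  exact (ContinuousLinearMap.contDiff _).comp_contDiffOn (h.smooth_covD hξ)

/-- The Laplacian is the divergence of the gradient. -/
theorem laplacian_eq (h : IsMetricOn G Ω) {u : V → ℝ} (hu : ContDiffOn ℝ ∞ u Ω) (hy : y ∈ Ω) :
    coordLaplacian G u y = diverg G (sharp G (fderiv ℝ u)) y := by
  rw [coordLaplacian, metricTrace, diverg]
  congr 2
  ext Y
  refine h.ext hy fun Z => ?_
  have hs := (h.smooth_sharp (hu.fderiv_infty h.isOpen)).differentiableAt_infty h.isOpen hy
  -- For ξ = grad u the form G(ξ) is du, so this identity says that the Hessian is ∇ grad u with its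
  -- index lowered.
  have := h.fderiv_flat hy hs Y Z
  rw [fderiv_congr_on h.isOpen (fun z hz => h.sharp_spec hz (fderiv ℝ u)) hy,
    h.sharp_spec hy] at this
  simp [coordHessian, h.invertible y hy]
  linarith

theorem smooth_laplacian (h : IsMetricOn G Ω) {u : V → ℝ} (hu : ContDiffOn ℝ ∞ u Ω) :
    ContDiffOn ℝ ∞ (coordLaplacian G u) Ω :=
  (h.smooth_diverg (h.smooth_sharp (hu.fderiv_infty h.isOpen))).congr
    fun _ hy => h.laplacian_eq hu hy

end IsMetricOn

end Calculus

/-! ### Trace identities, the contracted Ricci identity and the product rule -/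

section Calculus

set_option synthInstance.maxHeartbeats 400000

variable {V : Type*} [NormedAddCommGroup V] [NormedSpace ℝ V]
  {G : V → V →L[ℝ] V →L[ℝ] ℝ} {Ω : Set V} {y : V}

theorem trace_clm_comm (A B : V →L[ℝ] V) :
    LinearMap.trace ℝ V (A ∘L B : V →L[ℝ] V) = LinearMap.trace ℝ V (B ∘L A : V →L[ℝ] V) := by
  simpa using! LinearMap.trace_mul_comm ℝ (A : V →ₗ[ℝ] V) (B : V →ₗ[ℝ] V)

theorem coordLaplacian_congr (hΩ : IsOpen Ω) {u v : V → ℝ} (huv : EqOn u v Ω) (hy : y ∈ Ω) :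
    coordLaplacian G u y = coordLaplacian G v y := by
  have h1 : EqOn (fderiv ℝ u) (fderiv ℝ v) Ω := fun z hz => fderiv_congr_on hΩ huv hz
  rw [coordLaplacian, coordLaplacian, coordHessian, coordHessian, h1 hy,
    fderiv_congr_on hΩ h1 hy]

theorem coordLaplacian_const_mul (c : ℝ) (u : V → ℝ) (y : V) :
    coordLaplacian G (fun z => c * u z) y = c * coordLaplacian G u y := by
  have h1 : (fderiv ℝ fun z => c * u z) = fun z => c • fderiv ℝ u z := by
    ext1 z
    exact congrFun (fderiv_const_smul_field (f := u) c) z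
  have h2 : fderiv ℝ (fun z => c • fderiv ℝ u z) y = c • fderiv ℝ (fderiv ℝ u) y :=
    congrFun (fderiv_const_smul_field (f := fderiv ℝ u) c) y
  have : coordHessian G (fun z => c * u z) y = c • coordHessian G u y := by
    rw [coordHessian, h1, h2, coordHessian]
    ext; simp [mul_sub]
  rw [coordLaplacian, this, coordLaplacian, metricTrace, metricTrace]
  simp

variable [FiniteDimensional ℝ V]

/-- In finite dimension the injective P is an isomorphism, so A and B are conjugate. P will be the
differential of an isometry. -/
theorem trace_eq_of_intertwine (P A B : V →L[ℝ] V) (hP : Function.Injective P)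
    (h : P ∘L A = B ∘L P) :
    LinearMap.trace ℝ V (A : V →L[ℝ] V) = LinearMap.trace ℝ V (B : V →L[ℝ] V) := by
  let e : V ≃ₗ[ℝ] V := LinearEquiv.ofInjectiveEndo (P : V →ₗ[ℝ] V) hP
  have he : e.conj (A : V →ₗ[ℝ] V) = (B : V →ₗ[ℝ] V) := by
    ext v
    rw [LinearEquiv.conj_apply_apply]
    have : ∀ v, e v = P v := fun v => rfl
    rw [this]
    have h2 := congrArg (fun F : V →L[ℝ] V => F (e.symm v)) h
    simp only [ContinuousLinearMap.comp_apply] at h2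
    have h3 : P (e.symm v) = v := by rw [← this]; simp
    rw [h3] at h2
    exact h2
  rw [← he, LinearMap.trace_conj']

/-- The trace of an endomorphism which is skew for a nondegenerate symmetric form vanishes. -/
theorem trace_eq_zero_of_skew {B : V →L[ℝ] V →L[ℝ] ℝ} (hB : B.IsInvertible)
    (F : V →L[ℝ] V) (hF : ∀ Y Z, B (F Y) Z = - B (F Z) Y) (hs : ∀ Y Z, B Y Z = B Z Y) :
    LinearMap.trace ℝ V (F : V →L[ℝ] V) = 0 := by
  obtain ⟨e, he⟩ := hB
  let e' : V ≃ₗ[ℝ] Module.Dual ℝ V := e.toLinearEquiv.trans LinearMap.toContinuousLinearMap.symm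
  have he' : ∀ Y Z, e' Y Z = B Y Z := by
    intro Y Z; rw [← he]; rfl
  -- Under the identification of V with its dual by B, skewness says that F becomes minus its
  -- transpose, so tr F = -tr F.
  have : e'.conj (F : V →ₗ[ℝ] V) = - Module.Dual.transpose (R := ℝ) (F : V →ₗ[ℝ] V) := by
    ext φ Z
    obtain ⟨Y, rfl⟩ := e'.surjective φ
    rw [LinearEquiv.conj_apply_apply]
    simp [he', Module.Dual.transpose_apply]
    rw [hF, hs]
  have h2 := LinearMap.trace_conj' (F : V →ₗ[ℝ] V) e'
  have h3 := LinearMap.map_neg (LinearMap.trace ℝ (Module.Dual ℝ V))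
    (Module.Dual.transpose (R := ℝ) (F : V →ₗ[ℝ] V))
  rw [LinearMap.trace_transpose'] at h3
  rw [this, h3] at h2
  linarith

namespace IsMetricOn

/-- The contracted Ricci identity. -/
theorem diverg_covD (h : IsMetricOn G Ω) (hy : y ∈ Ω) {X Z : V → V} (hX : ContDiffOn ℝ ∞ X Ω)
    (hZ : ContDiffOn ℝ ∞ Z Ω) :
    diverg G (fun z => covD G X z (Z z)) y =
      LinearMap.trace ℝ V (covD G X y ∘L covD G Z y : V →L[ℝ] V)
        + fderiv ℝ (diverg G X) y (Z y) + coordRicci G y (Z y) (X y) := by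
  have hA := h.smooth_covD hX
  have hAd := hA.differentiableAt_infty h.isOpen hy
  have hZd := hZ.differentiableAt_infty h.isOpen hy
  have hXd := hX.differentiableAt_infty h.isOpen hy
  have hΓ := h.smooth_christoffel.differentiableAt_infty h.isOpen hy
  have hDX := (hX.fderiv_infty h.isOpen).differentiableAt_infty h.isOpen hy
  have dA : ∀ Y W, fderiv ℝ (covD G X) y Y W = fderiv ℝ (fderiv ℝ X) y Y W
      + fderiv ℝ (coordChristoffel G) y Y W (X y) + coordChristoffel G y W (fderiv ℝ X y Y) := by
    intro Y W
    have e : fderiv ℝ (fun z => covD G X z W) y Y = fderiv ℝ (covD G X) y Y W := by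
      rw [fderiv_clm_apply hAd (by fun_prop)]; simp
    rw [← e]
    simp only [covD_apply]
    have h1 : DifferentiableAt ℝ (fun z => coordChristoffel G z W) y :=
      hΓ.clm_apply (differentiableAt_const _)
    rw [fderiv_fun_add (hDX.clm_apply (differentiableAt_const _)) (h1.clm_apply hXd),
      fderiv_clm_apply hDX (differentiableAt_const _), fderiv_clm_apply h1 hXd,
      fderiv_clm_apply hΓ (differentiableAt_const _)]
    simp
    abel
  set Γ := coordChristoffel G y with hΓdef
  set A := covD G X y with hAdef
  set z0 := Z y with hz0
  -- N is the covariant derivative of A = ∇X in the direction Z; its commutator terms are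
  -- trace-free, so tr N = Z(div X).
  let N : V →L[ℝ] V := fderiv ℝ (covD G X) y z0 + (Γ z0 ∘L A - A ∘L Γ z0)
  -- The Ricci identity ∇(∇_Z X) = A ∘ ∇Z + ∇_Z A + R(·, Z)X; the trace of the last term is the
  -- Ricci tensor.
  have key : covD G (fun z => covD G X z (Z z)) y =
      A ∘L covD G Z y + N + coordCurvature G y z0 (X y) := by
    ext Y
    rw [covD_apply, fderiv_clm_apply hAd hZd]
    simp only [N, coordCurvature, _root_.add_apply, _root_.sub_apply,
      ContinuousLinearMap.comp_apply, ContinuousLinearMap.flip_apply, dA]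
    rw [← hAdef, ← hz0, ← hΓdef, covD_apply (G := G) Z, map_add, ← hΓdef, ← hz0]
    have hAa : ∀ W, A W = fderiv ℝ X y W + Γ W (X y) := fun W => covD_apply X y W
    rw [hX.fderiv_fderiv_comm h.isOpen hy Y z0, hAa z0, hAa Y, map_add, map_add,
      show Γ z0 Y = Γ Y z0 from h.christoffel_symm hy _ _]
    abel
  have hdiv : fderiv ℝ (diverg G X) y z0 =
      LinearMap.trace ℝ V (fderiv ℝ (covD G X) y z0 : V →L[ℝ] V) := by
    have : diverg G X = (LinearMap.trace ℝ V ∘ₗ ContinuousLinearMap.coeLM ℝ).toContinuousLinearMap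
        ∘ covD G X := by
      ext y; simp [diverg]
    rw [this, fderiv_comp _ (ContinuousLinearMap.differentiableAt _) hAd,
      ContinuousLinearMap.fderiv]
    simp
  have hc := trace_clm_comm (Γ z0) A
  rw [diverg, key, hdiv, coordRicci]
  simp only [N, ContinuousLinearMap.toLinearMap_add, ContinuousLinearMap.toLinearMap_sub, map_add,
    map_sub, hc]
  ring

/-- The product rule for the Laplacian. -/
theorem laplacian_mul (h : IsMetricOn G Ω) {u v : V → ℝ} (hu : ContDiffOn ℝ ∞ u Ω)
    (hv : ContDiffOn ℝ ∞ v Ω) (hy : y ∈ Ω) :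
    coordLaplacian G (fun z => u z * v z) y = u y * coordLaplacian G v y
      + 2 * fderiv ℝ v y (sharp G (fderiv ℝ u) y) + v y * coordLaplacian G u y := by
  have hsu := h.smooth_sharp (hu.fderiv_infty h.isOpen)
  have hsv := h.smooth_sharp (hv.fderiv_infty h.isOpen)
  have hud := fun z (hz : z ∈ Ω) => hu.differentiableAt_infty h.isOpen hz
  have hvd := fun z (hz : z ∈ Ω) => hv.differentiableAt_infty h.isOpen hz
  have e : EqOn (sharp G (fderiv ℝ fun z => u z * v z))
      (fun z => u z • sharp G (fderiv ℝ v) z + v z • sharp G (fderiv ℝ u) z) Ω := by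
    intro z hz
    simp only [sharp]
    rw [fderiv_fun_mul (hud z hz) (hvd z hz)]
    simp
  rw [h.laplacian_eq (hu.mul hv) hy, h.laplacian_eq hu hy, h.laplacian_eq hv hy,
    diverg_congr h.isOpen hy e,
    diverg_add ((hud y hy).fun_smul (hsv.differentiableAt_infty h.isOpen hy))
      ((hvd y hy).fun_smul (hsu.differentiableAt_infty h.isOpen hy)),
    diverg_smul (hud y hy) (hsv.differentiableAt_infty h.isOpen hy),
    diverg_smul (hvd y hy) (hsu.differentiableAt_infty h.isOpen hy)]
  have hsym : fderiv ℝ u y (sharp G (fderiv ℝ v) y) = fderiv ℝ v y (sharp G (fderiv ℝ u) y) := by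
    rw [← h.sharp_spec hy (fderiv ℝ u), ← h.sharp_spec hy (fderiv ℝ v), h.symm y hy]
  rw [hsym]
  ring

theorem laplacian_add (h : IsMetricOn G Ω) {u v : V → ℝ} (hu : ContDiffOn ℝ ∞ u Ω)
    (hv : ContDiffOn ℝ ∞ v Ω) (hy : y ∈ Ω) :
    coordLaplacian G (fun z => u z + v z) y = coordLaplacian G u y + coordLaplacian G v y := by
  have e : EqOn (sharp G (fderiv ℝ fun z => u z + v z))
      (fun z => sharp G (fderiv ℝ u) z + sharp G (fderiv ℝ v) z) Ω := by
    intro z hz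
    simp only [sharp]
    rw [fderiv_fun_add (hu.differentiableAt_infty h.isOpen hz)
      (hv.differentiableAt_infty h.isOpen hz), map_add]
  rw [h.laplacian_eq (hu.add hv) hy, h.laplacian_eq hu hy, h.laplacian_eq hv hy,
    diverg_congr h.isOpen hy e, diverg_add
      ((h.smooth_sharp (hu.fderiv_infty h.isOpen)).differentiableAt_infty h.isOpen hy)
      ((h.smooth_sharp (hv.fderiv_infty h.isOpen)).differentiableAt_infty h.isOpen hy)]

end IsMetricOn

end Calculus

/-! ### Invariance of Laplacian and Ricci tensor under isometries, and constant rescaling -/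

section Pullback

set_option synthInstance.maxHeartbeats 400000

variable {V : Type*} [NormedAddCommGroup V] [NormedSpace ℝ V]

/-- The map `ψ` is a smooth local isometry from `(Ω, G)` to `(Ω', G')`. -/
structure IsIsometryOn (G G' : V → V →L[ℝ] V →L[ℝ] ℝ) (Ω Ω' : Set V) (ψ : V → V) : Prop where
  source : IsMetricOn G Ω
  target : IsMetricOn G' Ω'
  mapsTo : MapsTo ψ Ω Ω'
  smooth : ContDiffOn ℝ ∞ ψ Ω
  pullback : ∀ y ∈ Ω, ∀ Y Z, G y Y Z = G' (ψ y) (fderiv ℝ ψ y Y) (fderiv ℝ ψ y Z)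

namespace IsIsometryOn

variable {G G' : V → V →L[ℝ] V →L[ℝ] ℝ} {Ω Ω' : Set V} {ψ : V → V} {y : V}

theorem injective (h : IsIsometryOn G G' Ω Ω' ψ) (hy : y ∈ Ω) :
    Function.Injective (fderiv ℝ ψ y) := by
  rw [injective_iff_map_eq_zero]
  intro Y hY
  refine h.source.ext hy fun Z => ?_
  rw [h.pullback y hy, hY]
  simp

theorem differentiableAt (h : IsIsometryOn G G' Ω Ω' ψ) (hy : y ∈ Ω) : DifferentiableAt ℝ ψ y :=
  h.smooth.differentiableAt_infty h.source.isOpen hy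

theorem fderiv_comp {W : Type*} [NormedAddCommGroup W] [NormedSpace ℝ W]
    (h : IsIsometryOn G G' Ω Ω' ψ) (hy : y ∈ Ω) {f : V → W} (hf : ContDiffOn ℝ ∞ f Ω') (X : V) :
    fderiv ℝ (fun z => f (ψ z)) y X = fderiv ℝ f (ψ y) (fderiv ℝ ψ y X) := by
  have := _root_.fderiv_comp y (hf.differentiableAt_infty h.target.isOpen (h.mapsTo hy))
    (h.differentiableAt hy)
  rw [show (fun z => f (ψ z)) = f ∘ ψ from rfl, this]
  rfl

theorem fderiv_pullback (h : IsIsometryOn G G' Ω Ω' ψ) (hy : y ∈ Ω) (X Y Z : V) :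
    fderiv ℝ G y X Y Z = fderiv ℝ G' (ψ y) (fderiv ℝ ψ y X) (fderiv ℝ ψ y Y) (fderiv ℝ ψ y Z)
      + G' (ψ y) (fderiv ℝ (fderiv ℝ ψ) y X Y) (fderiv ℝ ψ y Z)
      + G' (ψ y) (fderiv ℝ ψ y Y) (fderiv ℝ (fderiv ℝ ψ) y X Z) := by
  have hd := h.source.smooth.differentiableAt_infty h.source.isOpen hy
  have e : fderiv ℝ (fun z => G z Y Z) y X = fderiv ℝ G y X Y Z := by
    rw [fderiv_clm_apply (hd.clm_apply (by fun_prop)) (by fun_prop),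
      fderiv_clm_apply hd (by fun_prop)]
    simp
  have hψ := (h.smooth.fderiv_infty h.source.isOpen).differentiableAt_infty h.source.isOpen hy
  have hG' : DifferentiableAt ℝ (fun z => G' (ψ z)) y :=
    (h.target.smooth.differentiableAt_infty h.target.isOpen (h.mapsTo hy)).comp y
      (h.differentiableAt hy)
  have h1 : ∀ Y, DifferentiableAt ℝ (fun z => fderiv ℝ ψ z Y) y := fun Y =>
    hψ.clm_apply (differentiableAt_const _)
  -- Differentiating the pullback formula gives one term from the metric and one from each
  -- differential of ψ.
  rw [← e, fderiv_congr_on h.source.isOpen (fun z hz => h.pullback z hz Y Z) hy,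
    fderiv_clm_apply (hG'.clm_apply (h1 Y)) (h1 Z), fderiv_clm_apply hG' (h1 Y),
    fderiv_clm_apply hψ (differentiableAt_const _), fderiv_clm_apply hψ (differentiableAt_const _)]
  simp [h.fderiv_comp hy h.target.smooth]
  ring

variable [FiniteDimensional ℝ V]

theorem surjective (h : IsIsometryOn G G' Ω Ω' ψ) (hy : y ∈ Ω) :
    Function.Surjective (fderiv ℝ ψ y) :=
  (LinearMap.injective_iff_surjective (f := (fderiv ℝ ψ y : V →ₗ[ℝ] V))).1 (h.injective hy)

/-- The transformation law of the Christoffel symbols. -/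
theorem christoffel (h : IsIsometryOn G G' Ω Ω' ψ) (hy : y ∈ Ω) (X Y : V) :
    fderiv ℝ ψ y (coordChristoffel G y X Y) =
      coordChristoffel G' (ψ y) (fderiv ℝ ψ y X) (fderiv ℝ ψ y Y)
        + fderiv ℝ (fderiv ℝ ψ) y X Y := by
  refine h.target.ext (h.mapsTo hy) fun Z' => ?_
  obtain ⟨Z, rfl⟩ := h.surjective hy Z'
  rw [← h.pullback y hy, h.source.christoffel_spec hy, map_add, _root_.add_apply,
    h.target.christoffel_spec (h.mapsTo hy)]
  simp only [h.fderiv_pullback hy]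
  have hc := h.smooth.fderiv_fderiv_comm h.source.isOpen hy
  rw [hc Y X, hc Z X, hc Z Y, h.target.symm _ (h.mapsTo hy) (fderiv ℝ ψ y Y),
    h.target.symm _ (h.mapsTo hy) (fderiv ℝ ψ y X)]
  ring

/-- The Laplacian is invariant under isometries. -/
theorem laplacian (h : IsIsometryOn G G' Ω Ω' ψ) (hy : y ∈ Ω) {u : V → ℝ}
    (hu : ContDiffOn ℝ ∞ u Ω') :
    coordLaplacian G (fun z => u (ψ z)) y = coordLaplacian G' u (ψ y) := by
  have hψ := (h.smooth.fderiv_infty h.source.isOpen).differentiableAt_infty h.source.isOpen hy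
  have hdu := hu.fderiv_infty h.target.isOpen
  have hess : ∀ X Y, coordHessian G (fun z => u (ψ z)) y X Y =
      coordHessian G' u (ψ y) (fderiv ℝ ψ y X) (fderiv ℝ ψ y Y) := by
    intro X Y
    have e1 : fderiv ℝ (fderiv ℝ fun z => u (ψ z)) y X Y =
        fderiv ℝ (fun z => fderiv ℝ u (ψ z) (fderiv ℝ ψ z Y)) y X := by
      have hs : ContDiffOn ℝ ∞ (fun z => u (ψ z)) Ω := hu.comp h.smooth h.mapsTo
      have e2 : fderiv ℝ (fun z => fderiv ℝ (fun z => u (ψ z)) z Y) y X =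
          fderiv ℝ (fderiv ℝ fun z => u (ψ z)) y X Y := by
        rw [fderiv_clm_apply ((hs.fderiv_infty h.source.isOpen).differentiableAt_infty
          h.source.isOpen hy) (differentiableAt_const _)]
        simp
      rw [← e2, fderiv_congr_on h.source.isOpen (fun z hz => h.fderiv_comp hz hu Y) hy]
    have hd : DifferentiableAt ℝ (fun z => fderiv ℝ u (ψ z)) y :=
      (hdu.differentiableAt_infty h.target.isOpen (h.mapsTo hy)).comp y (h.differentiableAt hy)
    have hψY : DifferentiableAt ℝ (fun z => fderiv ℝ ψ z Y) y :=
      hψ.clm_apply (differentiableAt_const _)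
    simp only [coordHessian, _root_.sub_apply, ContinuousLinearMap.comp_apply,
      ContinuousLinearMap.compL_apply]
    rw [e1, fderiv_clm_apply hd hψY, fderiv_clm_apply hψ (differentiableAt_const _),
      h.fderiv_comp hy hu, h.christoffel hy, map_add]
    simp [h.fderiv_comp hy hdu]
    ring
  rw [coordLaplacian, coordLaplacian, metricTrace, metricTrace]
  refine trace_eq_of_intertwine (fderiv ℝ ψ y) _ _ (h.injective hy) ?_
  ext Y
  refine h.target.ext (h.mapsTo hy) fun Z' => ?_
  obtain ⟨Z, rfl⟩ := h.surjective hy Z'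
  simp only [ContinuousLinearMap.comp_apply]
  rw [← h.pullback y hy]
  simp [h.source.invertible y hy, h.target.invertible _ (h.mapsTo hy), hess]

/-- The Ricci tensor is invariant under isometries. -/
theorem ricci (h : IsIsometryOn G G' Ω Ω' ψ) (hy : y ∈ Ω) (Y Z : V) :
    coordRicci G y Y Z = coordRicci G' (ψ y) (fderiv ℝ ψ y Y) (fderiv ℝ ψ y Z) := by
  have hD := h.smooth.fderiv_infty h.source.isOpen
  have hψ := hD.differentiableAt_infty h.source.isOpen hy
  have hψ2 := (hD.fderiv_infty h.source.isOpen).differentiableAt_infty h.source.isOpen hy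
  have hΓ := h.source.smooth_christoffel.differentiableAt_infty h.source.isOpen hy
  have hΓ' : DifferentiableAt ℝ (fun z => coordChristoffel G' (ψ z)) y :=
    (h.target.smooth_christoffel.differentiableAt_infty h.target.isOpen (h.mapsTo hy)).comp y
      (h.differentiableAt hy)
  have hψX : ∀ X, DifferentiableAt ℝ (fun z => fderiv ℝ ψ z X) y := fun X =>
    hψ.clm_apply (differentiableAt_const _)
  have hc := h.smooth.fderiv_fderiv_comm h.source.isOpen hy
  have hc3 : ∀ A B C, fderiv ℝ (fderiv ℝ (fderiv ℝ ψ)) y A B C =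
      fderiv ℝ (fderiv ℝ (fderiv ℝ ψ)) y B A C := by
    intro A B C
    rw [hD.fderiv_fderiv_comm h.source.isOpen hy]
  -- the derivative of the transformation law
  have dchr : ∀ W A B, fderiv ℝ ψ y (fderiv ℝ (coordChristoffel G) y W A B) =
      fderiv ℝ (coordChristoffel G') (ψ y) (fderiv ℝ ψ y W) (fderiv ℝ ψ y A) (fderiv ℝ ψ y B)
      + coordChristoffel G' (ψ y) (fderiv ℝ (fderiv ℝ ψ) y W A) (fderiv ℝ ψ y B)
      + coordChristoffel G' (ψ y) (fderiv ℝ ψ y A) (fderiv ℝ (fderiv ℝ ψ) y W B)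
      + fderiv ℝ (fderiv ℝ (fderiv ℝ ψ)) y W A B
      - fderiv ℝ (fderiv ℝ ψ) y W (coordChristoffel G y A B) := by
    intro W A B
    have e := DFunLike.congr_fun (fderiv_congr_on h.source.isOpen
      (fun z hz => h.christoffel hz A B) hy) W
    have hΓA : DifferentiableAt ℝ (fun z => coordChristoffel G z A) y :=
      hΓ.clm_apply (differentiableAt_const _)
    have hΓAB : DifferentiableAt ℝ (fun z => coordChristoffel G z A B) y :=
      hΓA.clm_apply (differentiableAt_const _)
    have hψ2A : DifferentiableAt ℝ (fun z => fderiv ℝ (fderiv ℝ ψ) z A) y :=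
      hψ2.clm_apply (differentiableAt_const _)
    rw [fderiv_clm_apply hψ hΓAB, fderiv_clm_apply hΓA (differentiableAt_const _),
      fderiv_clm_apply hΓ (differentiableAt_const _),
      fderiv_fun_add ((hΓ'.clm_apply (hψX A)).clm_apply (hψX B))
        (hψ2A.clm_apply (differentiableAt_const _)),
      fderiv_clm_apply (hΓ'.clm_apply (hψX A)) (hψX B), fderiv_clm_apply hΓ' (hψX A),
      fderiv_clm_apply hψ (differentiableAt_const _), fderiv_clm_apply hψ (differentiableAt_const _),
      fderiv_clm_apply hψ2A (differentiableAt_const _),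
      fderiv_clm_apply hψ2 (differentiableAt_const _)] at e
    simp [h.fderiv_comp hy h.target.smooth_christoffel] at e
    rw [eq_sub_iff_add_eq, e]
    abel
  rw [coordRicci, coordRicci]
  refine trace_eq_of_intertwine (fderiv ℝ ψ y) _ _ (h.injective hy) ?_
  ext W
  simp only [coordCurvature, _root_.add_apply, _root_.sub_apply,
    ContinuousLinearMap.comp_apply, ContinuousLinearMap.flip_apply, map_add, map_sub, dchr,
    h.christoffel hy]
  -- The curvature is antisymmetric in W and Y, so the third derivatives of ψ cancel; the second
  -- derivatives cancel between the derivative terms and the quadratic terms.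
  rw [hc3 W Y Z, hc W Y]
  abel

end IsIsometryOn

variable {G : V → V →L[ℝ] V →L[ℝ] ℝ} {Ω : Set V} {y : V}

theorem IsMetricOn.const_smul (h : IsMetricOn G Ω) {c : ℝ} (hc : c ≠ 0) :
    IsMetricOn (fun y => c • G y) Ω where
  isOpen := h.isOpen
  smooth := h.smooth.const_smul c
  symm y hy Y Z := by simp [h.symm y hy Y Z]
  invertible y hy := by
    obtain ⟨e, he⟩ := h.invertible y hy
    refine ⟨e.trans (ContinuousLinearEquiv.smulLeft (Units.mk0 c hc)), ?_⟩
    ext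
    simp [← he]

theorem IsMetricOn.laplacian_const_smul (h : IsMetricOn G Ω) {c : ℝ} (hc : c ≠ 0) (hy : y ∈ Ω)
    (u : V → ℝ) : coordLaplacian (fun y => c • G y) u y = c⁻¹ * coordLaplacian G u y := by
  have h' := h.const_smul hc
  have hd := h.smooth.differentiableAt_infty h.isOpen hy
  have e1 : coordChristoffel (fun y => c • G y) y = coordChristoffel G y := by
    ext X Y
    refine h'.ext hy fun Z => ?_
    rw [h'.christoffel_spec hy, _root_.smul_apply, _root_.smul_apply, h.christoffel_spec hy,
      fderiv_fun_const_smul hd]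
    simp
    ring
  have e2 : (c • G y).inverse ∘L coordHessian G u y =
      c⁻¹ • ((G y).inverse ∘L coordHessian G u y) := by
    ext Y
    refine h'.ext hy fun Z => ?_
    have hi : ∀ φ, (c • G y) ((c • G y).inverse φ) = φ := (h'.invertible y hy).self_apply_inverse
    rw [ContinuousLinearMap.comp_apply, hi]
    simp [h.invertible y hy, hc]
  rw [coordLaplacian, coordHessian, e1, ← coordHessian, metricTrace, e2, coordLaplacian,
    metricTrace]
  simp

end Pullback

/-! ### Smooth dependence of integrals on parameters -/

section Division

open MeasureTheory

variable {V : Type} [NormedAddCommGroup V] [NormedSpace ℝ V] [FiniteDimensional ℝ V]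

/-- Differentiation under the integral sign; the dominating constant is a bound for the derivative
on the compact product of [0, 1] with a small closed ball. -/
theorem hasFDerivAt_intervalIntegral {W : Type} [NormedAddCommGroup W] [NormedSpace ℝ W]
    [CompleteSpace W] {D : Set (ℝ × V)} (hD : IsOpen D) {Ω : Set V} (hΩ : IsOpen Ω)
    (hsub : ∀ s ∈ Icc (0 : ℝ) 1, ∀ y ∈ Ω, (s, y) ∈ D) {F : ℝ × V → W}
    (hF : ContDiffOn ℝ ∞ F D) {y : V} (hy : y ∈ Ω) :
    HasFDerivAt (fun y => ∫ s in (0 : ℝ)..1, F (s, y))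
      (∫ s in (0 : ℝ)..1, fderiv ℝ F (s, y) ∘L ContinuousLinearMap.inr ℝ ℝ V) y := by
  obtain ⟨r, hr, hball⟩ := Metric.nhds_basis_closedBall.mem_iff.1 (hΩ.mem_nhds hy)
  have hF' := hF.fderiv_infty hD
  have hcont : ∀ z ∈ Ω, ContinuousOn (fun s => F (s, z)) (Icc 0 1) := fun z hz =>
    hF.continuousOn.comp (by fun_prop) fun s hs => hsub s hs z hz
  have hcont' : ∀ z ∈ Ω, ContinuousOn
      (fun s => fderiv ℝ F (s, z) ∘L ContinuousLinearMap.inr ℝ ℝ V) (Icc 0 1) := fun z hz =>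
    ((hF'.continuousOn.comp (by fun_prop) fun s hs => hsub s hs z hz).clm_comp continuousOn_const)
  have hK : IsCompact (Icc (0 : ℝ) 1 ×ˢ Metric.closedBall y r) :=
    isCompact_Icc.prod (isCompact_closedBall y r)
  obtain ⟨C, hC⟩ := hK.exists_bound_of_continuousOn (f := fun p => fderiv ℝ F p ∘L
    ContinuousLinearMap.inr ℝ ℝ V) ((hF'.continuousOn.clm_comp continuousOn_const).mono
      fun p hp => hsub p.1 hp.1 p.2 (hball hp.2))
  have huIoc : Ioc (0 : ℝ) 1 ⊆ Icc 0 1 := Ioc_subset_Icc_self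
  refine (intervalIntegral.hasFDerivAt_integral_of_dominated_of_fderiv_le
    (F := fun z s => F (s, z)) (F' := fun z s => fderiv ℝ F (s, z) ∘L
    ContinuousLinearMap.inr ℝ ℝ V) (bound := fun _ => C) (Metric.ball_mem_nhds y hr)
    ?_ ?_ ?_ ?_ ?_ ?_)
  · filter_upwards [hΩ.mem_nhds hy] with z hz
    rw [uIoc_of_le zero_le_one]
    exact ((hcont z hz).mono huIoc).aestronglyMeasurable measurableSet_Ioc
  · exact ContinuousOn.intervalIntegrable (by rw [uIcc_of_le zero_le_one]; exact hcont y hy)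
  · rw [uIoc_of_le zero_le_one]
    exact ((hcont' y hy).mono huIoc).aestronglyMeasurable measurableSet_Ioc
  · refine ae_of_all _ fun s hs z hz => ?_
    rw [uIoc_of_le zero_le_one] at hs
    exact hC (s, z) ⟨huIoc hs, Metric.ball_subset_closedBall hz⟩
  · exact intervalIntegrable_const
  · refine ae_of_all _ fun s hs z hz => ?_
    rw [uIoc_of_le zero_le_one] at hs
    have hd := (hF.differentiableAt_infty hD
      (hsub s (huIoc hs) z (hball (Metric.ball_subset_closedBall hz)))).hasFDerivAt
    exact hd.comp z (hasFDerivAt_prodMk_right s z)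

/-- The derivative of the integral is again such an integral, but with values in V →L[ℝ] W; hence
the codomain is quantified inside the induction. -/
theorem contDiffOn_intervalIntegral_nat (m : ℕ) : ∀ {W : Type} [NormedAddCommGroup W]
    [NormedSpace ℝ W] [CompleteSpace W] {D : Set (ℝ × V)} (_ : IsOpen D) {Ω : Set V}
    (_ : IsOpen Ω) (_ : ∀ s ∈ Icc (0 : ℝ) 1, ∀ y ∈ Ω, (s, y) ∈ D) {F : ℝ × V → W}
    (_ : ContDiffOn ℝ ∞ F D), ContDiffOn ℝ m (fun y => ∫ s in (0 : ℝ)..1, F (s, y)) Ω := by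
  induction m with
  | zero =>
    intro W _ _ _ D hD Ω hΩ hsub F hF
    rw [Nat.cast_zero, contDiffOn_zero]
    exact fun y hy =>
      (hasFDerivAt_intervalIntegral hD hΩ hsub hF hy).continuousAt.continuousWithinAt
  | succ m ih =>
    intro W _ _ _ D hD Ω hΩ hsub F hF
    rw [Nat.cast_succ, contDiffOn_succ_iff_fderiv_of_isOpen hΩ]
    refine ⟨fun y hy => (hasFDerivAt_intervalIntegral hD hΩ hsub hF
      hy).differentiableAt.differentiableWithinAt, by simp, ?_⟩
    exact (ih hD hΩ hsub ((hF.fderiv_infty hD).clm_comp contDiffOn_const)).congr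
      fun y hy => (hasFDerivAt_intervalIntegral hD hΩ hsub hF hy).fderiv

theorem contDiffOn_intervalIntegral {W : Type} [NormedAddCommGroup W] [NormedSpace ℝ W]
    [CompleteSpace W] {D : Set (ℝ × V)} (hD : IsOpen D) {Ω : Set V} (hΩ : IsOpen Ω)
    (hsub : ∀ s ∈ Icc (0 : ℝ) 1, ∀ y ∈ Ω, (s, y) ∈ D) {F : ℝ × V → W}
    (hF : ContDiffOn ℝ ∞ F D) :
    ContDiffOn ℝ ∞ (fun y => ∫ s in (0 : ℝ)..1, F (s, y)) Ω :=
  contDiffOn_infty.2 fun m => contDiffOn_intervalIntegral_nat m hD hΩ hsub hF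

end Division

/-! ### Cone domains

A vector space `V` with a linear function `ρ`, a vector `R` with `ρ R = 1`, and a projection `T`
with `T R = 0`, `ρ ∘ T = 0`; the model is `V = E × ℝ × ℝ` with the coordinates `(x, t, ρ)`, in
which `T` is the value of the vector field `t ∂_t` and `R = ∂_ρ`. -/

/-- The linear data of the coordinates `(x, t, ρ)`. -/
structure ConeFrame (V : Type*) [NormedAddCommGroup V] [NormedSpace ℝ V] where
  /-- the function `ρ` -/
  rho : V →L[ℝ] ℝ
  /-- the vector field `∂_ρ` -/
  vec : V
  /-- the projection to the direction of `∂_t` -/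
  proj : V →L[ℝ] V
  rho_vec : rho vec = 1
  proj_proj : ∀ y, proj (proj y) = proj y
  proj_vec : proj vec = 0
  rho_proj : ∀ y, rho (proj y) = 0

namespace ConeFrame

attribute [simp] rho_vec proj_proj proj_vec rho_proj

section Domain

variable {V : Type*} [NormedAddCommGroup V] [NormedSpace ℝ V] (c : ConeFrame V)

/-- The dilation `(x, t, ρ) ↦ (x, s t, ρ)`. -/
def dil (s : ℝ) : V →L[ℝ] V := ContinuousLinearMap.id ℝ V + (s - 1) • c.proj

/-- The contraction `(x, t, ρ) ↦ (x, t, s ρ)`. -/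
def contr (s : ℝ) : V →L[ℝ] V := ContinuousLinearMap.id ℝ V + (s - 1) • c.rho.smulRight c.vec

theorem dil_apply (s : ℝ) (y : V) : c.dil s y = y + (s - 1) • c.proj y := by simp [dil]

theorem contr_apply (s : ℝ) (y : V) : c.contr s y = y + ((s - 1) * c.rho y) • c.vec := by
  simp [contr, smul_smul]

@[simp] theorem rho_dil (s : ℝ) (y : V) : c.rho (c.dil s y) = c.rho y := by simp [dil_apply]

@[simp] theorem rho_contr (s : ℝ) (y : V) : c.rho (c.contr s y) = s * c.rho y := by
  simp [contr_apply]; ring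

@[simp] theorem dil_vec (s : ℝ) : c.dil s c.vec = c.vec := by simp [dil_apply]

@[simp] theorem proj_dil (s : ℝ) (y : V) : c.proj (c.dil s y) = s • c.proj y := by
  simp only [dil_apply, map_add, map_smul, proj_proj]; module

@[simp] theorem dil_proj (s : ℝ) (y : V) : c.dil s (c.proj y) = s • c.proj y := by
  simp only [dil_apply, proj_proj]; module

theorem contr_dil (s t : ℝ) (y : V) : c.contr s (c.dil t y) = c.dil t (c.contr s y) := by
  simp only [contr_apply, rho_dil, map_add, map_smul, dil_vec]

theorem contr_contr (s t : ℝ) (y : V) : c.contr s (c.contr t y) = c.contr (s * t) y := by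
  simp only [contr_apply, map_add, map_smul, rho_vec, mul_one]
  module

@[simp] theorem contr_one (y : V) : c.contr 1 y = y := by simp [contr_apply]

theorem contr_of_rho (s : ℝ) {y : V} (hy : c.rho y = 0) : c.contr s y = y := by
  simp [contr_apply, hy]

@[simp] theorem dil_one (y : V) : c.dil 1 y = y := by simp [dil_apply]

/-- `Ω` is open, dilation invariant, and star-shaped towards the cone `ρ = 0`. -/
structure IsDomain (Ω : Set V) : Prop where
  isOpen : IsOpen Ω
  star : ∀ y ∈ Ω, ∀ s ∈ Icc (0 : ℝ) 1, c.contr s y ∈ Ω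
  dil : ∀ y ∈ Ω, ∀ s : ℝ, 0 < s → c.dil s y ∈ Ω

/-- The largest subset of `Ω` which is star-shaped towards the cone. -/
def starCore (Ω : Set V) : Set V := {y | ∀ s ∈ Icc (0 : ℝ) 1, c.contr s y ∈ Ω}

theorem starCore_subset (Ω : Set V) : c.starCore Ω ⊆ Ω := fun y hy => by
  simpa using hy 1 (by simp)

theorem mem_starCore {Ω : Set V} {y : V} (hy : y ∈ Ω) (h0 : c.rho y = 0) : y ∈ c.starCore Ω :=
  fun s _ => by rwa [c.contr_of_rho s h0]

theorem continuous_contr : Continuous fun p : ℝ × V => c.contr p.1 p.2 := by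
  simp only [contr_apply]; fun_prop

/-- Passing to the star core makes division by ρ available without losing points of the cone;
dilations survive because they commute with the contractions. -/
theorem isDomain_starCore {Ω : Set V} (hΩ : IsOpen Ω)
    (hd : ∀ y ∈ Ω, ∀ s : ℝ, 0 < s → c.dil s y ∈ Ω) : c.IsDomain (c.starCore Ω) where
  isOpen := by
    rw [isOpen_iff_mem_nhds]
    intro y hy
    -- The tube lemma: a condition open in (z, s) and valid for all s in the compact interval
    -- persists for z near y.
    have := isCompact_Icc.eventually_forall_of_forall_eventually (K := Icc (0 : ℝ) 1) (x₀ := y)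
      (P := fun z s => c.contr s z ∈ Ω) fun s hs =>
        (c.continuous_contr.comp continuous_swap).continuousAt.eventually
          (hΩ.mem_nhds (hy s hs))
    exact this
  star y hy s hs t ht := by
    rw [contr_contr]
    exact hy _ ⟨mul_nonneg ht.1 hs.1, mul_le_one₀ ht.2 hs.1 hs.2⟩
  dil y hy s hs t ht := by
    rw [contr_dil]
    exact hd _ (hy t ht) s hs

/-- Every point is a limit of points off the cone. -/
theorem tendsto_vec (y : V) :
    Filter.Tendsto (fun r : ℝ => y + r • c.vec) (nhdsWithin 0 {0}ᶜ) (nhds y) := by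
  have : ContinuousAt (fun r : ℝ => y + r • c.vec) 0 := by fun_prop
  simpa using this.tendsto.mono_left nhdsWithin_le_nhds

namespace IsDomain

variable {c} {Ω : Set V}

theorem eventually_mem (h : c.IsDomain Ω) {y : V} (hy : y ∈ Ω) :
    ∀ᶠ r : ℝ in nhdsWithin 0 {0}ᶜ, y + r • c.vec ∈ Ω :=
  (c.tendsto_vec y).eventually (h.isOpen.mem_nhds hy)

/-- The limit of a function along the transversal to the cone. -/
theorem tendsto_of_continuousOn (h : c.IsDomain Ω) {W : Type*} [TopologicalSpace W] {f : V → W}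
    (hf : ContinuousOn f Ω) {y : V} (hy : y ∈ Ω) :
    Filter.Tendsto (fun r : ℝ => f (y + r • c.vec)) (nhdsWithin 0 {0}ᶜ) (nhds (f y)) :=
  (hf.continuousAt (h.isOpen.mem_nhds hy)).tendsto.comp (c.tendsto_vec y)

/-- The complement of the cone is dense, so an identity may be divided by powers of ρ and then
extended by continuity. -/
theorem eqOn_of_off_cone (h : c.IsDomain Ω) {W : Type*} [TopologicalSpace W] [T2Space W] {f g : V → W}
    (hf : ContinuousOn f Ω) (hg : ContinuousOn g Ω)
    (hfg : ∀ y ∈ Ω, c.rho y ≠ 0 → f y = g y) {y : V} (hy : y ∈ Ω) : f y = g y := by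
  by_cases h0 : c.rho y = 0
  · refine tendsto_nhds_unique_of_eventuallyEq (h.tendsto_of_continuousOn hf hy)
      (h.tendsto_of_continuousOn hg hy) ?_
    filter_upwards [h.eventually_mem hy, self_mem_nhdsWithin] with r hr hr0
    refine hfg _ hr ?_
    simpa [h0] using hr0
  · exact hfg y hy h0

end IsDomain

end Domain

section Hadamard

variable {V : Type} [NormedAddCommGroup V] [NormedSpace ℝ V] [FiniteDimensional ℝ V]
  {c : ConeFrame V} {Ω : Set V}

/-- A smooth function which vanishes on the cone is divisible by `ρ`. -/
theorem IsDomain.exists_eq_rho_smul (h : c.IsDomain Ω) {W : Type} [NormedAddCommGroup W]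
    [NormedSpace ℝ W] [CompleteSpace W] {f : V → W} (hf : ContDiffOn ℝ ∞ f Ω)
    (h0 : ∀ y ∈ Ω, c.rho y = 0 → f y = 0) :
    ∃ g : V → W, ContDiffOn ℝ ∞ g Ω ∧ ∀ y ∈ Ω, f y = c.rho y • g y := by
  have hsm : ContDiff ℝ ∞ fun p : ℝ × V => c.contr p.1 p.2 := by
    simp only [contr_apply]; fun_prop
  have hD : IsOpen {p : ℝ × V | c.contr p.1 p.2 ∈ Ω} := h.isOpen.preimage c.continuous_contr
  -- Hadamard's quotient: integrate the derivative of f along the segment from the contraction of y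
  -- onto the cone to y, which stays in Ω by star-shapedness.
  refine ⟨fun y => ∫ s in (0 : ℝ)..1, fderiv ℝ f (c.contr s y) c.vec,
    contDiffOn_intervalIntegral hD h.isOpen (fun s hs y hy => h.star y hy s hs)
      (F := fun p => fderiv ℝ f (c.contr p.1 p.2) c.vec)
      (((hf.fderiv_infty h.isOpen).comp hsm.contDiffOn fun p hp => hp).clm_apply
        contDiffOn_const), fun y hy => ?_⟩
  have hder : ∀ s ∈ uIcc (0 : ℝ) 1, HasDerivAt (fun s => f (c.contr s y))
      (c.rho y • fderiv ℝ f (c.contr s y) c.vec) s := by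
    intro s hs
    rw [uIcc_of_le zero_le_one] at hs
    have h1 : HasDerivAt (fun s => c.contr s y) (c.rho y • c.vec) s := by
      simp only [contr_apply]
      have := (((hasDerivAt_id s).sub_const 1).mul_const (c.rho y)).smul_const c.vec
      simpa using this.const_add y
    have h2 := (hf.differentiableAt_infty h.isOpen (h.star y hy s hs)).hasFDerivAt.comp_hasDerivAt
      s h1
    simpa [Function.comp_def] using h2
  have hcont : ContinuousOn (fun s => c.rho y • fderiv ℝ f (c.contr s y) c.vec) (uIcc 0 1) := by
    rw [uIcc_of_le zero_le_one]
    have hc : ContinuousOn (fun s => fderiv ℝ f (c.contr s y)) (Icc 0 1) :=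
      (hf.fderiv_infty h.isOpen).continuousOn.comp (by simp only [contr_apply]; fun_prop)
        fun s hs => h.star y hy s hs
    exact continuousOn_const.smul (hc.clm_apply continuousOn_const)
  have := intervalIntegral.integral_eq_sub_of_hasDerivAt hder hcont.intervalIntegrable
  rw [intervalIntegral.integral_smul, contr_one,
    h0 _ (h.star y hy 0 (by simp)) (by simp), sub_zero] at this
  exact this.symm

end Hadamard

end ConeFrame

/-! ### Homogeneous metrics on cone domains -/

section Cone

set_option synthInstance.maxHeartbeats 400000

variable {V : Type} [NormedAddCommGroup V] [NormedSpace ℝ V]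

/-- A metric on a cone domain which is homogeneous of weight two and for which the generator of the
dilations is orthogonal to the cone. -/
structure IsConeMetric (c : ConeFrame V) (G : V → V →L[ℝ] V →L[ℝ] ℝ) (Ω : Set V) : Prop where
  domain : c.IsDomain Ω
  metric : IsMetricOn G Ω
  proj_ne : ∀ y ∈ Ω, c.proj y ≠ 0
  homogeneous : ∀ y ∈ Ω, ∀ s : ℝ, 0 < s → ∀ Y Z,
    G (c.dil s y) (c.dil s Y) (c.dil s Z) = s ^ 2 * G y Y Z
  null : ∀ y ∈ Ω, c.rho y = 0 → ∀ Z, c.rho Z = 0 → G y (c.proj y) Z = 0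

/-- The one-form dual to the generator of the dilations. -/
def coneForm (c : ConeFrame V) (G : V → V →L[ℝ] V →L[ℝ] ℝ) (y : V) : V →L[ℝ] ℝ :=
  G y (c.proj y)

/-- The square length of the generator of the dilations. -/
def coneSq (c : ConeFrame V) (G : V → V →L[ℝ] V →L[ℝ] ℝ) (y : V) : ℝ :=
  G y (c.proj y) (c.proj y)

/-- The one-form which measures the failure of the metric to be straight. -/
def coneDefect (c : ConeFrame V) (G : V → V →L[ℝ] V →L[ℝ] ℝ) (y : V) : V →L[ℝ] ℝ :=
  coneForm c G y - (1 / 2 : ℝ) • fderiv ℝ (coneSq c G) y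

/-- The skew endomorphism field `F` with `∇ X = id + F`, where `X` generates the dilations. -/
def coneSkew (c : ConeFrame V) (G : V → V →L[ℝ] V →L[ℝ] ℝ) (y : V) : V →L[ℝ] V :=
  (1 / 2 : ℝ) • ((G y).inverse ∘L curl (coneDefect c G) y)

theorem ContDiffOn.curl_infty [FiniteDimensional ℝ V] {Ω : Set V} (hΩ : IsOpen Ω) {γ : V → V →L[ℝ] ℝ}
    (hγ : ContDiffOn ℝ ∞ γ Ω) : ContDiffOn ℝ ∞ (curl γ) Ω := by
  have h1 := hγ.fderiv_infty hΩ
  refine contDiffOn_clm_apply.2 fun Y => contDiffOn_clm_apply.2 fun Z => ?_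
  simp only [curl_apply]
  exact ((h1.clm_apply contDiffOn_const).clm_apply contDiffOn_const).sub
    ((h1.clm_apply contDiffOn_const).clm_apply contDiffOn_const)

namespace IsConeMetric

variable {c : ConeFrame V} {G : V → V →L[ℝ] V →L[ℝ] ℝ} {Ω : Set V} {y : V}

theorem isOpen (h : IsConeMetric c G Ω) : IsOpen Ω := h.domain.isOpen

theorem mono (h : IsConeMetric c G Ω) {Ω' : Set V} (h' : c.IsDomain Ω') (hs : Ω' ⊆ Ω) :
    IsConeMetric c G Ω' where
  domain := h'
  metric := ⟨h'.isOpen, h.metric.smooth.mono hs, fun y hy => h.metric.symm y (hs hy),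
    fun y hy => h.metric.invertible y (hs hy)⟩
  proj_ne y hy := h.proj_ne y (hs hy)
  homogeneous y hy := h.homogeneous y (hs hy)
  null y hy := h.null y (hs hy)

theorem smooth_proj (c : ConeFrame V) (Ω : Set V) : ContDiffOn ℝ ∞ (fun y => c.proj y) Ω :=
  c.proj.contDiff.contDiffOn

theorem smooth_form (h : IsConeMetric c G Ω) : ContDiffOn ℝ ∞ (coneForm c G) Ω :=
  h.metric.smooth_flat (smooth_proj c Ω)

theorem smooth_sq (h : IsConeMetric c G Ω) : ContDiffOn ℝ ∞ (coneSq c G) Ω :=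
  h.smooth_form.clm_apply (smooth_proj c Ω)

theorem smooth_defect (h : IsConeMetric c G Ω) : ContDiffOn ℝ ∞ (coneDefect c G) Ω :=
  h.smooth_form.sub ((h.smooth_sq.fderiv_infty h.isOpen).const_smul _)

/-- The generator of the dilations is a homothety. -/
theorem killing (h : IsConeMetric c G Ω) (hy : y ∈ Ω) (Y Z : V) :
    fderiv ℝ G y (c.proj y) Y Z + G y (c.proj Y) Z + G y Y (c.proj Z) = 2 * G y Y Z := by
  have hd : ∀ Y : V, HasDerivAt (fun s => c.dil s Y) (c.proj Y) 1 := by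
    intro Y
    simp only [ConeFrame.dil_apply]
    simpa using (((hasDerivAt_id (1 : ℝ)).sub_const 1).smul_const (c.proj Y)).const_add Y
  have hG : HasDerivAt (fun s => G (c.dil s y)) (fderiv ℝ G y (c.proj y)) 1 := by
    have := (h.metric.smooth.differentiableAt_infty h.isOpen hy).hasFDerivAt
    rw [show y = c.dil 1 y by simp] at this
    simpa [Function.comp_def] using this.comp_hasDerivAt (1 : ℝ) (hd y)
  have h1 := (hG.clm_apply (hd Y)).clm_apply (hd Z)
  have h2 : HasDerivAt (fun s : ℝ => s ^ 2 * G y Y Z) (2 * G y Y Z) 1 := by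
    simpa using (hasDerivAt_pow 2 (1 : ℝ)).mul_const (G y Y Z)
  have h3 := (h2.congr_of_eventuallyEq (f₁ := fun s => G (c.dil s y) (c.dil s Y) (c.dil s Z)) (by
    filter_upwards [lt_mem_nhds (zero_lt_one' ℝ)] with s hs
    exact h.homogeneous y hy s hs Y Z)).unique h1
  rw [h3]
  simp

theorem covD_proj_apply (y Y : V) :
    covD G (fun y => c.proj y) y Y = c.proj Y + coordChristoffel G y Y (c.proj y) := by
  rw [covD_apply, ContinuousLinearMap.fderiv]

theorem diff_proj (c : ConeFrame V) (y : V) : DifferentiableAt ℝ (fun y => c.proj y) y :=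
  c.proj.differentiableAt

/-- The homothety equation L_X G = 2G in terms of the connection: the symmetric part of ∇X is the
identity. -/
theorem inner_covD_proj_symm (h : IsConeMetric c G Ω) (hy : y ∈ Ω) (Y Z : V) :
    G y (covD G (fun y => c.proj y) y Y) Z + G y (covD G (fun y => c.proj y) y Z) Y =
      2 * G y Y Z := by
  rw [← h.killing hy, covD_proj_apply, covD_proj_apply, h.metric.fderiv_eq hy,
    h.metric.christoffel_symm hy Y, h.metric.christoffel_symm hy Z, map_add, map_add,
    _root_.add_apply, _root_.add_apply, h.metric.symm y hy Y]
  ring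

/-- The defect and the form dual to X differ by the exact form dQ/2. -/
theorem curl_defect (h : IsConeMetric c G Ω) (hy : y ∈ Ω) :
    curl (coneDefect c G) y = curl (coneForm c G) y := by
  have h1 := h.smooth_form.differentiableAt_infty h.isOpen hy
  have h2 := (h.smooth_sq.fderiv_infty h.isOpen).differentiableAt_infty h.isOpen hy
  ext Y Z
  have : fderiv ℝ (coneDefect c G) y = fderiv ℝ (coneForm c G) y -
      (1 / 2 : ℝ) • fderiv ℝ (fderiv ℝ (coneSq c G)) y := by
    have e : coneDefect c G = fun y => coneForm c G y - (1 / 2 : ℝ) • fderiv ℝ (coneSq c G) y := rfl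
    rw [e, fderiv_fun_sub h1 (h2.fun_const_smul _), fderiv_fun_const_smul h2]
  rw [curl_apply, curl_apply, this]
  simp [h.smooth_sq.fderiv_fderiv_comm h.isOpen hy Y Z]

theorem inner_skew (h : IsConeMetric c G Ω) (hy : y ∈ Ω) (Y Z : V) :
    G y (coneSkew c G y Y) Z = 1 / 2 * curl (coneDefect c G) y Y Z := by
  simp [coneSkew, h.metric.invertible y hy]

/-- The symmetric part of ∇X is the identity by homogeneity; the skew part is half the exterior
derivative of X^♭, which may be replaced by that of the defect. -/
theorem covD_proj (h : IsConeMetric c G Ω) (hy : y ∈ Ω) :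
    covD G (fun y => c.proj y) y = ContinuousLinearMap.id ℝ V + coneSkew c G y := by
  ext Y
  refine h.metric.ext hy fun Z => ?_
  have h1 := h.metric.curl_flat hy (diff_proj c y) Y Z
  have h2 := h.inner_covD_proj_symm hy Y Z
  have h3 := h.curl_defect hy
  have h4 : curl (coneForm c G) y Y Z = curl (fun z => G z (c.proj z)) y Y Z := rfl
  rw [_root_.add_apply, map_add, _root_.add_apply, h.inner_skew hy, h3, h4]
  simp only [ContinuousLinearMap.id_apply]
  linarith

theorem fderiv_sq (y Y : V) :
    fderiv ℝ (coneSq c G) y Y = 2 * coneForm c G y Y - 2 * coneDefect c G y Y := by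
  simp [coneDefect]
  ring

/-- Compare two expressions for dQ: 2α - 2β by definition of β, and 2G(∇X, X) = 2α - i_X dβ by
metric compatibility and ∇X = id + F. -/
theorem defect_eq (h : IsConeMetric c G Ω) (hy : y ∈ Ω) (Z : V) :
    coneDefect c G y Z = 1 / 2 * curl (coneDefect c G) y (c.proj y) Z := by
  have h1 : fderiv ℝ (coneSq c G) y Z = 2 * G y (covD G (fun y => c.proj y) y Z) (c.proj y) := by
    have := h.metric.fderiv_inner hy (diff_proj c y) (diff_proj c y) Z
    rw [show coneSq c G = fun z => G z (c.proj z) (c.proj z) from rfl, this,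
      h.metric.symm y hy (c.proj y)]
    ring
  rw [h.covD_proj hy, _root_.add_apply, map_add, _root_.add_apply, h.inner_skew hy,
    curl_swap] at h1
  have h2 : coneForm c G y Z = G y Z (c.proj y) := h.metric.symm y hy _ _
  have h3 := fderiv_sq (c := c) (G := G) y Z
  rw [h1, h2] at h3
  simp only [ContinuousLinearMap.id_apply] at h3
  linarith

theorem defect_proj (h : IsConeMetric c G Ω) (hy : y ∈ Ω) :
    coneDefect c G y (c.proj y) = 0 := by
  rw [h.defect_eq hy, curl_apply]; ring

/-- Equivalently ∇_X X = X + β^♯, so that β vanishes exactly when the orbits are geodesics. -/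
theorem skew_proj (h : IsConeMetric c G Ω) (hy : y ∈ Ω) :
    coneSkew c G y (c.proj y) = sharp G (coneDefect c G) y := by
  refine h.metric.ext hy fun Z => ?_
  rw [h.inner_skew hy, h.metric.sharp_spec hy, h.defect_eq hy]

theorem fderiv_sq_proj (h : IsConeMetric c G Ω) (hy : y ∈ Ω) :
    fderiv ℝ (coneSq c G) y (c.proj y) = 2 * coneSq c G y := by
  rw [fderiv_sq, h.defect_proj hy, coneForm, coneSq]; ring

theorem form_proj (y : V) : coneForm c G y (c.proj y) = coneSq c G y := rfl

theorem sharp_form (h : IsConeMetric c G Ω) (hy : y ∈ Ω) :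
    sharp G (coneForm c G) y = c.proj y :=
  h.metric.ext hy fun Z => by rw [h.metric.sharp_spec hy, coneForm]

/-- The derivative of a one-form `γ` with `γ(X) = 0` in the direction of `X`. -/
theorem fderiv_form_proj {γ : V → V →L[ℝ] ℝ} (hΩ : IsOpen Ω) (hγ : ContDiffOn ℝ ∞ γ Ω)
    (h0 : ∀ y ∈ Ω, γ y (c.proj y) = 0) (hy : y ∈ Ω) (Z : V) :
    fderiv ℝ γ y (c.proj y) Z = curl γ y (c.proj y) Z - γ y (c.proj Z) := by
  have h1 := fderiv_congr_on hΩ h0 hy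
  rw [fderiv_clm_apply (hγ.differentiableAt_infty hΩ hy) (diff_proj c y)] at h1
  have h2 := DFunLike.congr_fun h1 Z
  rw [curl_apply]
  simp at h2
  linarith

theorem trace_skew [FiniteDimensional ℝ V] (h : IsConeMetric c G Ω) (hy : y ∈ Ω) :
    LinearMap.trace ℝ V (coneSkew c G y : V →L[ℝ] V) = 0 :=
  trace_eq_zero_of_skew (h.metric.invertible y hy) _
    (fun Y Z => by rw [h.inner_skew hy, h.inner_skew hy, curl_swap]; ring) (h.metric.symm y hy)

/-- The skew part of ∇X is trace-free. That the value is constant removes the derivative of the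
divergence from the Ricci identity in `diverg_skew`. -/
theorem diverg_proj [FiniteDimensional ℝ V] (h : IsConeMetric c G Ω) (hy : y ∈ Ω) :
    diverg G (fun y => c.proj y) y = Module.finrank ℝ V := by
  rw [diverg, h.covD_proj hy, ContinuousLinearMap.toLinearMap_add, map_add, h.trace_skew hy,
    add_zero]
  exact LinearMap.trace_id ℝ V

theorem smooth_skew [FiniteDimensional ℝ V] (h : IsConeMetric c G Ω) :
    ContDiffOn ℝ ∞ (coneSkew c G) Ω :=
  (h.metric.smooth_inverse.clm_comp (h.smooth_defect.curl_infty h.isOpen)).const_smul _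

/-- The Maxwell equation for the skew endomorphism field. -/
theorem diverg_skew [FiniteDimensional ℝ V] (h : IsConeMetric c G Ω) (hy : y ∈ Ω) {Z : V → V}
    (hZ : ContDiffOn ℝ ∞ Z Ω) :
    diverg G (fun z => coneSkew c G z (Z z)) y =
      LinearMap.trace ℝ V (coneSkew c G y ∘L covD G Z y : V →L[ℝ] V)
        + coordRicci G y (Z y) (c.proj y) := by
  have h1 := h.metric.diverg_covD hy (smooth_proj c Ω) hZ
  have h2 : EqOn (fun z => covD G (fun y => c.proj y) z (Z z))
      (fun z => Z z + coneSkew c G z (Z z)) Ω := by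
    intro z hz
    simp only [h.covD_proj hz]
    simp
  have h3 : fderiv ℝ (diverg G fun y => c.proj y) y = 0 := by
    rw [fderiv_congr_on h.isOpen (fun z hz => h.diverg_proj hz) hy]
    simp
  have hZd := hZ.differentiableAt_infty h.isOpen hy
  have hFZ : DifferentiableAt ℝ (fun z => coneSkew c G z (Z z)) y :=
    (h.smooth_skew.clm_apply hZ).differentiableAt_infty h.isOpen hy
  rw [diverg_congr h.isOpen hy h2, diverg_add hZd hFZ, h3, h.covD_proj hy,
    ContinuousLinearMap.add_comp, ContinuousLinearMap.id_comp,
    ContinuousLinearMap.toLinearMap_add, map_add] at h1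
  simp only [_root_.zero_apply, add_zero] at h1
  have h4 : diverg G Z y = LinearMap.trace ℝ V (covD G Z y : V →L[ℝ] V) := rfl
  linarith

end IsConeMetric

end Cone

/-! ### Vanishing of the defect on the cone -/

section Cone

set_option synthInstance.maxHeartbeats 400000

variable {V : Type} [NormedAddCommGroup V] [NormedSpace ℝ V]

theorem trace_clm_add (A B : V →L[ℝ] V) : LinearMap.trace ℝ V (A + B : V →L[ℝ] V) =
    LinearMap.trace ℝ V (A : V →L[ℝ] V) + LinearMap.trace ℝ V (B : V →L[ℝ] V) := by simp

theorem trace_clm_sub (A B : V →L[ℝ] V) : LinearMap.trace ℝ V (A - B : V →L[ℝ] V) =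
    LinearMap.trace ℝ V (A : V →L[ℝ] V) - LinearMap.trace ℝ V (B : V →L[ℝ] V) := by simp

theorem trace_clm_smul (a : ℝ) (A : V →L[ℝ] V) : LinearMap.trace ℝ V (a • A : V →L[ℝ] V) =
    a * LinearMap.trace ℝ V (A : V →L[ℝ] V) := by simp

variable {c : ConeFrame V} {G : V → V →L[ℝ] V →L[ℝ] ℝ} {Ω : Set V} {y : V}

theorem ConeFrame.IsDomain.fderiv_of_eq_rho_smul (h : c.IsDomain Ω) {W : Type} [NormedAddCommGroup W]
    [NormedSpace ℝ W] {f g : V → W} (hg : ContDiffOn ℝ ∞ g Ω)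
    (hfg : ∀ y ∈ Ω, f y = c.rho y • g y) (hy : y ∈ Ω) (Z : V) :
    fderiv ℝ f y Z = c.rho Z • g y + c.rho y • fderiv ℝ g y Z := by
  rw [fderiv_congr_on h.isOpen hfg hy, fderiv_fun_smul c.rho.differentiableAt
    (hg.differentiableAt_infty h.isOpen hy)]
  simp
  abel

theorem IsConeMetric.sq_eq_zero (h : IsConeMetric c G Ω) (hy : y ∈ Ω) (h0 : c.rho y = 0) : coneSq c G y = 0 :=
  h.null y hy h0 _ (by simp)

/-- X is orthogonal to the tangent vectors of the cone; were it also orthogonal to ∂_ρ, the metric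
would be degenerate. -/
theorem IsConeMetric.form_vec_ne_zero (h : IsConeMetric c G Ω) (hy : y ∈ Ω) (h0 : c.rho y = 0) :
    coneForm c G y c.vec ≠ 0 := by
  intro hv
  refine h.proj_ne y hy (h.metric.ext hy fun Z => ?_)
  have h1 := h.null y hy h0 (Z - c.rho Z • c.vec) (by simp)
  rw [map_sub, map_smul] at h1
  have hv' : G y (c.proj y) c.vec = 0 := hv
  rw [hv'] at h1
  simp at h1
  simp [h1]

/-- The square length of the generator is a defining function of the cone, once the defect
vanishes there. -/
theorem IsConeMetric.fderiv_sq_vec (h : IsConeMetric c G Ω) {q : V → ℝ} (hq : ContDiffOn ℝ ∞ q Ω)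
    (hQ : ∀ y ∈ Ω, coneSq c G y = c.rho y * q y) (hy : y ∈ Ω) (h0 : c.rho y = 0) :
    q y = 2 * coneForm c G y c.vec - 2 * coneDefect c G y c.vec := by
  have h1 := h.domain.fderiv_of_eq_rho_smul hq hQ hy c.vec
  rw [IsConeMetric.fderiv_sq, h0] at h1
  simpa using h1.symm

variable [FiniteDimensional ℝ V]

theorem trace_smulRight_comp (φ : V →L[ℝ] ℝ) (v : V) (L : V →L[ℝ] V) :
    LinearMap.trace ℝ V (φ.smulRight v ∘L L : V →L[ℝ] V) = φ (L v) := by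
  have : φ.smulRight v ∘L L = (φ ∘L L).smulRight v := by ext; simp
  rw [this, trace_smulRight]; rfl

namespace ConeFrame.IsDomain

/-- A one-form which vanishes along the cone is a multiple of `dρ` up to a multiple of `ρ`. -/
theorem exists_form_decomp (h : c.IsDomain Ω) {γ : V → V →L[ℝ] ℝ} (hγ : ContDiffOn ℝ ∞ γ Ω)
    (h0 : ∀ y ∈ Ω, c.rho y = 0 → ∀ Z, c.rho Z = 0 → γ y Z = 0) :
    ∃ τ : V → V →L[ℝ] ℝ, ContDiffOn ℝ ∞ τ Ω ∧
      ∀ y ∈ Ω, γ y = γ y c.vec • c.rho + c.rho y • τ y := by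
  have hs : ContDiffOn ℝ ∞ (fun y => γ y - γ y c.vec • c.rho) Ω :=
    hγ.sub ((hγ.clm_apply contDiffOn_const).smul contDiffOn_const)
  obtain ⟨τ, hτ, e⟩ := h.exists_eq_rho_smul hs fun y hy hr => by
    ext Z
    have := h0 y hy hr (Z - c.rho Z • c.vec) (by simp)
    simp only [map_sub, map_smul, smul_eq_mul] at this
    simp
    linarith
  exact ⟨τ, hτ, fun y hy => by rw [← e y hy]; abel⟩

end ConeFrame.IsDomain

namespace IsConeMetric

theorem exists_sq_eq (h : IsConeMetric c G Ω) : ∃ q : V → ℝ, ContDiffOn ℝ ∞ q Ω ∧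
    ∀ y ∈ Ω, coneSq c G y = c.rho y * q y :=
  h.domain.exists_eq_rho_smul h.smooth_sq fun _ hy h0 => h.sq_eq_zero hy h0

/-- Since Q = 0 on the cone, dQ kills tangent vectors, and so does α because X is orthogonal to the
cone. -/
theorem defect_tangent (h : IsConeMetric c G Ω) (hy : y ∈ Ω) (h0 : c.rho y = 0) {Z : V}
    (hZ : c.rho Z = 0) : coneDefect c G y Z = 0 := by
  obtain ⟨q, hq, hQ⟩ := h.exists_sq_eq
  have h1 := h.domain.fderiv_of_eq_rho_smul hq hQ hy Z
  have h2 : coneForm c G y Z = 0 := h.null y hy h0 Z hZ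
  rw [fderiv_sq, h2, hZ, h0] at h1
  simp at h1
  linarith

/-- If the Ricci curvature of the generator vanishes along the cone, then so does the defect. -/
theorem defect_eq_zero_on_cone (h : IsConeMetric c G Ω) (hN : 2 < Module.finrank ℝ V)
    (hRic : ∀ y ∈ Ω, c.rho y = 0 → Filter.Tendsto
      (fun r : ℝ => coordRicci G (y + r • c.vec) (c.proj y) (c.proj y))
      (nhdsWithin 0 {0}ᶜ) (nhds 0)) (hy : y ∈ Ω) (h0 : c.rho y = 0) :
    coneDefect c G y = 0 := by
  have hΩ := h.isOpen
  obtain ⟨q, hq, hQ⟩ := h.exists_sq_eq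
  obtain ⟨τ, hτ, hα⟩ := h.domain.exists_form_decomp h.smooth_form
    fun y hy h0 Z hZ => h.null y hy h0 Z hZ
  obtain ⟨ξ, hξ, hβ⟩ := h.domain.exists_form_decomp h.smooth_defect
    fun y hy h0 Z hZ => h.defect_tangent hy h0 hZ
  set a : V → ℝ := fun y => coneForm c G y c.vec with ha
  set b : V → ℝ := fun y => coneDefect c G y c.vec with hb
  have hsa : ContDiffOn ℝ ∞ a Ω := h.smooth_form.clm_apply contDiffOn_const
  have hsb : ContDiffOn ℝ ∞ b Ω := h.smooth_defect.clm_apply contDiffOn_const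
  set N := sharp G fun _ => c.rho with hNdef
  have hsN : ContDiffOn ℝ ∞ N Ω := h.metric.smooth_sharp contDiffOn_const
  have hsτ := h.metric.smooth_sharp hτ
  have hsξ := h.metric.smooth_sharp hξ
  have dif : ∀ {W : Type} [NormedAddCommGroup W] [NormedSpace ℝ W] {f : V → W},
      ContDiffOn ℝ ∞ f Ω → DifferentiableAt ℝ f y := fun hf => hf.differentiableAt_infty hΩ hy
  have hdρ : DifferentiableAt ℝ (fun y => c.rho y) y := c.rho.differentiableAt
  -- the contractions with the generator
  have hτX : τ y (c.proj y) = q y := by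
    refine h.domain.eqOn_of_off_cone (hτ.continuousOn.clm_apply (c.proj.continuous.continuousOn))
      hq.continuousOn (fun y hy hr => ?_) hy
    have := congrArg (fun L : V →L[ℝ] ℝ => L (c.proj y)) (hα y hy)
    simp only [form_proj, hQ y hy, _root_.add_apply, _root_.smul_apply, c.rho_proj,
      smul_eq_mul, mul_zero, zero_add] at this
    exact (mul_left_cancel₀ hr this).symm
  have hξX : ξ y (c.proj y) = 0 := by
    refine h.domain.eqOn_of_off_cone (g := fun _ => 0)
      (hξ.continuousOn.clm_apply (c.proj.continuous.continuousOn))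
      continuousOn_const (fun y hy hr => ?_) hy
    have := congrArg (fun L : V →L[ℝ] ℝ => L (c.proj y)) (hβ y hy)
    simp only [h.defect_proj hy, _root_.add_apply, _root_.smul_apply, c.rho_proj,
      smul_eq_mul, mul_zero, zero_add] at this
    exact (mul_eq_zero.1 this.symm).resolve_left hr
  -- On the cone α = a dρ, so X is a times the gradient N of ρ; derivatives along N thus become
  -- derivatives along X, known from weights.
  have hX : c.proj y = a y • N y := by
    refine h.metric.ext hy fun Z => ?_
    have := congrArg (fun L : V →L[ℝ] ℝ => L Z) (hα y hy)
    simp only [h0, zero_smul, add_zero] at this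
    rw [map_smul, hNdef, _root_.smul_apply, h.metric.sharp_spec hy]
    exact this
  have flat : ∀ Z, a y * c.rho Z = G y (c.proj y) Z := by
    intro Z
    rw [hX, map_smul, _root_.smul_apply, hNdef, h.metric.sharp_spec hy, smul_eq_mul]
  have flat' : ∀ γ : V → V →L[ℝ] ℝ, a y * c.rho (sharp G γ y) = γ y (c.proj y) := by
    intro γ
    rw [flat, h.metric.symm y hy, h.metric.sharp_spec hy]
  have hqy := h.fderiv_sq_vec hq hQ hy h0
  -- weights
  have hda : fderiv ℝ a y (c.proj y) = 2 * a y := by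
    have hG := dif h.metric.smooth
    have hf : DifferentiableAt ℝ (coneForm c G) y := dif h.smooth_form
    have := h.killing hy (c.proj y) c.vec
    have e1 : fderiv ℝ (coneForm c G) y (c.proj y) c.vec =
        fderiv ℝ G y (c.proj y) (c.proj y) c.vec + G y (c.proj y) c.vec := by
      rw [show coneForm c G = fun y => G y (c.proj y) from rfl,
        fderiv_clm_apply hG (diff_proj c y)]
      simp [add_comm]
    rw [ha, fderiv_clm_apply hf (differentiableAt_const _)]
    simp at this ⊢
    rw [e1, coneForm]
    linarith
  have hdb : fderiv ℝ b y (c.proj y) = 2 * b y := by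
    have hf : DifferentiableAt ℝ (coneDefect c G) y := dif h.smooth_defect
    have := fderiv_form_proj hΩ h.smooth_defect (fun z hz => h.defect_proj hz) hy c.vec
    have h2 := h.defect_eq hy c.vec
    rw [hb, fderiv_clm_apply hf (differentiableAt_const _)]
    simp at this ⊢
    linarith
  -- the divergence of the generator
  have e1 : a y * (Module.finrank ℝ V : ℝ) = a y ^ 2 * diverg G N y + 2 * a y + q y := by
    have e : EqOn (fun y => c.proj y) (fun y => a y • N y + c.rho y • sharp G τ y) Ω := by
      intro z hz
      simp only
      rw [← h.sharp_form hz, sharp, hα z hz]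
      simp [hNdef, sharp, ha]
    have := h.diverg_proj hy
    rw [diverg_congr hΩ hy e, diverg_add ((dif hsa).fun_smul (dif hsN))
      (hdρ.fun_smul (dif hsτ)), diverg_smul (dif hsa) (dif hsN), diverg_smul hdρ (dif hsτ), h0,
      ContinuousLinearMap.fderiv] at this
    rw [← this, ← hτX, ← flat' τ]
    have h3 : fderiv ℝ a y (c.proj y) = a y * fderiv ℝ a y (N y) := by rw [hX]; simp
    have h4 : (fderiv ℝ fun y => c.rho y) y = c.rho := ContinuousLinearMap.fderiv _
    rw [h3] at hda
    linear_combination hda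
  -- the divergence of the defect
  have e2 : a y * diverg G (fun z => coneSkew c G z (c.proj z)) y =
      2 * b y + a y * b y * diverg G N y := by
    have e : EqOn (fun z => coneSkew c G z (c.proj z))
        (fun y => b y • N y + c.rho y • sharp G ξ y) Ω := by
      intro z hz
      simp only
      rw [h.skew_proj hz, sharp, hβ z hz]
      simp [hNdef, sharp, hb]
    rw [diverg_congr hΩ hy e, diverg_add ((dif hsb).fun_smul (dif hsN))
      (hdρ.fun_smul (dif hsξ)), diverg_smul (dif hsb) (dif hsN), diverg_smul hdρ (dif hsξ), h0,
      ContinuousLinearMap.fderiv]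
    have h3 : fderiv ℝ b y (c.proj y) = a y * fderiv ℝ b y (N y) := by rw [hX]; simp
    have h5 := flat' ξ
    rw [hξX] at h5
    rw [h3] at hdb
    linear_combination hdb + h5
  -- the square of the skew endomorphism
  set m := sharp G (fun y => ξ y - fderiv ℝ b y) with hm
  -- On the cone dβ = (db - ξ) ∧ dρ, so F has rank at most two and its square has a trace computable
  -- from pairings of ξ - db and ρ with N and m.
  have hF : coneSkew c G y = (1 / 2 : ℝ) • (c.rho.smulRight (m y) -
      (ξ y - fderiv ℝ b y).smulRight (N y)) := by
    ext Y
    refine h.metric.ext hy fun Z => ?_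
    have hdβ : fderiv ℝ (coneDefect c G) y =
        (fderiv ℝ b y).smulRight c.rho + c.rho.smulRight (ξ y) := by
      rw [fderiv_congr_on hΩ hβ hy, fderiv_fun_add
        ((dif hsb).fun_smul (differentiableAt_const _)) (hdρ.fun_smul (dif hξ)),
        fderiv_fun_smul (dif hsb) (differentiableAt_const _), fderiv_fun_smul hdρ (dif hξ), h0]
      ext Y Z
      have h4 : (fderiv ℝ fun y => c.rho y) y = c.rho := ContinuousLinearMap.fderiv _
      simp [h4]
    rw [h.inner_skew hy, curl_apply, hdβ]
    simp only [_root_.add_apply, _root_.smul_apply, _root_.sub_apply,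
      ContinuousLinearMap.smulRight_apply, map_smul, map_sub, hm, hNdef,
      h.metric.sharp_spec hy, smul_eq_mul]
    ring
  have e3 : a y ^ 2 * LinearMap.trace ℝ V (coneSkew c G y ∘L coneSkew c G y : V →L[ℝ] V) =
      2 * b y ^ 2 := by
    have h1 : c.rho (N y) * a y = 0 := by
      have := flat' fun _ => c.rho
      simp at this
      simpa [mul_comm] using this
    have h2 : a y * c.rho (m y) = - 2 * b y := by
      rw [hm, flat', _root_.sub_apply, hξX, hdb]; ring
    have h3 : a y * (ξ y - fderiv ℝ b y) (N y) = - 2 * b y := by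
      have : a y * (ξ y - fderiv ℝ b y) (N y) = (ξ y - fderiv ℝ b y) (c.proj y) := by
        rw [hX, map_smul, smul_eq_mul]
      rw [this, _root_.sub_apply, hξX, hdb]; ring
    rw [hF, ContinuousLinearMap.smul_comp, trace_clm_smul, ContinuousLinearMap.sub_comp,
      trace_clm_sub, trace_smulRight_comp, trace_smulRight_comp]
    simp only [_root_.smul_apply, _root_.sub_apply,
      ContinuousLinearMap.smulRight_apply, map_smul, map_sub, smul_eq_mul] at h3 ⊢
    set μm := (ξ y) (m y) - (fderiv ℝ b y) (m y)
    set μN := (ξ y) (N y) - (fderiv ℝ b y) (N y)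
    linear_combination (1 / 4) * (a y * c.rho (m y) - 2 * b y) * h2
      + (1 / 4) * (a y * μN - 2 * b y) * h3 - (1 / 2) * a y * μm * h1
  -- the Ricci curvature
  have hric : coordRicci G y (c.proj y) (c.proj y) = 0 := by
    have hex : ∀ z ∈ Ω, coordRicci G z (c.proj z) (c.proj z) =
        diverg G (fun z => coneSkew c G z (c.proj z)) z -
        LinearMap.trace ℝ V (coneSkew c G z ∘L covD G (fun y => c.proj y) z : V →L[ℝ] V) := by
      intro z hz
      rw [h.diverg_skew hz (smooth_proj c Ω)]; ring
    have hcont : ContinuousOn (fun z => diverg G (fun z => coneSkew c G z (c.proj z)) z -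
        LinearMap.trace ℝ V (coneSkew c G z ∘L covD G (fun y => c.proj y) z : V →L[ℝ] V)) Ω := by
      refine (h.metric.smooth_diverg (h.smooth_skew.clm_apply
        (smooth_proj c Ω))).continuousOn.sub ?_
      exact (LinearMap.continuous_of_finiteDimensional
        (LinearMap.trace ℝ V ∘ₗ ContinuousLinearMap.coeLM ℝ)).comp_continuousOn
        (h.smooth_skew.clm_comp (h.metric.smooth_covD (smooth_proj c Ω))).continuousOn
    have h1 := h.domain.tendsto_of_continuousOn hcont hy
    rw [hex y hy]
    -- The Maxwell equation writes Ric(X, X) as a continuous function, so its value on the cone is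
    -- its limit along ∂_ρ.
    refine tendsto_nhds_unique h1 ((hRic y hy h0).congr' ?_)
    filter_upwards [h.domain.eventually_mem hy] with r hr
    rw [← hex _ hr]
    simp
  have e4 := h.diverg_skew hy (smooth_proj c Ω)
  rw [h.covD_proj hy, ContinuousLinearMap.comp_add, trace_clm_add, ContinuousLinearMap.comp_id,
    h.trace_skew hy, hric] at e4
  have ha0 : a y ≠ 0 := h.form_vec_ne_zero hy h0
  have hbz : b y = 0 := by
    -- With Ric(X, X) = 0 the Maxwell equation reads div(FX) = tr F². Eliminating div N and using q
    -- = 2a - 2b leaves ab(N - 2) = 0, where a ≠ 0.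
    have h1 : a y * b y * ((Module.finrank ℝ V : ℝ) - 2) = 0 := by
      have hqy' : q y = 2 * a y - 2 * b y := hqy
      rw [e4] at e2
      linear_combination b y * e1 - a y * e2 + e3 + b y * hqy'
    have hN' : (2 : ℝ) < Module.finrank ℝ V := by exact_mod_cast hN
    rcases mul_eq_zero.1 h1 with h2 | h2
    · exact (mul_eq_zero.1 h2).resolve_left ha0
    · linarith
  have := hβ y hy
  rw [this, h0]
  have hbz' : coneDefect c G y c.vec = 0 := hbz
  simp [hbz']

end IsConeMetric

end Cone

/-! ### Raising the order of vanishing of the defect -/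

section Cone

set_option synthInstance.maxHeartbeats 400000

variable {V : Type} [NormedAddCommGroup V] [NormedSpace ℝ V]

/-- The one-form `γ` is the quotient of the defect by the power `Q ^ m` of the defining function
`Q = ρ q` of the cone. -/
structure IsDefectQuotient (c : ConeFrame V) (G : V → V →L[ℝ] V →L[ℝ] ℝ) (Ω : Set V)
    (q : V → ℝ) (m : ℕ) (γ : V → V →L[ℝ] ℝ) : Prop where
  cone : IsConeMetric c G Ω
  smooth_q : ContDiffOn ℝ ∞ q Ω
  sq_eq : ∀ y ∈ Ω, coneSq c G y = c.rho y * q y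
  q_ne : ∀ y ∈ Ω, q y ≠ 0
  smooth : ContDiffOn ℝ ∞ γ Ω
  defect_eq : ∀ y ∈ Ω, coneDefect c G y = coneSq c G y ^ m • γ y

/-- The endomorphism field dual to the exterior derivative of a one-form. -/
def sharpCurl (G : V → V →L[ℝ] V →L[ℝ] ℝ) (γ : V → V →L[ℝ] ℝ) (y : V) : V →L[ℝ] V :=
  (G y).inverse ∘L curl γ y

namespace IsDefectQuotient

variable {c : ConeFrame V} {G : V → V →L[ℝ] V →L[ℝ] ℝ} {Ω : Set V} {y : V} {q : V → ℝ} {m : ℕ}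
  {γ : V → V →L[ℝ] ℝ}

theorem isOpen (h : IsDefectQuotient c G Ω q m γ) : IsOpen Ω := h.cone.isOpen

theorem sq_ne (h : IsDefectQuotient c G Ω q m γ) (hy : y ∈ Ω) (h0 : c.rho y ≠ 0) :
    coneSq c G y ≠ 0 := by
  rw [h.sq_eq y hy]; exact mul_ne_zero h0 (h.q_ne y hy)

theorem inner_sharpCurl (h : IsDefectQuotient c G Ω q m γ) (hy : y ∈ Ω) (Y Z : V) :
    G y (sharpCurl G γ y Y) Z = curl γ y Y Z := by
  simp [sharpCurl, h.cone.metric.invertible y hy]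

/-- Cancellation of powers of the defining function. -/
theorem cancel (h : IsDefectQuotient c G Ω q m γ) (l : ℕ) {f g : V → ℝ} (hf : ContinuousOn f Ω)
    (hg : ContinuousOn g Ω)
    (hfg : ∀ y ∈ Ω, coneSq c G y ^ l * f y = coneSq c G y ^ l * g y) (hy : y ∈ Ω) : f y = g y :=
  h.cone.domain.eqOn_of_off_cone hf hg
    (fun y hy h0 => mul_left_cancel₀ (pow_ne_zero _ (h.sq_ne hy h0)) (hfg y hy)) hy

theorem form_proj (h : IsDefectQuotient c G Ω q m γ) (hy : y ∈ Ω) : γ y (c.proj y) = 0 := by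
  refine h.cancel m (f := fun y => γ y (c.proj y)) (g := fun _ => 0)
    (h.smooth.clm_apply (IsConeMetric.smooth_proj c Ω)).continuousOn
    continuousOn_const (fun y hy => ?_) hy
  have := h.cone.defect_proj hy
  rw [h.defect_eq y hy] at this
  simpa using this

theorem fderiv_sq (h : IsDefectQuotient c G Ω q m γ) (hy : y ∈ Ω) (Z : V) :
    fderiv ℝ (coneSq c G) y Z = 2 * coneForm c G y Z - 2 * (coneSq c G y ^ m * γ y Z) := by
  rw [IsConeMetric.fderiv_sq, h.defect_eq y hy]; simp

/-- Q = ρq has weight 2 and ρ has weight 0, so q has weight 2 off the cone, hence everywhere by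
continuity. -/
theorem fderiv_q_proj (h : IsDefectQuotient c G Ω q m γ) (hy : y ∈ Ω) :
    fderiv ℝ q y (c.proj y) = 2 * q y := by
  refine h.cone.domain.eqOn_of_off_cone (f := fun y => fderiv ℝ q y (c.proj y))
    (g := fun y => 2 * q y)
    ((h.smooth_q.fderiv_infty h.isOpen).clm_apply (IsConeMetric.smooth_proj c Ω)).continuousOn
    (continuousOn_const.mul h.smooth_q.continuousOn) (fun y hy h0 => ?_) hy
  have h1 := h.cone.domain.fderiv_of_eq_rho_smul h.smooth_q h.sq_eq hy (c.proj y)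
  rw [h.cone.fderiv_sq_proj hy, h.sq_eq y hy] at h1
  simp at h1
  exact mul_left_cancel₀ h0 (by linarith)

/-- A smooth function which vanishes along the cone is divisible by the defining function. -/
theorem exists_eq_sq_smul [FiniteDimensional ℝ V] (h : IsDefectQuotient c G Ω q m γ) {W : Type}
    [NormedAddCommGroup W] [NormedSpace ℝ W] [CompleteSpace W] {f : V → W}
    (hf : ContDiffOn ℝ ∞ f Ω) (h0 : ∀ y ∈ Ω, c.rho y = 0 → f y = 0) :
    ∃ g : V → W, ContDiffOn ℝ ∞ g Ω ∧ ∀ y ∈ Ω, f y = coneSq c G y • g y := by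
  obtain ⟨g, hg, e⟩ := h.cone.domain.exists_eq_rho_smul hf h0
  refine ⟨fun y => (q y)⁻¹ • g y, (h.smooth_q.inv h.q_ne).smul hg, fun y hy => ?_⟩
  rw [e y hy, h.sq_eq y hy, smul_smul, mul_assoc, mul_inv_cancel₀ (h.q_ne y hy), mul_one]

theorem fderiv_pow (h : IsDefectQuotient c G Ω q m γ) (hy : y ∈ Ω) (l : ℕ) :
    fderiv ℝ (fun z => coneSq c G z ^ l) y =
      (l * coneSq c G y ^ (l - 1)) • fderiv ℝ (coneSq c G) y := by
  have := h.cone.smooth_sq.differentiableAt_infty h.isOpen hy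
  rw [fderiv_fun_pow l this]
  simp

theorem fderiv_pow_proj (h : IsDefectQuotient c G Ω q m γ) (hy : y ∈ Ω) (l : ℕ) :
    fderiv ℝ (fun z => coneSq c G z ^ l) y (c.proj y) = 2 * l * coneSq c G y ^ l := by
  rw [h.fderiv_pow hy, _root_.smul_apply, h.cone.fderiv_sq_proj hy, smul_eq_mul]
  cases l with
  | zero => simp
  | succ l => simp only [Nat.add_sub_cancel]; ring

/-- Since α(γ^♯) = γ(X) = 0, only the defect term of dQ = 2α - 2Q^m γ contributes. -/
theorem fderiv_sq_sharp (h : IsDefectQuotient c G Ω q m γ) (hy : y ∈ Ω) :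
    fderiv ℝ (coneSq c G) y (sharp G γ y) = - 2 * (coneSq c G y ^ m * γ y (sharp G γ y)) := by
  have h1 : coneForm c G y (sharp G γ y) = 0 := by
    rw [coneForm, h.cone.metric.symm y hy, h.cone.metric.sharp_spec hy, h.form_proj hy]
  rw [h.fderiv_sq hy, h1]; ring

/-- The limit along the transversal to the cone of a function divided by a power of `ρ`. -/
theorem tendsto_div_pow (h : IsDefectQuotient c G Ω q m γ) (l : ℕ) {f g : V → ℝ}
    (hg : ContinuousOn g Ω) (hfg : ∀ y ∈ Ω, f y = coneSq c G y ^ l * g y) (hy : y ∈ Ω)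
    (h0 : c.rho y = 0) :
    Filter.Tendsto (fun r : ℝ => f (y + r • c.vec) / r ^ l) (nhdsWithin 0 {0}ᶜ)
      (nhds (q y ^ l * g y)) := by
  refine (h.cone.domain.tendsto_of_continuousOn ((h.smooth_q.continuousOn.pow l).mul hg) hy).congr'
    ?_
  filter_upwards [h.cone.domain.eventually_mem hy, self_mem_nhdsWithin] with r hr hr0
  have hr0' : r ≠ 0 := hr0
  have h1 : c.rho (y + r • c.vec) = r := by simp [h0]
  simp only [Pi.mul_apply, Pi.pow_apply]
  rw [hfg _ hr, h.sq_eq _ hr, h1, mul_pow]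
  field_simp

section Succ

variable {l : ℕ}

theorem fderiv_pow_sharp (h : IsDefectQuotient c G Ω q (l + 1) γ) (hy : y ∈ Ω) :
    fderiv ℝ (fun z => coneSq c G z ^ l) y (sharp G γ y) =
      - 2 * l * (coneSq c G y ^ (2 * l) * γ y (sharp G γ y)) := by
  rw [h.fderiv_pow hy, _root_.smul_apply, h.fderiv_sq_sharp hy, smul_eq_mul]
  cases l with
  | zero => simp
  | succ l => simp only [Nat.add_sub_cancel]; ring

/-- The exterior derivative of the defect. -/
theorem curl_defect (h : IsDefectQuotient c G Ω q (l + 1) γ) (hy : y ∈ Ω) (Y Z : V) :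
    curl (coneDefect c G) y Y Z = 2 * (l + 1) * coneSq c G y ^ l *
      (coneForm c G y Y * γ y Z - coneForm c G y Z * γ y Y)
      + coneSq c G y ^ (l + 1) * curl γ y Y Z := by
  have hp : DifferentiableAt ℝ (fun z => coneSq c G z ^ (l + 1)) y :=
    (h.cone.smooth_sq.differentiableAt_infty h.isOpen hy).fun_pow _
  have hγ := h.smooth.differentiableAt_infty h.isOpen hy
  have e : fderiv ℝ (coneDefect c G) y = coneSq c G y ^ (l + 1) • fderiv ℝ γ y +
      (fderiv ℝ (fun z => coneSq c G z ^ (l + 1)) y).smulRight (γ y) := by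
    rw [fderiv_congr_on h.isOpen h.defect_eq hy, fderiv_fun_smul hp hγ]
  rw [curl_apply, e, h.fderiv_pow hy]
  simp only [_root_.add_apply, _root_.smul_apply, ContinuousLinearMap.smulRight_apply,
    smul_eq_mul, h.fderiv_sq hy, curl_apply, Nat.add_sub_cancel]
  push_cast
  ring

theorem skew_apply (h : IsDefectQuotient c G Ω q (l + 1) γ) (hy : y ∈ Ω) (Y : V) :
    coneSkew c G y Y = ((l + 1) * coneSq c G y ^ l) •
      (coneForm c G y Y • sharp G γ y - γ y Y • c.proj y)
      + (1 / 2 * coneSq c G y ^ (l + 1)) • sharpCurl G γ y Y := by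
  refine h.cone.metric.ext hy fun Z => ?_
  rw [h.cone.inner_skew hy, h.curl_defect hy]
  simp only [map_add, map_sub, map_smul, _root_.add_apply, _root_.sub_apply, _root_.smul_apply,
    smul_eq_mul, h.cone.metric.sharp_spec hy, h.inner_sharpCurl hy]
  rw [show G y (c.proj y) Z = coneForm c G y Z from rfl]
  ring

theorem skew_eq (h : IsDefectQuotient c G Ω q (l + 1) γ) (hy : y ∈ Ω) :
    coneSkew c G y = ((l + 1) * coneSq c G y ^ l) •
      ((coneForm c G y).smulRight (sharp G γ y) - (γ y).smulRight (c.proj y))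
      + (1 / 2 * coneSq c G y ^ (l + 1)) • sharpCurl G γ y := by
  ext Y
  rw [h.skew_apply hy]
  simp

variable [FiniteDimensional ℝ V]

/-- The exterior derivative of the quotient, contracted with the generator. -/
theorem curl_proj (h : IsDefectQuotient c G Ω q (l + 1) γ) (hy : y ∈ Ω) (Z : V) :
    curl γ y (c.proj y) Z = - 2 * l * γ y Z := by
  -- Insert β = Q^{l+1}γ into β = ½ i_X dβ and divide by Q^{l+1}: differentiating the power
  -- contributes 2(l + 1)γ, leaving i_X dγ = -2lγ.
  refine h.cancel (l + 1) (f := fun y => curl γ y (c.proj y) Z)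
    (g := fun y => - 2 * l * γ y Z)
    ((((h.smooth.curl_infty h.isOpen).clm_apply (IsConeMetric.smooth_proj c Ω)).clm_apply
      contDiffOn_const).continuousOn)
    ((continuousOn_const.mul (h.smooth.clm_apply contDiffOn_const).continuousOn))
    (fun y hy => ?_) hy
  have h1 := h.cone.defect_eq hy Z
  rw [h.curl_defect hy, h.form_proj hy, h.defect_eq y hy, IsConeMetric.form_proj,
    _root_.smul_apply, smul_eq_mul] at h1
  linear_combination -2 * h1

/-- The commutator of the generator and the field dual to the quotient. -/
theorem inner_commutator (h : IsDefectQuotient c G Ω q (l + 1) γ) (hy : y ∈ Ω) (Z : V) :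
    G y (covD G (fun y => c.proj y) y (sharp G γ y)) Z
      - G y (covD G (sharp G γ) y (c.proj y)) Z = 2 * (l + 1) * γ y Z := by
  have hM := h.cone.metric
  have hζ := (hM.smooth_sharp h.smooth).differentiableAt_infty h.isOpen hy
  have h1 : curl γ y = curl (fun z => G z (sharp G γ z)) y := by
    have e : EqOn γ (fun z => G z (sharp G γ z)) Ω := fun z hz => (hM.sharp_spec hz γ).symm
    ext Y Z
    rw [curl_apply, curl_apply, fderiv_congr_on h.isOpen e hy]
  have h2 := hM.curl_flat hy hζ (c.proj y) Z
  rw [← h1, h.curl_proj hy] at h2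
  have h3 : fderiv ℝ (fun z => G z (sharp G γ z) (c.proj z)) y Z = 0 := by
    have e : EqOn (fun z => G z (sharp G γ z) (c.proj z)) (fun _ => 0) Ω := fun z hz => by
      simp only [hM.sharp_spec hz, h.form_proj hz]
    rw [fderiv_congr_on h.isOpen e hy]
    simp
  rw [hM.fderiv_inner hy hζ (IsConeMetric.diff_proj c y)] at h3
  have h4 := h.cone.inner_covD_proj_symm hy (sharp G γ y) Z
  rw [hM.symm y hy (covD G (fun y => c.proj y) y Z), hM.sharp_spec hy] at h4
  rw [hM.sharp_spec hy] at h3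
  linarith

theorem smooth_sharpCurl (h : IsDefectQuotient c G Ω q m γ) :
    ContDiffOn ℝ ∞ (sharpCurl G γ) Ω :=
  h.cone.metric.smooth_inverse.clm_comp (h.smooth.curl_infty h.isOpen)

/-- The Ricci curvature in the direction of the generator, to leading order. -/
theorem ricci_proj (h : IsDefectQuotient c G Ω q (l + 1) γ) (Z : V) :
    ∃ S₁ S₂ : V → ℝ, ContinuousOn S₁ Ω ∧ ContinuousOn S₂ Ω ∧ ∀ y ∈ Ω,
      coordRicci G y Z (c.proj y) = (l + 1) * coneSq c G y ^ l *
        ((2 * (l + 1) - Module.finrank ℝ V) * γ y Z + coneForm c G y Z * S₁ y)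
        + coneSq c G y ^ (l + 1) * S₂ y := by
  have hM := h.cone.metric
  have hsζ := hM.smooth_sharp h.smooth
  have hZ : ContDiffOn ℝ ∞ (fun _ : V => Z) Ω := contDiffOn_const
  have hsKZ : ContDiffOn ℝ ∞ (fun z => sharpCurl G γ z Z) Ω := h.smooth_sharpCurl.clm_apply hZ
  have hsγZ : ContDiffOn ℝ ∞ (fun z => γ z Z) Ω := h.smooth.clm_apply hZ
  have hsαZ : ContDiffOn ℝ ∞ (fun z => coneForm c G z Z) Ω := h.cone.smooth_form.clm_apply hZ
  have hsQ : ∀ l, ContDiffOn ℝ ∞ (fun z => coneSq c G z ^ l) Ω := fun l => h.cone.smooth_sq.pow l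
  have htr : ContinuousOn (fun z => LinearMap.trace ℝ V
      (sharpCurl G γ z ∘L covD G (fun _ => Z) z : V →L[ℝ] V)) Ω :=
    (LinearMap.continuous_of_finiteDimensional
      (LinearMap.trace ℝ V ∘ₗ ContinuousLinearMap.coeLM ℝ)).comp_continuousOn
      (h.smooth_sharpCurl.clm_comp (hM.smooth_covD hZ)).continuousOn
  have hcγζ : ContinuousOn (fun z => γ z (sharp G γ z)) Ω := (h.smooth.clm_apply hsζ).continuousOn
  have hccurl : ContinuousOn (fun z => curl γ z Z (sharp G γ z)) Ω :=
    (((h.smooth.curl_infty h.isOpen).clm_apply hZ).clm_apply hsζ).continuousOn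
  -- The witnesses collect the terms of div(FZ) - tr(F ∘ ∇Z) that carry a factor α(Z) or an extra
  -- factor Q; later only their continuity matters.
  refine ⟨fun z => diverg G (sharp G γ) z - 2 * l * (coneSq c G z ^ l * γ z (sharp G γ z)),
    fun z => 1 / 2 * diverg G (fun z => sharpCurl G γ z Z) z
      - (l + 1) * coneSq c G z ^ l * curl γ z Z (sharp G γ z)
      - 1 / 2 * LinearMap.trace ℝ V (sharpCurl G γ z ∘L covD G (fun _ => Z) z : V →L[ℝ] V),
    ?_, ?_, fun y hy => ?_⟩
  · exact (hM.smooth_diverg hsζ).continuousOn.sub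
      (continuousOn_const.mul ((hsQ l).continuousOn.mul hcγζ))
  · exact ((continuousOn_const.mul (hM.smooth_diverg hsKZ).continuousOn).sub
      ((continuousOn_const.mul (hsQ l).continuousOn).mul hccurl)).sub (continuousOn_const.mul htr)
  have dif : ∀ {W : Type} [NormedAddCommGroup W] [NormedSpace ℝ W] {f : V → W},
      ContDiffOn ℝ ∞ f Ω → DifferentiableAt ℝ f y :=
    fun hf => hf.differentiableAt_infty h.isOpen hy
  have hX := IsConeMetric.smooth_proj c Ω
  set φ : V → ℝ := fun z => coneSq c G z ^ l * coneForm c G z Z with hφ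
  set χ : V → ℝ := fun z => coneSq c G z ^ l * γ z Z with hχ
  have hsφ : ContDiffOn ℝ ∞ φ Ω := (hsQ l).mul hsαZ
  have hsχ : ContDiffOn ℝ ∞ χ Ω := (hsQ l).mul hsγZ
  have e : EqOn (fun z => coneSkew c G z Z) (fun z => ((l + 1 : ℝ) • (φ z • sharp G γ z)
      - (l + 1 : ℝ) • (χ z • c.proj z))
      + (1 / 2 : ℝ) • (coneSq c G z ^ (l + 1) • sharpCurl G γ z Z)) Ω := by
    intro z hz
    simp only [h.skew_apply hz, hφ, hχ]
    module
  have h1 := h.cone.diverg_skew hy hZ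
  have d1 := (dif hsφ).fun_smul (dif hsζ)
  have d2 := (dif hsχ).fun_smul (dif hX)
  have d3 := (dif (hsQ (l + 1))).fun_smul (dif hsKZ)
  rw [diverg_congr h.isOpen hy e,
    diverg_add ((d1.fun_const_smul _).fun_sub (d2.fun_const_smul _)) (d3.fun_const_smul _),
    diverg_sub (d1.fun_const_smul _) (d2.fun_const_smul _), diverg_const_smul _ d1,
    diverg_const_smul _ d2, diverg_const_smul _ d3, diverg_smul (dif hsφ) (dif hsζ),
    diverg_smul (dif hsχ) (dif hX), diverg_smul (dif (hsQ (l + 1))) (dif hsKZ),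
    h.cone.diverg_proj hy, h.skew_eq hy] at h1
  -- Write ζ for the dual field of γ. The term α(∇_ζ Z) here and γ(∇_X Z) in `e2` cancel against the
  -- trace of the rank-two part of F ∘ ∇Z; what survives is ∇_ζ X - ∇_X ζ, given by
  -- `inner_commutator`.
  have e1 : fderiv ℝ φ y (sharp G γ y) = coneSq c G y ^ l *
      (G y (covD G (fun y => c.proj y) y (sharp G γ y)) Z
        + coneForm c G y (covD G (fun _ => Z) y (sharp G γ y)))
      - 2 * l * coneSq c G y ^ (2 * l) * γ y (sharp G γ y) * coneForm c G y Z := by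
    have hd := hM.fderiv_inner hy (dif hX) (dif hZ) (sharp G γ y)
    rw [hφ, fderiv_fun_mul (dif (hsQ l)) (dif hsαZ)]
    simp only [_root_.add_apply, _root_.smul_apply, smul_eq_mul, h.fderiv_pow_sharp hy]
    rw [show (fun z => coneForm c G z Z) = fun z => G z (c.proj z) Z from rfl, hd]
    simp only [coneForm]
    ring
  have e2 : fderiv ℝ χ y (c.proj y) = coneSq c G y ^ l *
      (G y (covD G (sharp G γ) y (c.proj y)) Z + γ y (covD G (fun _ => Z) y (c.proj y)))
      + 2 * l * coneSq c G y ^ l * γ y Z := by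
    have hd := hM.fderiv_inner hy (dif hsζ) (dif hZ) (c.proj y)
    rw [← fderiv_congr_on (f := fun z => γ z Z) h.isOpen
      (fun z hz => by simp only [hM.sharp_spec hz]) hy, hM.sharp_spec hy] at hd
    rw [hχ, fderiv_fun_mul (dif (hsQ l)) (dif hsγZ)]
    simp only [_root_.add_apply, _root_.smul_apply, smul_eq_mul, h.fderiv_pow_proj hy, hd]
    ring
  have e3 : fderiv ℝ (fun z => coneSq c G z ^ (l + 1)) y (sharpCurl G γ y Z) =
      (l + 1) * coneSq c G y ^ l *
        (4 * l * γ y Z - 2 * (coneSq c G y ^ (l + 1) * curl γ y Z (sharp G γ y))) := by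
    rw [h.fderiv_pow hy, _root_.smul_apply, h.fderiv_sq hy, smul_eq_mul]
    have h5 : coneForm c G y (sharpCurl G γ y Z) = 2 * l * γ y Z := by
      rw [coneForm, hM.symm y hy, h.inner_sharpCurl hy, curl_swap, h.curl_proj hy]; ring
    have h6 : γ y (sharpCurl G γ y Z) = curl γ y Z (sharp G γ y) := by
      rw [← h.inner_sharpCurl hy, hM.symm y hy, hM.sharp_spec hy]
    rw [h5, h6, Nat.add_sub_cancel]
    push_cast
    ring
  have e4 := h.inner_commutator hy Z
  rw [e1, e2, e3, ContinuousLinearMap.add_comp, trace_clm_add, ContinuousLinearMap.smul_comp,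
    ContinuousLinearMap.smul_comp, trace_clm_smul, trace_clm_smul, ContinuousLinearMap.sub_comp,
    trace_clm_sub, trace_smulRight_comp, trace_smulRight_comp] at h1
  simp only [hφ, hχ] at h1
  set Q := coneSq c G y
  set g := γ y Z
  set A := G y (covD G (fun y => c.proj y) y (sharp G γ y)) Z
  set B := G y (covD G (sharp G γ) y (c.proj y)) Z
  have e5 : Q ^ (2 * l) = Q ^ l * Q ^ l := by ring
  rw [e5] at h1
  linear_combination (-1 : ℝ) * h1 + (l + 1) * Q ^ l * e4

/-- The divergence of the field dual to the quotient, to leading order. -/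
theorem diverg_sharp (h : IsDefectQuotient c G Ω q (l + 1) γ) :
    ∃ S : V → ℝ, ContinuousOn S Ω ∧ ∀ y ∈ Ω,
      coneSq c G y ^ (l + 1) * diverg G (sharp G γ) y =
        coneSq c G y ^ (l + 1) * (2 * (l + 1) * l * coneSq c G y ^ l * γ y (sharp G γ y)
          + coneSq c G y ^ (l + 1) * S y) + coordRicci G y (c.proj y) (c.proj y) := by
  have hM := h.cone.metric
  have hsζ := hM.smooth_sharp h.smooth
  have hX := IsConeMetric.smooth_proj c Ω
  have htr : ContinuousOn (fun z => LinearMap.trace ℝ V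
      (sharpCurl G γ z ∘L sharpCurl G γ z : V →L[ℝ] V)) Ω :=
    (LinearMap.continuous_of_finiteDimensional
      (LinearMap.trace ℝ V ∘ₗ ContinuousLinearMap.coeLM ℝ)).comp_continuousOn
      (h.smooth_sharpCurl.clm_comp h.smooth_sharpCurl).continuousOn
  refine ⟨fun z => 1 / 4 * LinearMap.trace ℝ V
      (sharpCurl G γ z ∘L sharpCurl G γ z : V →L[ℝ] V),
      continuousOn_const.mul htr, fun y hy => ?_⟩
  have dif : ∀ {W : Type} [NormedAddCommGroup W] [NormedSpace ℝ W] {f : V → W},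
      ContDiffOn ℝ ∞ f Ω → DifferentiableAt ℝ f y :=
    fun hf => hf.differentiableAt_infty h.isOpen hy
  have h1 := h.cone.diverg_skew hy hX
  -- F X is the dual field of the defect, so the Maxwell equation with Z = X controls the divergence
  -- of γ^♯.
  have e : EqOn (fun z => coneSkew c G z (c.proj z))
      (fun z => coneSq c G z ^ (l + 1) • sharp G γ z) Ω := by
    intro z hz
    simp only [h.cone.skew_proj hz, sharp, h.defect_eq z hz, map_smul]
  rw [diverg_congr h.isOpen hy e,
    diverg_smul (dif (h.cone.smooth_sq.pow (l + 1))) (dif hsζ), h.fderiv_pow hy,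
    _root_.smul_apply, h.fderiv_sq_sharp hy, smul_eq_mul, h.cone.covD_proj hy,
    ContinuousLinearMap.comp_add, trace_clm_add, ContinuousLinearMap.comp_id,
    h.cone.trace_skew hy, h.skew_eq hy] at h1
  set S : V →L[ℝ] V :=
    (coneForm c G y).smulRight (sharp G γ y) - (γ y).smulRight (c.proj y) with hS
  set K := sharpCurl G γ y
  have hαζ : coneForm c G y (sharp G γ y) = 0 := by
    rw [coneForm, hM.symm y hy, hM.sharp_spec hy, h.form_proj hy]
  have hKX : γ y (K (c.proj y)) = - 2 * l * γ y (sharp G γ y) := by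
    rw [← h.curl_proj hy, ← h.inner_sharpCurl hy, hM.symm y hy, hM.sharp_spec hy]
  have hαK : coneForm c G y (K (sharp G γ y)) = 2 * l * γ y (sharp G γ y) := by
    rw [coneForm, hM.symm y hy, h.inner_sharpCurl hy, curl_swap, h.curl_proj hy]; ring
  have hSS : LinearMap.trace ℝ V (S ∘L S : V →L[ℝ] V) =
      - 2 * coneSq c G y * γ y (sharp G γ y) := by
    conv_lhs => rw [hS, ContinuousLinearMap.sub_comp, trace_clm_sub, trace_smulRight_comp,
      trace_smulRight_comp]
    simp only [_root_.sub_apply, ContinuousLinearMap.smulRight_apply, map_sub, map_smul,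
      smul_eq_mul, hαζ, h.form_proj hy, IsConeMetric.form_proj]
    ring
  have hSK : LinearMap.trace ℝ V (S ∘L K : V →L[ℝ] V) = 4 * l * γ y (sharp G γ y) := by
    rw [hS, ContinuousLinearMap.sub_comp, trace_clm_sub, trace_smulRight_comp,
      trace_smulRight_comp, hKX, hαK]
    ring
  have hKS := trace_clm_comm S K
  rw [hSK] at hKS
  simp only [ContinuousLinearMap.add_comp, ContinuousLinearMap.comp_add,
    ContinuousLinearMap.smul_comp, ContinuousLinearMap.comp_smul, trace_clm_add, trace_clm_smul,
    hSS, hSK, ← hKS] at h1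
  have hKK : LinearMap.trace ℝ V ((K : V →ₗ[ℝ] V) ∘ₗ (K : V →ₗ[ℝ] V)) =
    LinearMap.trace ℝ V (sharpCurl G γ y ∘L sharpCurl G γ y : V →L[ℝ] V) := rfl
  rw [Nat.add_sub_cancel] at h1
  push_cast at h1
  rw [hKK] at h1
  -- The coefficient of Q^{2l+1} γ(γ^♯) is (l + 1)(2 - 2(l + 1) + 4l) = 2l(l + 1); its factor l will
  -- matter when l = 0.
  linear_combination h1

/-- Vanishing of the Ricci curvature to higher order improves the order of the defect. -/
theorem exists_succ (h : IsDefectQuotient c G Ω q (l + 1) γ)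
    (hRic : ∀ y ∈ Ω, c.rho y = 0 → ∀ Z, c.rho Z = 0 → Filter.Tendsto
      (fun r : ℝ => coordRicci G (y + r • c.vec) Z (c.proj y) / r ^ (l + 1))
      (nhdsWithin 0 {0}ᶜ) (nhds 0))
    (h1 : (2 * (l + 1) : ℝ) ≠ Module.finrank ℝ V)
    (h2 : (2 * (l + 1) + 2 : ℝ) ≠ Module.finrank ℝ V) :
    ∃ γ', IsDefectQuotient c G Ω q (l + 2) γ' := by
  have hM := h.cone.metric
  have hΩ := h.isOpen
  have hl0 : (l + 1 : ℝ) ≠ 0 := by positivity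
  -- the tangential part
  have tang : ∀ y ∈ Ω, c.rho y = 0 → ∀ Z, c.rho Z = 0 → γ y Z = 0 := by
    intro y hy h0 Z hZ
    obtain ⟨S₁, S₂, hS₁, hS₂, e⟩ := h.ricci_proj Z
    have hc : ContinuousOn (fun y => (l + 1) *
        ((2 * (l + 1) - Module.finrank ℝ V) * γ y Z + coneForm c G y Z * S₁ y)
        + coneSq c G y * S₂ y) Ω := by
      refine (continuousOn_const.mul ((continuousOn_const.mul
        (h.smooth.clm_apply contDiffOn_const).continuousOn).add
        ((h.cone.smooth_form.clm_apply contDiffOn_const).continuousOn.mul hS₁))).add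
        (h.cone.smooth_sq.continuousOn.mul hS₂)
    have t1 := h.tendsto_div_pow l hc (f := fun y => coordRicci G y Z (c.proj y))
      (fun y hy => by rw [e y hy]; ring) hy h0
    have t2 : Filter.Tendsto (fun r : ℝ => coordRicci G (y + r • c.vec) Z
        (c.proj (y + r • c.vec)) / r ^ l) (nhdsWithin 0 {0}ᶜ) (nhds 0) := by
      have t3 : Filter.Tendsto (fun r : ℝ => r) (nhdsWithin 0 {0}ᶜ) (nhds 0) :=
        Filter.tendsto_id.mono_left nhdsWithin_le_nhds
      have t4 := t3.mul (hRic y hy h0 Z hZ)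
      rw [mul_zero] at t4
      refine t4.congr' ?_
      filter_upwards [self_mem_nhdsWithin] with r hr0
      have hr0' : r ≠ 0 := hr0
      rw [map_add, map_smul, c.proj_vec, smul_zero, add_zero, pow_succ]
      field_simp
    have t5 := tendsto_nhds_unique t1 t2
    have hα : coneForm c G y Z = 0 := h.cone.null y hy h0 Z hZ
    -- For tangent Z only the γ(Z) term of `ricci_proj` survives on the cone; its factor 2(l + 1) -
    -- N is nonzero by assumption.
    rw [hα, h.cone.sq_eq_zero hy h0, zero_mul, zero_mul, add_zero, add_zero] at t5
    have := (mul_eq_zero.1 t5).resolve_left (pow_ne_zero _ (h.q_ne y hy))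
    have := (mul_eq_zero.1 this).resolve_left hl0
    exact (mul_eq_zero.1 this).resolve_left (sub_ne_zero.2 h1)
  -- the divergence
  have hdiv : ∀ y ∈ Ω, c.rho y = 0 → diverg G (sharp G γ) y = 0 := by
    intro y hy h0
    obtain ⟨S, hS, e⟩ := h.diverg_sharp
    have hsζ := hM.smooth_sharp h.smooth
    have hc : ContinuousOn (fun y => diverg G (sharp G γ) y -
        (2 * (l + 1) * l * coneSq c G y ^ l * γ y (sharp G γ y)
          + coneSq c G y ^ (l + 1) * S y)) Ω := by
      refine (hM.smooth_diverg hsζ).continuousOn.sub (((continuousOn_const.mul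
        (h.cone.smooth_sq.continuousOn.pow l)).mul (h.smooth.clm_apply hsζ).continuousOn).add
        ((h.cone.smooth_sq.continuousOn.pow (l + 1)).mul hS))
    have t1 := h.tendsto_div_pow (l + 1) hc
      (f := fun y => coordRicci G y (c.proj y) (c.proj y))
      (fun y hy => by linear_combination -e y hy) hy h0
    have t2 : Filter.Tendsto (fun r : ℝ => coordRicci G (y + r • c.vec) (c.proj (y + r • c.vec))
        (c.proj (y + r • c.vec)) / r ^ (l + 1)) (nhdsWithin 0 {0}ᶜ) (nhds 0) := by
      simpa using hRic y hy h0 (c.proj y) (by simp)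
    have t5 := tendsto_nhds_unique t1 t2
    have := (mul_eq_zero.1 t5).resolve_left (pow_ne_zero _ (h.q_ne y hy))
    rw [h.cone.sq_eq_zero hy h0] at this
    -- For l = 0 the power of Q is 1 and only the prefactor l makes the term vanish on the cone.
    have hl : (l : ℝ) * (0 : ℝ) ^ l = 0 := by
      cases l with
      | zero => simp
      | succ l => simp
    linear_combination this + (2 * (l + 1) * γ y (sharp G γ y)) * hl
  -- the transversal part
  set lam : V → ℝ := fun y => 2 * γ y c.vec * (q y)⁻¹ with hlam
  have hsγR : ContDiffOn ℝ ∞ (fun y => γ y c.vec) Ω := h.smooth.clm_apply contDiffOn_const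
  have hslam : ContDiffOn ℝ ∞ lam Ω :=
    (contDiffOn_const.mul hsγR).mul (h.smooth_q.inv h.q_ne)
  have hqα : ∀ y ∈ Ω, c.rho y = 0 → q y = 2 * coneForm c G y c.vec := by
    intro y hy h0
    rw [h.cone.fderiv_sq_vec h.smooth_q h.sq_eq hy h0, h.defect_eq y hy,
      h.cone.sq_eq_zero hy h0]
    simp
  have hdec : ∀ y ∈ Ω, c.rho y = 0 → γ y - lam y • coneForm c G y = 0 := by
    intro y hy h0
    ext Z
    have hZ : Z = (Z - c.rho Z • c.vec) + c.rho Z • c.vec := by abel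
    have hα : coneForm c G y (Z - c.rho Z • c.vec) = 0 := h.cone.null y hy h0 _ (by simp)
    have hγ := tang y hy h0 (Z - c.rho Z • c.vec) (by simp)
    have hR : γ y c.vec = lam y * coneForm c G y c.vec := by
      have hq0 := h.q_ne y hy
      have : coneForm c G y c.vec = q y / 2 := by rw [hqα y hy h0]; ring
      rw [hlam, this]
      field_simp
    rw [hZ]
    simp only [map_add, _root_.sub_apply, hγ, _root_.smul_apply, hα, map_smul, hR, smul_eq_mul]
    simp
  obtain ⟨τ, hτ, hγτ⟩ := h.exists_eq_sq_smul
    (f := fun y => γ y - lam y • coneForm c G y)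
    (h.smooth.sub (hslam.smul h.cone.smooth_form)) hdec
  have hτX : ∀ y ∈ Ω, τ y (c.proj y) = - lam y := by
    intro y hy
    refine h.cancel 1 (f := fun y => τ y (c.proj y)) (g := fun y => - lam y)
      (hτ.clm_apply (IsConeMetric.smooth_proj c Ω)).continuousOn hslam.continuousOn.neg
      (fun y hy => ?_) hy
    have := congrArg (fun L : V →L[ℝ] ℝ => L (c.proj y)) (hγτ y hy)
    simp only [_root_.sub_apply, _root_.smul_apply, h.form_proj hy, smul_eq_mul,
      IsConeMetric.form_proj] at this
    linear_combination -this
  have hdlam : ∀ y ∈ Ω, fderiv ℝ lam y (c.proj y) = - 2 * (l + 1) * lam y := by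
    intro y hy
    have dγ := h.smooth.differentiableAt_infty hΩ hy
    have dR := hsγR.differentiableAt_infty hΩ hy
    have dq := h.smooth_q.differentiableAt_infty hΩ hy
    have dl := hslam.differentiableAt_infty hΩ hy
    have e1 : fderiv ℝ (fun y => γ y c.vec) y (c.proj y) = - 2 * l * γ y c.vec := by
      have := IsConeMetric.fderiv_form_proj hΩ h.smooth (fun z hz => h.form_proj hz) hy c.vec
      rw [h.curl_proj hy, c.proj_vec, map_zero, sub_zero] at this
      rw [fderiv_clm_apply dγ (differentiableAt_const _)]
      simpa using this
    have e2 : EqOn (fun y => lam y * q y) (fun y => 2 * γ y c.vec) Ω := by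
      intro z hz
      have := h.q_ne z hz
      simp only [hlam]
      field_simp
    have e3 := DFunLike.congr_fun (fderiv_congr_on hΩ e2 hy) (c.proj y)
    rw [fderiv_fun_mul dl dq, fderiv_const_mul dR] at e3
    simp only [_root_.add_apply, _root_.smul_apply, smul_eq_mul, e1, h.fderiv_q_proj hy] at e3
    have e4 : lam y * q y = 2 * γ y c.vec := e2 hy
    have := h.q_ne y hy
    refine mul_left_cancel₀ this ?_
    linear_combination e3 + 2 * l * e4
  have hlam0 : ∀ y ∈ Ω, c.rho y = 0 → lam y = 0 := by
    intro y hy h0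
    have hX := IsConeMetric.smooth_proj c Ω
    have hsξ := hM.smooth_sharp hτ
    have dif : ∀ {W : Type} [NormedAddCommGroup W] [NormedSpace ℝ W] {f : V → W},
        ContDiffOn ℝ ∞ f Ω → DifferentiableAt ℝ f y := fun hf => hf.differentiableAt_infty hΩ hy
    have e : EqOn (sharp G γ) (fun y => lam y • c.proj y + coneSq c G y • sharp G τ y) Ω := by
      intro z hz
      have := hγτ z hz
      rw [sub_eq_iff_eq_add] at this
      simp only
      rw [← h.cone.sharp_form hz]
      simp only [sharp]
      rw [this, map_add, map_smul, map_smul]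
      abel
    have h3 := hdiv y hy h0
    rw [diverg_congr hΩ hy e, diverg_add ((dif hslam).fun_smul (dif hX))
      ((dif h.cone.smooth_sq).fun_smul (dif hsξ)), diverg_smul (dif hslam) (dif hX),
      diverg_smul (dif h.cone.smooth_sq) (dif hsξ), h.cone.diverg_proj hy, hdlam y hy,
      h.fderiv_sq hy, h.cone.sq_eq_zero hy h0] at h3
    have h4 : coneForm c G y (sharp G τ y) = - lam y := by
      rw [coneForm, hM.symm y hy, hM.sharp_spec hy, hτX y hy]
    rw [h4] at h3
    simp only [ne_eq, Nat.add_eq_zero_iff, one_ne_zero, and_false, not_false_eq_true, zero_pow,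
      zero_mul, mul_zero, sub_zero, zero_add] at h3
    -- From γ^♯ = λX + Qτ^♯, the divergence on the cone is Nλ + Xλ + 2τ(X), with Xλ = -2(l + 1)λ and
    -- τ(X) = -λ.
    have h5 : lam y * ((Module.finrank ℝ V : ℝ) - (2 * (l + 1) + 2)) = 0 := by
      linear_combination h3
    exact (mul_eq_zero.1 h5).resolve_right (sub_ne_zero.2 h2.symm)
  obtain ⟨γ', hγ', e⟩ := h.exists_eq_sq_smul h.smooth fun y hy h0 => by
    have := hdec y hy h0
    rw [hlam0 y hy h0, zero_smul, sub_zero] at this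
    exact this
  exact ⟨γ', h.cone, h.smooth_q, h.sq_eq, h.q_ne, hγ', fun y hy => by
    rw [h.defect_eq y hy, e y hy, smul_smul]; ring_nf⟩

end Succ

end IsDefectQuotient

end Cone

/-! ### The defect of an ambient metric, homogeneous functions, and the commutator of Δ with Q -/

section Cone

set_option synthInstance.maxHeartbeats 400000

variable {V : Type} [NormedAddCommGroup V] [NormedSpace ℝ V]
  {c : ConeFrame V} {G : V → V →L[ℝ] V →L[ℝ] ℝ} {Ω : Set V} {y : V} {q : V → ℝ} {m : ℕ}
  {γ : V → V →L[ℝ] ℝ}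

theorem IsConeMetric.sq_dil (h : IsConeMetric c G Ω) (hy : y ∈ Ω) {s : ℝ} (hs : 0 < s) :
    coneSq c G (c.dil s y) = s ^ 2 * coneSq c G y := by
  have := h.homogeneous y hy s hs (c.proj y) (c.proj y)
  rw [c.dil_proj] at this
  rw [coneSq, c.proj_dil, this, coneSq]

/-- The defect of an ambient metric vanishes to high order along the cone. -/
theorem IsConeMetric.exists_isDefectQuotient [FiniteDimensional ℝ V] (h : IsConeMetric c G Ω)
    (hN : 2 < Module.finrank ℝ V) (k : ℕ)
    (hor : (∀ y ∈ Ω, coneDefect c G y = 0) ∨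
      ((∀ y ∈ Ω, c.rho y = 0 → ∀ Z, c.rho Z = 0 → Filter.Tendsto
        (fun r : ℝ => coordRicci G (y + r • c.vec) Z (c.proj y) / r ^ k)
        (nhdsWithin 0 {0}ᶜ) (nhds 0)) ∧
      ∀ m : ℕ, m < k → 2 * (m + 1) ≠ Module.finrank ℝ V ∧
        2 * (m + 1) + 2 ≠ Module.finrank ℝ V)) :
    ∃ Ω' ⊆ Ω, (∀ y ∈ Ω, c.rho y = 0 → y ∈ Ω') ∧
      ∃ q γ, IsDefectQuotient c G Ω' q (k + 1) γ := by
  have low : (∀ y ∈ Ω, c.rho y = 0 → ∀ Z, c.rho Z = 0 → Filter.Tendsto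
        (fun r : ℝ => coordRicci G (y + r • c.vec) Z (c.proj y) / r ^ k)
        (nhdsWithin 0 {0}ᶜ) (nhds 0)) → ∀ j ≤ k, ∀ y ∈ Ω, c.rho y = 0 → ∀ Z, c.rho Z = 0 →
        Filter.Tendsto (fun r : ℝ => coordRicci G (y + r • c.vec) Z (c.proj y) / r ^ j)
        (nhdsWithin 0 {0}ᶜ) (nhds 0) := by
    intro H j hj y hy h0 Z hZ
    have t1 : Filter.Tendsto (fun r : ℝ => r ^ (k - j)) (nhdsWithin 0 {0}ᶜ)
        (nhds (0 ^ (k - j))) :=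
      ((continuous_pow (k - j)).tendsto (0 : ℝ)).mono_left nhdsWithin_le_nhds
    have t2 := t1.mul (H y hy h0 Z hZ)
    rw [mul_zero] at t2
    refine t2.congr' ?_
    filter_upwards [self_mem_nhdsWithin] with r hr
    have hr' : r ≠ 0 := hr
    obtain ⟨i, rfl⟩ := Nat.exists_eq_add_of_le hj
    rw [Nat.add_sub_cancel_left, pow_add]
    field_simp
  have hβ0 : ∀ y ∈ Ω, c.rho y = 0 → coneDefect c G y = 0 := by
    rcases hor with h1 | h1
    · exact fun y hy _ => h1 y hy
    · intro y hy h0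
      refine h.defect_eq_zero_on_cone hN (fun y hy h0 => ?_) hy h0
      simpa using low h1.1 0 (Nat.zero_le _) y hy h0 (c.proj y) (by simp)
  obtain ⟨q, hq, hQ⟩ := h.exists_sq_eq
  have hqd : ∀ y ∈ Ω, ∀ s : ℝ, 0 < s → q (c.dil s y) = s ^ 2 * q y := by
    intro y hy s hs
    refine h.domain.eqOn_of_off_cone (f := fun y => q (c.dil s y)) (g := fun y => s ^ 2 * q y)
      (hq.continuousOn.comp (c.dil s).continuous.continuousOn fun y hy => h.domain.dil y hy s hs)
      (continuousOn_const.mul hq.continuousOn) (fun y hy h0 => ?_) hy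
    have := h.sq_dil hy hs
    rw [hQ y hy, hQ _ (h.domain.dil y hy s hs), c.rho_dil] at this
    exact mul_left_cancel₀ h0 (by linarith)
  -- Division by Q needs q ≠ 0. On the cone q = 2α(∂_ρ) ≠ 0 once the defect vanishes there, so this
  -- shrinking loses no point of the cone; the weight of q keeps the set dilation invariant.
  set Ω₁ : Set V := Ω ∩ q ⁻¹' {0}ᶜ with hΩ₁
  have hΩ₁o : IsOpen Ω₁ := hq.continuousOn.isOpen_inter_preimage h.isOpen isOpen_compl_singleton
  have hD : c.IsDomain (c.starCore Ω₁) := c.isDomain_starCore hΩ₁o fun y hy s hs =>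
    ⟨h.domain.dil y hy.1 s hs, by
      have : q y ≠ 0 := hy.2
      have hs' : s ≠ 0 := hs.ne'
      simpa [hqd y hy.1 s hs, hs'] using this⟩
  have hsub : c.starCore Ω₁ ⊆ Ω := (c.starCore_subset Ω₁).trans inter_subset_left
  have hcone : ∀ y ∈ Ω, c.rho y = 0 → y ∈ c.starCore Ω₁ := by
    refine fun y hy h0 => c.mem_starCore ⟨hy, ?_⟩ h0
    have := h.fderiv_sq_vec hq hQ hy h0
    rw [hβ0 y hy h0] at this
    have h2 := h.form_vec_ne_zero hy h0
    simpa [this] using h2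
  have hq0 : ∀ y ∈ c.starCore Ω₁, q y ≠ 0 := fun y hy => (c.starCore_subset Ω₁ hy).2
  have h' := h.mono hD hsub
  refine ⟨c.starCore Ω₁, hsub, hcone, q, ?_⟩
  rcases hor with h1 | ⟨h1, h2⟩
  -- In the straight case the quotient is zero, to every order.
  · exact ⟨fun _ => 0, h', hq.mono hsub, fun y hy => hQ y (hsub hy), hq0, contDiffOn_const,
      fun y hy => by rw [h1 y (hsub hy), smul_zero]⟩
  · have base : ∃ γ, IsDefectQuotient c G (c.starCore Ω₁) q 1 γ := by
      obtain ⟨g, hg, e⟩ := hD.exists_eq_rho_smul h'.smooth_defect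
        fun y hy h0 => hβ0 y (hsub hy) h0
      refine ⟨fun y => (q y)⁻¹ • g y, h', hq.mono hsub, fun y hy => hQ y (hsub hy), hq0,
        ((hq.mono hsub).inv hq0).smul hg, fun y hy => ?_⟩
      rw [e y hy, hQ y (hsub hy), smul_smul, pow_one, mul_assoc, mul_inv_cancel₀ (hq0 y hy),
        mul_one]
    have : ∀ j ≤ k, ∃ γ, IsDefectQuotient c G (c.starCore Ω₁) q (j + 1) γ := by
      intro j
      induction j with
      | zero => exact fun _ => base
      | succ j ih =>
        intro hj
        obtain ⟨γ, hγ⟩ := ih (by omega)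
        obtain ⟨h3, h4⟩ := h2 j (by omega)
        exact hγ.exists_succ (fun y hy h0 Z hZ => low h1 (j + 1) hj y (hsub hy) h0 Z hZ)
          (by exact_mod_cast h3) (by exact_mod_cast h4)
    exact this k le_rfl

/-- The function `f` is smooth on `Ω` and homogeneous of weight `s`. -/
structure IsConeHom (c : ConeFrame V) (Ω : Set V) (s : ℝ) (f : V → ℝ) : Prop where
  smooth : ContDiffOn ℝ ∞ f Ω
  hom : ∀ y ∈ Ω, ∀ t : ℝ, 0 < t → f (c.dil t y) = t ^ s * f y

namespace IsConeHom

/-- Euler's identity, which turns ∇_X in the commutator into multiplication by the weight. -/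
theorem fderiv_proj {s : ℝ} {f : V → ℝ} (h : IsConeHom c Ω s f) (hΩ : IsOpen Ω) (hy : y ∈ Ω) :
    fderiv ℝ f y (c.proj y) = s * f y := by
  have hd : HasDerivAt (fun s => c.dil s y) (c.proj y) 1 := by
    simp only [ConeFrame.dil_apply]
    simpa using (((hasDerivAt_id (1 : ℝ)).sub_const 1).smul_const (c.proj y)).const_add y
  have hf : HasDerivAt (fun s => f (c.dil s y)) (fderiv ℝ f y (c.proj y)) 1 := by
    have := (h.smooth.differentiableAt_infty hΩ hy).hasFDerivAt
    rw [show y = c.dil 1 y by simp] at this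
    simpa [Function.comp_def] using this.comp_hasDerivAt (1 : ℝ) hd
  have h2 : HasDerivAt (fun t : ℝ => t ^ s * f y) (s * f y) 1 := by
    simpa using (Real.hasDerivAt_rpow_const (p := s) (Or.inl one_ne_zero)).mul_const (f y)
  exact ((h2.congr_of_eventuallyEq (f₁ := fun t => f (c.dil t y)) (by
    filter_upwards [lt_mem_nhds (zero_lt_one' ℝ)] with t ht
    exact h.hom y hy t ht)).unique hf).symm

theorem mul {s t : ℝ} {f g : V → ℝ} (hf : IsConeHom c Ω s f) (hg : IsConeHom c Ω t g) :
    IsConeHom c Ω (s + t) (fun y => f y * g y) where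
  smooth := hf.smooth.mul hg.smooth
  hom y hy r hr := by rw [hf.hom y hy r hr, hg.hom y hy r hr, Real.rpow_add hr]; ring

theorem sub {s : ℝ} {f g : V → ℝ} (hf : IsConeHom c Ω s f) (hg : IsConeHom c Ω s g) :
    IsConeHom c Ω s (fun y => f y - g y) where
  smooth := hf.smooth.sub hg.smooth
  hom y hy r hr := by rw [hf.hom y hy r hr, hg.hom y hy r hr]; ring

theorem mono {s : ℝ} {f : V → ℝ} (hf : IsConeHom c Ω s f) {Ω' : Set V} (hs : Ω' ⊆ Ω) :
    IsConeHom c Ω' s f :=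
  ⟨hf.smooth.mono hs, fun y hy => hf.hom y (hs hy)⟩

variable [FiniteDimensional ℝ V]

/-- The Laplacian of a homogeneous metric lowers weights by two. -/
theorem laplacian {s : ℝ} {f : V → ℝ} (hf : IsConeHom c Ω s f) (hM : IsMetricOn G Ω)
    (hd : ∀ y ∈ Ω, ∀ t : ℝ, 0 < t → c.dil t y ∈ Ω)
    (hG : ∀ y ∈ Ω, ∀ s : ℝ, 0 < s → ∀ Y Z,
      G (c.dil s y) (c.dil s Y) (c.dil s Z) = s ^ 2 * G y Y Z) :
    IsConeHom c Ω (s - 2) (coordLaplacian G f) where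
  smooth := hM.smooth_laplacian hf.smooth
  hom y hy t ht := by
    have ht2 : t ^ 2 ≠ 0 := by positivity
    -- A dilation is an isometry from t²G to G, and the Laplacian of t²G is t⁻²Δ.
    have iso : IsIsometryOn (fun y => t ^ 2 • G y) G Ω Ω (c.dil t) :=
      { source := hM.const_smul ht2
        target := hM
        mapsTo := fun y hy => hd y hy t ht
        smooth := (c.dil t).contDiff.contDiffOn
        pullback := fun y hy Y Z => by simp [hG y hy t ht] }
    rw [← iso.laplacian hy hf.smooth, hM.laplacian_const_smul ht2 hy,
      coordLaplacian_congr hM.isOpen (fun z hz => hf.hom z hz t ht) hy,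
      coordLaplacian_const_mul, Real.rpow_sub ht, Real.rpow_two]
    field_simp

theorem iterate {s : ℝ} {f : V → ℝ} (hf : IsConeHom c Ω s f) (hM : IsMetricOn G Ω)
    (hd : ∀ y ∈ Ω, ∀ t : ℝ, 0 < t → c.dil t y ∈ Ω)
    (hG : ∀ y ∈ Ω, ∀ s : ℝ, 0 < s → ∀ Y Z,
      G (c.dil s y) (c.dil s Y) (c.dil s Z) = s ^ 2 * G y Y Z) (j : ℕ) :
    IsConeHom c Ω (s - 2 * j) ((coordLaplacian G)^[j] f) := by
  induction j with
  | zero => simpa using hf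
  | succ j ih =>
    rw [Function.iterate_succ_apply']
    have := ih.laplacian hM hd hG
    convert this using 1
    push_cast
    ring

end IsConeHom

section Iterate

theorem IsMetricOn.iterate_smooth [FiniteDimensional ℝ V] (hM : IsMetricOn G Ω) (j : ℕ) {u : V → ℝ}
    (hu : ContDiffOn ℝ ∞ u Ω) : ContDiffOn ℝ ∞ ((coordLaplacian G)^[j] u) Ω := by
  induction j with
  | zero => simpa using hu
  | succ j ih => rw [Function.iterate_succ_apply']; exact hM.smooth_laplacian ih

theorem iterate_laplacian_congr (hΩ : IsOpen Ω) (j : ℕ) {u v : V → ℝ} (huv : EqOn u v Ω) :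
    EqOn ((coordLaplacian G)^[j] u) ((coordLaplacian G)^[j] v) Ω := by
  induction j with
  | zero => simpa using huv
  | succ j ih =>
    intro y hy
    rw [Function.iterate_succ_apply', Function.iterate_succ_apply']
    exact coordLaplacian_congr hΩ ih hy

theorem IsMetricOn.iterate_add [FiniteDimensional ℝ V] (hM : IsMetricOn G Ω) (j : ℕ) {u v : V → ℝ}
    (hu : ContDiffOn ℝ ∞ u Ω) (hv : ContDiffOn ℝ ∞ v Ω) :
    EqOn ((coordLaplacian G)^[j] fun z => u z + v z)
      (fun z => (coordLaplacian G)^[j] u z + (coordLaplacian G)^[j] v z) Ω := by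
  induction j with
  | zero => intro y _; rfl
  | succ j ih =>
    intro y hy
    simp only [Function.iterate_succ_apply']
    rw [coordLaplacian_congr hM.isOpen ih hy,
      hM.laplacian_add (hM.iterate_smooth j hu) (hM.iterate_smooth j hv) hy]

theorem iterate_laplacian_const_mul (j : ℕ) (a : ℝ) (u : V → ℝ) :
    ((coordLaplacian G)^[j] fun z => a * u z) = fun z => a * (coordLaplacian G)^[j] u z := by
  induction j with
  | zero => rfl
  | succ j ih =>
    ext y
    simp only [Function.iterate_succ_apply', ih, coordLaplacian_const_mul]

end Iterate

/-- The function `f` is divisible by `Q ^ m`, where `Q` is the defining function of the cone. -/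
def SqDvd (c : ConeFrame V) (G : V → V →L[ℝ] V →L[ℝ] ℝ) (Ω : Set V) (m : ℕ) (f : V → ℝ) : Prop :=
  ∃ g : V → ℝ, ContDiffOn ℝ ∞ g Ω ∧ EqOn f (fun y => coneSq c G y ^ m * g y) Ω

namespace SqDvd

theorem congr {f g : V → ℝ} (hf : SqDvd c G Ω m f) (h : EqOn g f Ω) : SqDvd c G Ω m g := by
  obtain ⟨f', hf', e⟩ := hf
  exact ⟨f', hf', h.trans e⟩

theorem add {f g : V → ℝ} (hf : SqDvd c G Ω m f) (hg : SqDvd c G Ω m g) :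
    SqDvd c G Ω m (fun y => f y + g y) := by
  obtain ⟨f', hf', e⟩ := hf
  obtain ⟨g', hg', e'⟩ := hg
  exact ⟨fun y => f' y + g' y, hf'.add hg', fun y hy => by simp only [e hy, e' hy]; ring⟩

theorem mul {f g : V → ℝ} (hf : SqDvd c G Ω m f) (hg : ContDiffOn ℝ ∞ g Ω) :
    SqDvd c G Ω m (fun y => g y * f y) := by
  obtain ⟨f', hf', e⟩ := hf
  exact ⟨fun y => g y * f' y, hg.mul hf', fun y hy => by simp only [e hy]; ring⟩

theorem const_mul {f : V → ℝ} (hf : SqDvd c G Ω m f) (a : ℝ) :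
    SqDvd c G Ω m (fun y => a * f y) := hf.mul contDiffOn_const

theorem sq_mul {f : V → ℝ} (hf : SqDvd c G Ω m f) :
    SqDvd c G Ω (m + 1) (fun y => coneSq c G y * f y) := by
  obtain ⟨f', hf', e⟩ := hf
  exact ⟨f', hf', fun y hy => by simp only [e hy]; ring⟩

theorem smooth {f : V → ℝ} (hf : SqDvd c G Ω m f) (h : IsConeMetric c G Ω) :
    ContDiffOn ℝ ∞ f Ω := by
  obtain ⟨f', hf', e⟩ := hf
  exact ((h.smooth_sq.pow m).mul hf').congr e

theorem of_le {f : V → ℝ} {m' : ℕ} (hf : SqDvd c G Ω m' f) (h : IsConeMetric c G Ω)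
    (hm : m ≤ m') : SqDvd c G Ω m f := by
  obtain ⟨f', hf', e⟩ := hf
  obtain ⟨i, rfl⟩ := Nat.exists_eq_add_of_le hm
  exact ⟨fun y => coneSq c G y ^ i * f' y, (h.smooth_sq.pow i).mul hf',
    fun y hy => by simp only [e hy]; ring⟩

theorem eq_zero {f : V → ℝ} (hf : SqDvd c G Ω (m + 1) f) (h : IsConeMetric c G Ω) (hy : y ∈ Ω)
    (h0 : c.rho y = 0) : f y = 0 := by
  obtain ⟨f', hf', e⟩ := hf
  rw [e hy]
  simp [h.sq_eq_zero hy h0]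

end SqDvd

namespace IsDefectQuotient

variable {l : ℕ} [FiniteDimensional ℝ V]

/-- The commutator of the Laplacian with the defining function. -/
theorem laplacian_sq_mul (h : IsDefectQuotient c G Ω q (l + 1) γ) :
    ∃ E : V → ℝ, ContDiffOn ℝ ∞ E Ω ∧ ∀ v : V → ℝ, ContDiffOn ℝ ∞ v Ω → ∀ y ∈ Ω,
      coordLaplacian G (fun z => coneSq c G z * v z) y = coneSq c G y * coordLaplacian G v y
        + 4 * fderiv ℝ v y (c.proj y) + 2 * Module.finrank ℝ V * v y
        + coneSq c G y ^ (l + 1) * (-4 * fderiv ℝ v y (sharp G γ y) + E y * v y) := by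
  have hM := h.cone.metric
  have hsζ := hM.smooth_sharp h.smooth
  refine ⟨fun z => - 2 * diverg G (sharp G γ) z
      + 4 * (l + 1) * (coneSq c G z ^ l * γ z (sharp G γ z)),
    (contDiffOn_const.mul (hM.smooth_diverg hsζ)).add
      (contDiffOn_const.mul ((h.cone.smooth_sq.pow l).mul (h.smooth.clm_apply hsζ))),
    fun v hv y hy => ?_⟩
  -- The gradient of Q is 2X up to the defect, of order Q^{l+1}; the exact part yields 4∇_X + 2N and
  -- the rest is the error.
  have grad : EqOn (sharp G (fderiv ℝ (coneSq c G)))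
      (fun z => (2 : ℝ) • c.proj z - (2 : ℝ) • (coneSq c G z ^ (l + 1) • sharp G γ z)) Ω := by
    intro z hz
    have : fderiv ℝ (coneSq c G) z = (2 : ℝ) • coneForm c G z
        - (2 : ℝ) • (coneSq c G z ^ (l + 1) • γ z) := by
      ext Z
      rw [h.fderiv_sq hz]
      simp
    simp only
    rw [← h.cone.sharp_form hz]
    simp only [sharp]
    rw [this]
    simp only [map_sub, map_smul]
  have dX := (IsConeMetric.smooth_proj c Ω).differentiableAt_infty h.isOpen hy
  have dQ := (h.cone.smooth_sq.pow (l + 1)).differentiableAt_infty h.isOpen hy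
  have dζ := hsζ.differentiableAt_infty h.isOpen hy
  have lapQ : coordLaplacian G (coneSq c G) y = 2 * Module.finrank ℝ V
      - 2 * (coneSq c G y ^ (l + 1) * diverg G (sharp G γ) y
        - 2 * (l + 1) * coneSq c G y ^ l * (coneSq c G y ^ (l + 1) * γ y (sharp G γ y))) := by
    rw [hM.laplacian_eq h.cone.smooth_sq hy, diverg_congr h.isOpen hy grad,
      diverg_sub (dX.fun_const_smul _) ((dQ.fun_smul dζ).fun_const_smul _), diverg_const_smul _ dX,
      diverg_const_smul _ (dQ.fun_smul dζ), diverg_smul dQ dζ, h.cone.diverg_proj hy,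
      h.fderiv_pow hy, _root_.smul_apply, h.fderiv_sq_sharp hy, Nat.add_sub_cancel]
    push_cast
    simp only [smul_eq_mul]
    ring
  rw [hM.laplacian_mul h.cone.smooth_sq hv hy, lapQ, grad hy]
  simp only [map_sub, map_smul, smul_eq_mul]
  ring

/-- A second-order operator could cost two powers of Q. Only one is lost because Q is null to
leading order: ∇Q is 2X up to a high power of Q, and X preserves divisibility by powers of Q. -/
theorem sqDvd_laplacian (h : IsDefectQuotient c G Ω q (l + 1) γ) (m : ℕ) :
    ∀ {f : V → ℝ}, SqDvd c G Ω (m + 1) f → SqDvd c G Ω m (coordLaplacian G f) := by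
  have hM := h.cone.metric
  have hsζ := hM.smooth_sharp h.smooth
  have hX := IsConeMetric.smooth_proj c Ω
  induction m with
  | zero =>
    intro f hf
    exact ⟨coordLaplacian G f, hM.smooth_laplacian (hf.smooth h.cone), fun y _ => by simp⟩
  | succ m ih =>
    rintro f ⟨g, hg, e⟩
    obtain ⟨E, hE, hcom⟩ := h.laplacian_sq_mul
    set v : V → ℝ := fun y => coneSq c G y ^ (m + 1) * g y with hv
    have hsv : ContDiffOn ℝ ∞ v Ω := (h.cone.smooth_sq.pow _).mul hg
    have hvd : SqDvd c G Ω (m + 1) v := ⟨g, hg, fun _ _ => rfl⟩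
    have hfv : EqOn f (fun y => coneSq c G y * v y) Ω := by
      intro y hy
      rw [e hy]; simp only [hv]; ring
    have hdv : ∀ y ∈ Ω, ∀ Z, fderiv ℝ v y Z = coneSq c G y ^ (m + 1) * fderiv ℝ g y Z +
        g y * fderiv ℝ (fun z => coneSq c G z ^ (m + 1)) y Z := by
      intro y hy Z
      rw [hv, fderiv_fun_mul ((h.cone.smooth_sq.pow _).differentiableAt_infty h.isOpen hy)
        (hg.differentiableAt_infty h.isOpen hy)]
      simp
    have hdX : SqDvd c G Ω (m + 1) (fun y => fderiv ℝ v y (c.proj y)) :=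
      ⟨fun y => fderiv ℝ g y (c.proj y) + 2 * (m + 1) * g y,
        ((hg.fderiv_infty h.isOpen).clm_apply hX).add (contDiffOn_const.mul hg), fun y hy => by
          simp only [hdv y hy, h.fderiv_pow_proj hy]; push_cast; ring⟩
    have hdζ : SqDvd c G Ω (m + 1)
        (fun y => coneSq c G y ^ (l + 1) * fderiv ℝ v y (sharp G γ y)) := by
      refine ⟨fun y => coneSq c G y ^ (l + 1) * fderiv ℝ g y (sharp G γ y)
        - 2 * (m + 1) * g y * coneSq c G y ^ (2 * l + 1) * γ y (sharp G γ y),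
        ((h.cone.smooth_sq.pow _).mul ((hg.fderiv_infty h.isOpen).clm_apply hsζ)).sub
        (((contDiffOn_const.mul hg).mul (h.cone.smooth_sq.pow _)).mul (h.smooth.clm_apply hsζ)),
        fun y hy => ?_⟩
      simp only [hdv y hy, h.fderiv_pow hy, _root_.smul_apply, h.fderiv_sq_sharp hy, smul_eq_mul,
        Nat.add_sub_cancel]
      push_cast
      ring
    refine ((((ih hvd).sq_mul.add (hdX.const_mul 4)).add
      (hvd.const_mul (2 * Module.finrank ℝ V))).add
      ((hdζ.const_mul (-4)).add
        (hvd.mul ((h.cone.smooth_sq.pow (l + 1)).mul hE)))).congr fun y hy => ?_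
    rw [coordLaplacian_congr h.isOpen hfv hy, hcom v hsv y hy]
    ring

theorem sqDvd_iterate (h : IsDefectQuotient c G Ω q (l + 1) γ) (i : ℕ) {f : V → ℝ}
    (hf : SqDvd c G Ω (m + i) f) : SqDvd c G Ω m ((coordLaplacian G)^[i] f) := by
  induction i generalizing f with
  | zero => simpa using hf
  | succ i ih =>
    rw [Function.iterate_succ_apply]
    exact ih (h.sqDvd_laplacian _ hf)

/-- The commutators of the powers of the Laplacian with the defining function. -/
theorem iterate_sq_mul (h : IsDefectQuotient c G Ω q (l + 1) γ) {s : ℝ} {v : V → ℝ}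
    (hv : IsConeHom c Ω s v) (j : ℕ) (hj : j ≤ l + 1) :
    ∃ e : V → ℝ, SqDvd c G Ω (l + 2 - j) e ∧ ∀ y ∈ Ω,
      (coordLaplacian G)^[j] (fun z => coneSq c G z * v z) y =
        coneSq c G y * (coordLaplacian G)^[j] v y
          + 4 * j * (s + Module.finrank ℝ V / 2 + 1 - j) * (coordLaplacian G)^[j - 1] v y
          + e y := by
  have hM := h.cone.metric
  induction j with
  | zero =>
    refine ⟨fun _ => 0, ⟨fun _ => 0, contDiffOn_const, fun y _ => by simp⟩, fun y hy => by simp⟩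
  | succ j ih =>
    obtain ⟨e, he, hee⟩ := ih (by omega)
    obtain ⟨E, hE, hcom⟩ := h.laplacian_sq_mul
    have hvj := hv.iterate hM h.cone.domain.dil h.cone.homogeneous j
    have hs1 := hM.iterate_smooth (j - 1) hv.smooth
    set a : ℝ := 4 * j * (s + Module.finrank ℝ V / 2 + 1 - j) with ha
    have hse := he.smooth h.cone
    have hsub : l + 2 - (j + 1) + 1 = l + 2 - j := by omega
    have hLe : SqDvd c G Ω (l + 2 - (j + 1)) (coordLaplacian G e) :=
      h.sqDvd_laplacian _ (by rw [hsub]; exact he)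
    have hLE : SqDvd c G Ω (l + 1) (fun y => coneSq c G y ^ (l + 1) *
        (-4 * fderiv ℝ ((coordLaplacian G)^[j] v) y (sharp G γ y)
          + E y * (coordLaplacian G)^[j] v y)) :=
      ⟨_, (contDiffOn_const.mul ((hvj.smooth.fderiv_infty h.isOpen).clm_apply
        (hM.smooth_sharp h.smooth))).add (hE.mul hvj.smooth), fun y _ => rfl⟩
    -- The new error has order l + 1, the old one loses one order under Δ; both have order at least
    -- l + 2 - (j + 1).
    refine ⟨_, (hLE.of_le h.cone (by omega)).add hLe, fun y hy => ?_⟩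
    have e1 : EqOn ((coordLaplacian G)^[j] fun z => coneSq c G z * v z)
        (fun y => (coneSq c G y * (coordLaplacian G)^[j] v y
          + a * (coordLaplacian G)^[j - 1] v y) + e y) Ω := fun z hz => hee z hz
    have s1 : ContDiffOn ℝ ∞ (fun y => coneSq c G y * (coordLaplacian G)^[j] v y) Ω :=
      h.cone.smooth_sq.mul hvj.smooth
    have s2 : ContDiffOn ℝ ∞ (fun y => a * (coordLaplacian G)^[j - 1] v y) Ω :=
      contDiffOn_const.mul hs1
    -- For j = 0 the exponent j - 1 is truncated to 0, which is harmless as a = 0.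
    have e2 : a * coordLaplacian G ((coordLaplacian G)^[j - 1] v) y =
        a * (coordLaplacian G)^[j] v y := by
      cases j with
      | zero => simp [ha]
      | succ j => rw [Nat.add_sub_cancel, ← Function.iterate_succ_apply' (f := coordLaplacian G)]
    rw [Function.iterate_succ_apply', coordLaplacian_congr h.isOpen e1 hy,
      hM.laplacian_add (s1.add s2) hse hy, hM.laplacian_add s1 s2 hy, coordLaplacian_const_mul,
      hcom _ hvj.smooth y hy, hvj.fderiv_proj h.isOpen hy, e2, Function.iterate_succ_apply',
      Nat.add_sub_cancel, ha]
    push_cast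
    ring

end IsDefectQuotient

end Cone

/-! ### The operator along the cone -/

section Cone

set_option synthInstance.maxHeartbeats 400000

variable {V : Type} [NormedAddCommGroup V] [NormedSpace ℝ V]
  {c : ConeFrame V} {G : V → V →L[ℝ] V →L[ℝ] ℝ} {Ω : Set V} {y : V} {q : V → ℝ} {l : ℕ}
  {γ : V → V →L[ℝ] ℝ}

/-- The operator `u ↦ ∑ a_j Δ^{k-j} (f Δ^j u)` in coordinates. -/
def coordOp (G : V → V →L[ℝ] V →L[ℝ] ℝ) (n k : ℕ) (w w' : ℝ) (f u : V → ℝ) (y : V) : ℝ :=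
  ∑ j ∈ Finset.range (k + 1), opCoeff n k w w' j *
    (coordLaplacian G)^[k - j] (fun z => f z * (coordLaplacian G)^[j] u z) y

/-- The binomial and both rising factorials change by one factor. In the notation of
`coordOp_sq_mul`, this is the recursion a_{j+1} b_{j+1} = -a_j d_j that makes the sum telescope. -/
theorem opCoeff_succ (n k : ℕ) (w w' : ℝ) (j : ℕ) (hj : j < k) :
    opCoeff n k w w' (j + 1) * ((j + 1) * (w + n / 2 - (j + 1))) =
      opCoeff n k w w' j * ((k - j) * (k - w - w' - n / 2 + j)) := by
  have hc : (k.choose (j + 1) : ℝ) * (j + 1) = k.choose j * (k - j) := by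
    have := Nat.choose_succ_right_eq k j
    rw [← Nat.cast_sub hj.le]
    exact_mod_cast this
  have hk : k - j = (k - (j + 1)) + 1 := by omega
  have e : ((k - (j + 1) : ℕ) : ℝ) = k - (j + 1) := by
    rw [Nat.cast_sub hj]; push_cast; ring
  rw [opCoeff, opCoeff, hk, ascPochhammer_succ_right, ascPochhammer_succ_right]
  simp only [Polynomial.eval_mul, Polynomial.eval_add, Polynomial.eval_X, Polynomial.eval_natCast,
    e]
  set A := (ascPochhammer ℝ j).eval (k - w - w' - n / 2 : ℝ)
  set B := (ascPochhammer ℝ (k - (j + 1))).eval (n / 2 + w - k : ℝ)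
  linear_combination (A * (k - w - w' - n / 2 + j) * B * (w + n / 2 - (j + 1))) * hc

variable [FiniteDimensional ℝ V]

namespace IsDefectQuotient

/-- The operator annihilates, along the cone, the functions which vanish there. -/
theorem coordOp_sq_mul (h : IsDefectQuotient c G Ω q (l + 1) γ) {n : ℕ}
    (hn : Module.finrank ℝ V = n + 2) {w w' : ℝ} {f v : V → ℝ} (hf : IsConeHom c Ω w' f)
    (hv : IsConeHom c Ω (w - 2) v) (hy : y ∈ Ω) (h0 : c.rho y = 0) :
    coordOp G n (l + 1) w w' f (fun z => coneSq c G z * v z) y = 0 := by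
  have hM := h.cone.metric
  have hN : (Module.finrank ℝ V : ℝ) = n + 2 := by exact_mod_cast hn
  -- P j is common to the summands j and j + 1. The number b_j comes from commuting Q past the inner
  -- Δ^j on v of weight w - 2, and d_j from the outer Δ^{k-j} on f Δ^j v of weight w + w' - 2 - 2j,
  -- where k = l + 1.
  set P : ℕ → ℝ := fun j => (coordLaplacian G)^[l + 1 - j - 1]
    (fun z => f z * (coordLaplacian G)^[j] v z) y with hP
  set d : ℕ → ℝ := fun j => 4 * (l + 1 - j) * (w + w' + n / 2 - j - (l + 1)) with hd
  set b : ℕ → ℝ := fun j => 4 * j * (w + n / 2 - j) with hb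
  have term : ∀ j ≤ l + 1, (coordLaplacian G)^[l + 1 - j]
      (fun z => f z * (coordLaplacian G)^[j] (fun z => coneSq c G z * v z) z) y =
        d j * P j + b j * P (j - 1) := by
    intro j hj
    have hvj := hv.iterate hM h.cone.domain.dil h.cone.homogeneous j
    obtain ⟨e, he, hee⟩ := h.iterate_sq_mul hv j hj
    obtain ⟨e', he', hee'⟩ := h.iterate_sq_mul (hf.mul hvj) (l + 1 - j) (by omega)
    have hs1 : ContDiffOn ℝ ∞ (fun z => f z * (coordLaplacian G)^[j - 1] v z) Ω :=
      hf.smooth.mul (hM.iterate_smooth (j - 1) hv.smooth)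
    have e1 : EqOn (fun z => f z * (coordLaplacian G)^[j] (fun z => coneSq c G z * v z) z)
        (fun z => (coneSq c G z * (f z * (coordLaplacian G)^[j] v z)
          + b j * (f z * (coordLaplacian G)^[j - 1] v z)) + f z * e z) Ω := by
      intro z hz
      simp only
      rw [hee z hz, hN]
      ring
    have s1 : ContDiffOn ℝ ∞ (fun z => coneSq c G z * (f z * (coordLaplacian G)^[j] v z)) Ω :=
      h.cone.smooth_sq.mul (hf.mul hvj).smooth
    have s2 : ContDiffOn ℝ ∞ (fun z => b j * (f z * (coordLaplacian G)^[j - 1] v z)) Ω :=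
      contDiffOn_const.mul hs1
    have s3 : ContDiffOn ℝ ∞ (fun z => f z * e z) Ω := hf.smooth.mul (he.smooth h.cone)
    -- The inner error has order l + 2 - j and meets l + 1 - j Laplacians, so exactly one factor Q
    -- is certain to remain.
    have z1 : (coordLaplacian G)^[l + 1 - j] (fun z => f z * e z) y = 0 := by
      have h1 : SqDvd c G Ω (0 + 1 + (l + 1 - j)) (fun z => f z * e z) := by
        have := he.mul hf.smooth
        rwa [show 0 + 1 + (l + 1 - j) = l + 2 - j by omega]
      exact (h.sqDvd_iterate _ h1).eq_zero h.cone hy h0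
    have z2 : e' y = 0 := by
      have h1 : SqDvd c G Ω (0 + 1) e' := he'.of_le h.cone (by omega)
      exact h1.eq_zero h.cone hy h0
    have e2 : b j * (coordLaplacian G)^[l + 1 - j]
        (fun z => f z * (coordLaplacian G)^[j - 1] v z) y = b j * P (j - 1) := by
      cases j with
      | zero => simp [hb]
      | succ j =>
        simp only [hP, Nat.add_sub_cancel]
        rw [show l + 1 - j - 1 = l + 1 - (j + 1) by omega]
    rw [iterate_laplacian_congr h.isOpen _ e1 hy, hM.iterate_add _ (s1.add s2) s3 hy]
    beta_reduce
    rw [hM.iterate_add _ s1 s2 hy]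
    beta_reduce
    rw [iterate_laplacian_const_mul]
    beta_reduce
    rw [z1, hee' y hy, z2,
      h.cone.sq_eq_zero hy h0, e2, hN]
    simp only [hd, hP]
    rw [Nat.cast_sub hj]
    push_cast
    ring
  rw [coordOp, Finset.sum_congr rfl fun j hj => by
    rw [term j (Nat.lt_succ_iff.1 (Finset.mem_range.1 hj))]]
  simp only [mul_add, Finset.sum_add_distrib]
  rw [Finset.sum_range_succ, Finset.sum_range_succ' (fun j => opCoeff n (l + 1) w w' j *
    (b j * P (j - 1)))]
  -- These zeros also discard the values of P reached by truncated subtraction at both ends of the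
  -- sum.
  have hd0 : d (l + 1) = 0 := by simp [hd]
  have hb0 : b 0 = 0 := by simp [hb]
  rw [hd0, hb0, zero_mul, mul_zero, add_zero, zero_mul, mul_zero, add_zero,
    ← Finset.sum_add_distrib]
  refine Finset.sum_eq_zero fun j hj => ?_
  have := opCoeff_succ n (l + 1) w w' j (Finset.mem_range.1 hj)
  simp only [hd, hb, Nat.add_sub_cancel]
  push_cast at this ⊢
  linear_combination (4 * P j) * this

/-- Hadamard division by ρ becomes division by Q since q is invertible; Q has weight 2, so the
quotient has weight w - 2 off the cone and then everywhere. -/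
theorem exists_eq_sq_mul_of_hom (h : IsDefectQuotient c G Ω q (l + 1) γ) {w : ℝ} {u : V → ℝ}
    (hu : IsConeHom c Ω w u) (h0 : ∀ y ∈ Ω, c.rho y = 0 → u y = 0) :
    ∃ v, IsConeHom c Ω (w - 2) v ∧ EqOn u (fun y => coneSq c G y * v y) Ω := by
  obtain ⟨v, hv, e⟩ := h.exists_eq_sq_smul hu.smooth h0
  refine ⟨v, ⟨hv, fun y hy t ht => ?_⟩, fun y hy => e y hy⟩
  refine h.cancel 1 (f := fun y => v (c.dil t y)) (g := fun y => t ^ (w - 2) * v y)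
    (hv.continuousOn.comp (c.dil t).continuous.continuousOn
      fun y hy => h.cone.domain.dil y hy t ht)
    (continuousOn_const.mul hv.continuousOn) (fun y hy => ?_) hy
  have h1 := hu.hom y hy t ht
  rw [e y hy, e _ (h.cone.domain.dil y hy t ht), h.cone.sq_dil hy ht] at h1
  have h2 : t ^ w = t ^ (w - 2) * t ^ 2 := by
    rw [← Real.rpow_two, ← Real.rpow_add ht]; ring_nf
  rw [h2] at h1
  simp only [smul_eq_mul] at h1
  have ht2 : t ^ 2 ≠ 0 := by positivity
  refine mul_left_cancel₀ ht2 ?_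
  linear_combination h1

/-- Along the cone, the operator only depends on the values of the function along the cone. -/
theorem coordOp_congr (h : IsDefectQuotient c G Ω q (l + 1) γ) {n : ℕ}
    (hn : Module.finrank ℝ V = n + 2) {w w' : ℝ} {f u₁ u₂ : V → ℝ} (hf : IsConeHom c Ω w' f)
    (h₁ : IsConeHom c Ω w u₁) (h₂ : IsConeHom c Ω w u₂)
    (h12 : ∀ y ∈ Ω, c.rho y = 0 → u₁ y = u₂ y) (hy : y ∈ Ω) (h0 : c.rho y = 0) :
    coordOp G n (l + 1) w w' f u₁ y = coordOp G n (l + 1) w w' f u₂ y := by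
  have hM := h.cone.metric
  obtain ⟨v, hv, e⟩ := h.exists_eq_sq_mul_of_hom (h₁.sub h₂)
    fun y hy h0 => sub_eq_zero.2 (h12 y hy h0)
  have key := h.coordOp_sq_mul hn hf hv hy h0
  have hsv : ContDiffOn ℝ ∞ (fun y => coneSq c G y * v y) Ω := h.cone.smooth_sq.mul hv.smooth
  have e' : EqOn u₁ (fun y => u₂ y + coneSq c G y * v y) Ω := by
    intro z hz
    have := e hz
    simp only at this ⊢
    linarith
  -- By linearity the difference of the two sides is the operator applied to the multiple Qv of Q.
  rw [← add_zero (coordOp G n (l + 1) w w' f u₂ y), ← key]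
  simp only [coordOp, ← Finset.sum_add_distrib, ← mul_add]
  refine Finset.sum_congr rfl fun j _ => ?_
  congr 1
  have e2 : EqOn (fun z => f z * (coordLaplacian G)^[j] u₁ z)
      (fun z => f z * (coordLaplacian G)^[j] u₂ z
        + f z * (coordLaplacian G)^[j] (fun y => coneSq c G y * v y) z) Ω := by
    intro z hz
    simp only
    rw [iterate_laplacian_congr h.isOpen j e' hz, hM.iterate_add j h₂.smooth hsv hz, mul_add]
  rw [iterate_laplacian_congr h.isOpen _ e2 hy, hM.iterate_add _
    (hf.smooth.mul (hM.iterate_smooth j h₂.smooth)) (hf.smooth.mul (hM.iterate_smooth j hsv)) hy]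

end IsDefectQuotient

end Cone

/-! ### Smoothness and continuity of coordinate expressions -/

section ChartMetric

set_option synthInstance.maxHeartbeats 400000

variable {V : Type*} [NormedAddCommGroup V] [NormedSpace ℝ V]
  {H : Type*} [TopologicalSpace H] (I : ModelWithCorners ℝ V H)
  {X : Type*} [TopologicalSpace X] [ChartedSpace H X]

/-- The part of the target of the preferred chart at `p` which corresponds to `U`. -/
def chartDom (p : X) (U : Set X) : Set V :=
  (extChartAt I p).target ∩ (extChartAt I p).symm ⁻¹' U

/-- The derivative of the inverse of the preferred chart at `p`. -/
def chartDeriv (p : X) (y : V) : V →L[ℝ] TangentSpace I ((extChartAt I p).symm y) :=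
  mfderivWithin 𝓘(ℝ, V) I (extChartAt I p).symm (range I) y

variable {I} {p : X} {U : Set X} {y : V}

theorem chartMetric_apply (g : BilinField I X) (Y Z : V) :
    chartMetric I g p y Y Z =
      g ((extChartAt I p).symm y) (chartDeriv I p y Y) (chartDeriv I p y Z) := rfl

theorem isOpen_chartDom [I.Boundaryless] (hU : IsOpen U) : IsOpen (chartDom I p U) :=
  (continuousOn_extChartAt_symm p).isOpen_inter_preimage (isOpen_extChartAt_target p) hU

theorem mem_chartDom_self (hp : p ∈ U) : extChartAt I p p ∈ chartDom I p U :=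
  ⟨mem_extChartAt_target p, by simpa using hp⟩

variable [IsManifold I ∞ X]

/-- The coordinate vector field of Y is the tangent map of the inverse chart composed with a
constant field; inserting such fields in g reduces smoothness of its coordinate expression to that
of g. -/
theorem contMDiffOn_chartDeriv [I.Boundaryless] (p : X) (Y : V) :
    ContMDiffOn 𝓘(ℝ, V) I.tangent ∞
      (fun y => TotalSpace.mk' V (E := TangentSpace I) ((extChartAt I p).symm y)
        (chartDeriv I p y Y)) (extChartAt I p).target := by
  have : IsManifold I 1 X := IsManifold.of_le (n := ∞) (by norm_cast)
  have hT : UniqueMDiffOn 𝓘(ℝ, V) (extChartAt I p).target :=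
    (isOpen_extChartAt_target p).uniqueMDiffOn
  have h1 := (contMDiffOn_extChartAt_symm (I := I) (n := ∞) p).contMDiffOn_tangentMapWithin
    (m := ∞) (by norm_cast) hT
  have h2 : ContMDiffOn 𝓘(ℝ, V) 𝓘(ℝ, V).tangent ∞
      (fun y => TotalSpace.mk' V (E := TangentSpace 𝓘(ℝ, V)) y Y) (extChartAt I p).target := by
    exact fun y hy => contMDiffWithinAt_vectorSpace_iff_contDiffWithinAt.2
      (contDiffWithinAt_const (c := (Y : V)))
  refine (h1.comp h2 fun y hy => hy).congr fun y hy => ?_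
  simp only [Function.comp_def, tangentMapWithin, chartDeriv]
  rw [I.range_eq_univ, mfderivWithin_univ,
    mfderivWithin_of_mem_nhds ((isOpen_extChartAt_target p).mem_nhds hy)]
  rfl

theorem BilinField.SmoothOn.chartMetric [FiniteDimensional ℝ V] [I.Boundaryless]
    {g : BilinField I X} (hg : g.SmoothOn I U) (p : X) :
    ContDiffOn ℝ ∞ (chartMetric I g p) (chartDom I p U) := by
  have : IsManifold I 1 X := IsManifold.of_le (n := ∞) (by norm_cast)
  refine contDiffOn_clm_apply.2 fun Y => contDiffOn_clm_apply.2 fun Z => ?_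
  have hs := (contMDiffOn_extChartAt_symm (I := I) (n := ∞) p).mono
    (inter_subset_left : chartDom I p U ⊆ _)
  have : ContMDiffOn 𝓘(ℝ, V) (I.prod 𝓘(ℝ, ℝ)) ∞
      (fun m => TotalSpace.mk' ℝ (E := Bundle.Trivial X ℝ) ((extChartAt I p).symm m)
        (g ((extChartAt I p).symm m) (chartDeriv I p m Y) (chartDeriv I p m Z)))
      (chartDom I p U) := by
    apply ContMDiffOn.clm_bundle_apply₂ (F₁ := V) (F₂ := V)
    · exact ContMDiffOn.comp hg hs fun y hy => hy.2
    · exact (contMDiffOn_chartDeriv p Y).mono inter_subset_left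
    · exact (contMDiffOn_chartDeriv p Z).mono inter_subset_left
  rw [← contMDiffOn_iff_contDiffOn]
  intro y hy
  have := this y hy
  simp only [contMDiffWithinAt_totalSpace] at this
  exact this.2

theorem BilinField.ContOn.chartMetric [FiniteDimensional ℝ V] [I.Boundaryless]
    {g : BilinField I X} (hg : g.ContOn I U) (p : X) :
    ContinuousOn (chartMetric I g p) (chartDom I p U) := by
  have : IsManifold I 1 X := IsManifold.of_le (n := ∞) (by norm_cast)
  refine continuousOn_clm_apply.2 fun Y => continuousOn_clm_apply.2 fun Z => ?_
  have hs := (continuousOn_extChartAt_symm (I := I) p).mono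
    (inter_subset_left : chartDom I p U ⊆ _)
  have : ContinuousOn
      (fun m => TotalSpace.mk' ℝ (E := Bundle.Trivial X ℝ) ((extChartAt I p).symm m)
        (g ((extChartAt I p).symm m) (chartDeriv I p m Y) (chartDeriv I p m Z)))
      (chartDom I p U) := by
    apply ContinuousOn.clm_bundle_apply₂ (F₁ := V) (F₂ := V)
    · exact ContinuousOn.comp hg hs fun y hy => hy.2
    · exact ((contMDiffOn_chartDeriv p Y).mono inter_subset_left).continuousOn
    · exact ((contMDiffOn_chartDeriv p Z).mono inter_subset_left).continuousOn
  intro y hy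
  have := this y hy
  simp only [FiberBundle.continuousWithinAt_totalSpace] at this
  exact this.2

end ChartMetric

/-! ### Symmetry and nondegeneracy from the signature -/

section Signature

variable {V : Type*} [AddCommGroup V] [Module ℝ V] [TopologicalSpace V] {p q : ℕ}
  {B : V →L[ℝ] V →L[ℝ] ℝ}

theorem HasSignature.symm (h : HasSignature p q B) (Y Z : V) : B Y Z = B Z Y := by
  obtain ⟨b, hb⟩ := h
  rw [← b.sum_repr Y, ← b.sum_repr Z]
  simp only [map_sum, map_smul, _root_.sum_apply, _root_.smul_apply, hb, smul_eq_mul]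
  simp [mul_comm]

theorem HasSignature.eq_zero (h : HasSignature p q B) {Y : V} (hY : ∀ Z, B Y Z = 0) : Y = 0 := by
  obtain ⟨b, hb⟩ := h
  refine b.ext_elem fun j => ?_
  have := hY (b j)
  rw [← b.sum_repr Y] at this
  simp only [map_sum, map_smul, _root_.sum_apply, _root_.smul_apply, hb, smul_eq_mul] at this
  rcases j with j | j <;> simpa using this

end Signature

theorem isInvertible_of_eq_zero {V : Type*} [NormedAddCommGroup V] [NormedSpace ℝ V]
    [FiniteDimensional ℝ V] {B : V →L[ℝ] V →L[ℝ] ℝ} (h : ∀ Y, (∀ Z, B Y Z = 0) → Y = 0) :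
    B.IsInvertible := by
  have hinj : Function.Injective (B : V →ₗ[ℝ] V →L[ℝ] ℝ) :=
    (injective_iff_map_eq_zero _).2 fun Y hY => h Y fun Z => by
      simpa using congrArg (fun L : V →L[ℝ] ℝ => L Z) hY
  have hdim : Module.finrank ℝ V = Module.finrank ℝ (V →L[ℝ] ℝ) := by
    rw [← (LinearMap.toContinuousLinearMap (𝕜 := ℝ) (E := V) (F' := ℝ)).finrank_eq]
    exact (Subspace.dual_finrank_eq (K := ℝ) (V := V)).symm
  exact ⟨(LinearEquiv.ofInjectiveOfFinrankEq (B : V →ₗ[ℝ] V →L[ℝ] ℝ) hinj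
    hdim).toContinuousLinearEquiv, by ext; rfl⟩

theorem IsMetricOn.mono {V : Type*} [NormedAddCommGroup V] [NormedSpace ℝ V]
    {G : V → V →L[ℝ] V →L[ℝ] ℝ} {Ω Ω' : Set V} (h : IsMetricOn G Ω) (hΩ' : IsOpen Ω')
    (hs : Ω' ⊆ Ω) : IsMetricOn G Ω' where
  isOpen := hΩ'
  smooth := h.smooth.mono hs
  symm y hy := h.symm y (hs hy)
  invertible y hy := h.invertible y (hs hy)

/-! ### Changes of coordinates as isometries -/

section Transition

set_option synthInstance.maxHeartbeats 400000

variable {V : Type*} [NormedAddCommGroup V] [NormedSpace ℝ V]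
  {H : Type*} [TopologicalSpace H] {I : ModelWithCorners ℝ V H}
  {X : Type*} [TopologicalSpace X] [ChartedSpace H X] {p p₀ x x' : X} {U : Set X} {y : V}

theorem BilinField.congr_point (g : BilinField I X) (h : x = x') (Y Z : V) :
    g x Y Z = g x' Y Z := by subst h; rfl

theorem chartDeriv_eq_mfderiv [I.Boundaryless] :
    chartDeriv I p y = mfderiv 𝓘(ℝ, V) I (extChartAt I p).symm y := by
  rw [chartDeriv, I.range_eq_univ, mfderivWithin_univ]

variable (I) in
/-- The change of coordinates from the preferred chart at `p` to that at `p₀`. -/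
def chartChange (p p₀ : X) (y : V) : V := extChartAt I p₀ ((extChartAt I p).symm y)

theorem chartChange_self (hx : x ∈ (extChartAt I p).source) :
    chartChange I p p₀ (extChartAt I p x) = extChartAt I p₀ x := by
  rw [chartChange, (extChartAt I p).left_inv hx]

theorem symm_chartChange (hy : y ∈ chartDom I p (extChartAt I p₀).source) :
    (extChartAt I p₀).symm (chartChange I p p₀ y) = (extChartAt I p).symm y :=
  (extChartAt I p₀).left_inv hy.2

theorem chartDom_mono {U' : Set X} (h : U ⊆ U') : chartDom I p U ⊆ chartDom I p U' :=
  inter_subset_inter_right _ (preimage_mono h)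

theorem isOpen_chartDom_source [I.Boundaryless] (p p₀ : X) : IsOpen (chartDom I p (extChartAt I p₀).source) :=
  isOpen_chartDom (isOpen_extChartAt_source p₀)

variable [IsManifold I ∞ X]

theorem contDiffOn_chartChange (p p₀ : X) :
    ContDiffOn ℝ ∞ (chartChange I p p₀) (chartDom I p (extChartAt I p₀).source) := by
  rw [← contMDiffOn_iff_contDiffOn]
  have h1 := (contMDiffOn_extChartAt_symm (I := I) (n := ∞) p).mono
    (inter_subset_left : chartDom I p (extChartAt I p₀).source ⊆ _)
  have h2 := contMDiffOn_extChartAt (I := I) (n := ∞) (x := p₀)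
  rw [← extChartAt_source I] at h2
  exact h2.comp h1 fun y hy => hy.2

variable [I.Boundaryless]

theorem mdifferentiableAt_extChartAt_symm (hy : y ∈ (extChartAt I p).target) :
    MDifferentiableAt 𝓘(ℝ, V) I (extChartAt I p).symm y :=
  ((contMDiffOn_extChartAt_symm (I := I) (n := ∞) p).contMDiffAt
    ((isOpen_extChartAt_target p).mem_nhds hy)).mdifferentiableAt (by simp)

/-- The chain rule for the inverse chart at p factored through the chart at p₀. Tangent spaces at
propositionally equal points are compared in the model space V. -/
theorem chartDeriv_chartChange (hy : y ∈ chartDom I p (extChartAt I p₀).source) (Y : V) :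
    (chartDeriv I p y Y : V) =
      chartDeriv I p₀ (chartChange I p p₀ y) (fderiv ℝ (chartChange I p p₀) y Y) := by
  have hO := isOpen_chartDom_source (I := I) p p₀
  have hψ : MDifferentiableAt 𝓘(ℝ, V) 𝓘(ℝ, V) (chartChange I p p₀) y :=
    ((contDiffOn_chartChange p p₀).differentiableAt_infty hO hy).mdifferentiableAt
  have hm : chartChange I p p₀ y ∈ (extChartAt I p₀).target := (extChartAt I p₀).map_source hy.2
  have hc := mfderiv_comp y (mdifferentiableAt_extChartAt_symm hm) hψ
  have he : (extChartAt I p₀).symm ∘ chartChange I p p₀ =ᶠ[nhds y] (extChartAt I p).symm := by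
    filter_upwards [hO.mem_nhds hy] with z hz using symm_chartChange hz
  have h2 := he.mfderiv_eq (I := 𝓘(ℝ, V)) (I' := I)
  rw [chartDeriv_eq_mfderiv, chartDeriv_eq_mfderiv, ← mfderiv_eq_fderiv]
  exact (congrArg (fun L : V →L[ℝ] V => L Y) h2).symm.trans
    (congrArg (fun L : V →L[ℝ] V => L Y) hc)

theorem chartMetric_chartChange (g : BilinField I X)
    (hy : y ∈ chartDom I p (extChartAt I p₀).source) (Y Z : V) :
    chartMetric I g p y Y Z = chartMetric I g p₀ (chartChange I p p₀ y)
      (fderiv ℝ (chartChange I p p₀) y Y) (fderiv ℝ (chartChange I p p₀) y Z) := by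
  rw [chartMetric_apply, chartMetric_apply]
  have e1 := chartDeriv_chartChange hy Y
  have e2 := chartDeriv_chartChange hy Z
  refine (BilinField.congr_point g (symm_chartChange hy).symm _ _).trans ?_
  exact congrArg₂ (fun a b : V => (g ((extChartAt I p₀).symm (chartChange I p p₀ y)) :
    V →L[ℝ] V →L[ℝ] ℝ) a b) e1 e2

variable [FiniteDimensional ℝ V] {r s : ℕ} {g : BilinField I X}

theorem IsPseudoRiemannianOn.isMetricOn_chartMetric (hg : IsPseudoRiemannianOn I r s g U)
    (hU : IsOpen U) (p : X) : IsMetricOn (chartMetric I g p) (chartDom I p U) where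
  isOpen := isOpen_chartDom hU
  smooth := hg.smooth.chartMetric p
  symm y hy Y Z := (hg.signature _ hy.2).symm _ _
  invertible y hy := by
    have : IsManifold I 1 X := IsManifold.of_le (n := ∞) (by norm_cast)
    obtain ⟨D, hD⟩ := isInvertible_mfderivWithin_extChartAt_symm (I := I) hy.1
    have hD' : ∀ Y, chartDeriv I p y Y = D Y := fun Y => by rw [chartDeriv, ← hD]; rfl
    refine isInvertible_of_eq_zero fun Y hY => ?_
    have : D Y = 0 := (hg.signature _ hy.2).eq_zero fun Z => by
      have e : chartDeriv I p y (D.symm Z) = Z := (hD' _).trans (D.apply_symm_apply Z)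
      rw [← e, ← hD']
      exact hY (D.symm Z)
    exact D.map_eq_zero_iff.1 this

theorem IsPseudoRiemannianOn.isIsometryOn_chartChange (hg : IsPseudoRiemannianOn I r s g U)
    (hU : IsOpen U) (p p₀ : X) :
    IsIsometryOn (chartMetric I g p) (chartMetric I g p₀)
      (chartDom I p (U ∩ (extChartAt I p₀).source)) (chartDom I p₀ U) (chartChange I p p₀) where
  source := (hg.isMetricOn_chartMetric hU p).mono (isOpen_chartDom
    (hU.inter (isOpen_extChartAt_source p₀))) (chartDom_mono inter_subset_left)
  target := hg.isMetricOn_chartMetric hU p₀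
  mapsTo y hy := ⟨(extChartAt I p₀).map_source hy.2.2, by
    rw [mem_preimage, symm_chartChange ⟨hy.1, hy.2.2⟩]; exact hy.2.1⟩
  smooth := (contDiffOn_chartChange p p₀).mono (chartDom_mono inter_subset_right)
  pullback y hy Y Z := chartMetric_chartChange g ⟨hy.1, hy.2.2⟩ Y Z

end Transition

/-! ### The Laplacian and Ricci tensor in a fixed chart -/

section Invariance

set_option synthInstance.maxHeartbeats 400000

variable {V : Type*} [NormedAddCommGroup V] [NormedSpace ℝ V]
  {H : Type*} [TopologicalSpace H] {I : ModelWithCorners ℝ V H}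
  {X : Type*} [TopologicalSpace X] [ChartedSpace H X] [IsManifold I ∞ X]
  {p p₀ x x' : X} {U : Set X} {y : V} {r s : ℕ} {g : BilinField I X} {u : X → ℝ}

theorem ContMDiffOn.comp_extChartAt_symm (hu : ContMDiffOn I 𝓘(ℝ, ℝ) ∞ u U) (p : X) :
    ContDiffOn ℝ ∞ (fun y => u ((extChartAt I p).symm y)) (chartDom I p U) := by
  rw [← contMDiffOn_iff_contDiffOn]
  exact hu.comp ((contMDiffOn_extChartAt_symm (I := I) (n := ∞) p).mono
    (inter_subset_left : chartDom I p U ⊆ _)) fun y hy => hy.2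

variable [I.Boundaryless] [FiniteDimensional ℝ V]

/-- The Laplacian at x is defined by the chart at x; the transition to the chart at p is an isometry
of coordinate metrics, which preserves it. -/
theorem IsPseudoRiemannianOn.laplacian_eq (hg : IsPseudoRiemannianOn I r s g U) (hU : IsOpen U)
    (hu : ContMDiffOn I 𝓘(ℝ, ℝ) ∞ u U) (hx : x ∈ U) (hx' : x ∈ (extChartAt I p).source) :
    laplacian I g u x = coordLaplacian (chartMetric I g p)
      (fun y => u ((extChartAt I p).symm y)) (extChartAt I p x) := by
  have iso := hg.isIsometryOn_chartChange hU x p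
  have hm : extChartAt I x x ∈ chartDom I x (U ∩ (extChartAt I p).source) :=
    mem_chartDom_self ⟨hx, hx'⟩
  have := iso.laplacian hm (hu.comp_extChartAt_symm p)
  rw [chartChange_self (mem_extChartAt_source x)] at this
  rw [← this, laplacian]
  refine coordLaplacian_congr iso.source.isOpen (fun z hz => ?_) hm
  rw [symm_chartChange ⟨hz.1, hz.2.2⟩]
  rfl

theorem IsPseudoRiemannianOn.smooth_laplacian (hg : IsPseudoRiemannianOn I r s g U)
    (hU : IsOpen U) (hu : ContMDiffOn I 𝓘(ℝ, ℝ) ∞ u U) :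
    ContMDiffOn I 𝓘(ℝ, ℝ) ∞ (laplacian I g u) U := by
  intro x hx
  have h1 := ((hg.isMetricOn_chartMetric hU x).smooth_laplacian
    (hu.comp_extChartAt_symm x)).contMDiffOn
  have h2 := contMDiffOn_extChartAt (I := I) (n := ∞) (x := x)
  rw [← extChartAt_source I] at h2
  have h3 : ContMDiffOn I 𝓘(ℝ, ℝ) ∞ (laplacian I g u) (U ∩ (extChartAt I x).source) :=
    (h1.comp (h2.mono inter_subset_right) fun z hz => ⟨(extChartAt I x).map_source hz.2, by
      rw [mem_preimage, (extChartAt I x).left_inv hz.2]; exact hz.1⟩).congr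
      fun z hz => hg.laplacian_eq hU hu hz.1 hz.2
  exact (h3.contMDiffAt ((hU.inter (isOpen_extChartAt_source x)).mem_nhds
    ⟨hx, mem_extChartAt_source x⟩)).contMDiffWithinAt

theorem IsPseudoRiemannianOn.smooth_iterate (hg : IsPseudoRiemannianOn I r s g U)
    (hU : IsOpen U) (hu : ContMDiffOn I 𝓘(ℝ, ℝ) ∞ u U) (j : ℕ) :
    ContMDiffOn I 𝓘(ℝ, ℝ) ∞ ((laplacian I g)^[j] u) U := by
  induction j with
  | zero => simpa using hu
  | succ j ih => rw [Function.iterate_succ_apply']; exact hg.smooth_laplacian hU ih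

/-- Iterates need this on a whole chart domain, because the definition changes the chart from point
to point. -/
theorem IsPseudoRiemannianOn.iterate_eq (hg : IsPseudoRiemannianOn I r s g U) (hU : IsOpen U)
    (hu : ContMDiffOn I 𝓘(ℝ, ℝ) ∞ u U) (p : X) (j : ℕ) :
    EqOn (fun y => (laplacian I g)^[j] u ((extChartAt I p).symm y))
      ((coordLaplacian (chartMetric I g p))^[j] fun y => u ((extChartAt I p).symm y))
      (chartDom I p U) := by
  induction j with
  | zero => exact fun _ _ => rfl
  | succ j ih =>
    intro y hy
    simp only [Function.iterate_succ_apply']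
    rw [hg.laplacian_eq hU (hg.smooth_iterate hU hu j) hy.2 ((extChartAt I p).map_target hy.1),
      (extChartAt I p).right_inv hy.1]
    exact coordLaplacian_congr (isOpen_chartDom hU) ih hy

theorem IsPseudoRiemannianOn.coordRicci_eq (hg : IsPseudoRiemannianOn I r s g U) (hU : IsOpen U)
    (hy : y ∈ chartDom I p U) (Y Z : V) :
    coordRicci (chartMetric I g p) y Y Z =
      ricci I g ((extChartAt I p).symm y) (chartDeriv I p y Y) (chartDeriv I p y Z) := by
  have : IsManifold I 1 X := IsManifold.of_le (n := ∞) (by norm_cast)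
  set x := (extChartAt I p).symm y with hx
  have iso := hg.isIsometryOn_chartChange hU p x
  have hm : y ∈ chartDom I p (U ∩ (extChartAt I x).source) :=
    ⟨hy.1, hy.2, mem_extChartAt_source x⟩
  have hd : ∀ Y : V, fderiv ℝ (chartChange I p x) y Y = (chartDeriv I p y Y : V) := fun Y => by
    have e1 := chartDeriv_chartChange (p₀ := x) ⟨hy.1, hm.2.2⟩ Y
    -- The tangent space at x is identified with V by the preferred chart at x, whose derivative
    -- there is the identity.
    have e2 : chartDeriv I x (extChartAt I x x) = ContinuousLinearMap.id ℝ V :=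
      mfderivWithin_range_extChartAt_symm
    exact (e1.trans (congrArg (fun L : V →L[ℝ] V => L (fderiv ℝ (chartChange I p x) y Y)) e2)).symm
  rw [iso.ricci hm, hd, hd, ricci, mfderiv_extChartAt_self]
  rfl

end Invariance

/-! ### Product charts of M × ℝ × ℝ, dilations and homogeneity -/

section AmbientChart

set_option synthInstance.maxHeartbeats 400000

/-- The frame of the coordinate model of `M × ℝ × ℝ`: the coordinates are `(x, t, ρ)`. -/
def ambFrame (n : ℕ) : ConeFrame (EuclideanSpace ℝ (Fin n) × (ℝ × ℝ)) where
  rho := (ContinuousLinearMap.snd ℝ ℝ ℝ) ∘L (ContinuousLinearMap.snd ℝ _ (ℝ × ℝ))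
  vec := (0, (0, 1))
  proj := (ContinuousLinearMap.inr ℝ _ (ℝ × ℝ)) ∘L (ContinuousLinearMap.inl ℝ ℝ ℝ) ∘L
    (ContinuousLinearMap.fst ℝ ℝ ℝ) ∘L (ContinuousLinearMap.snd ℝ _ (ℝ × ℝ))
  rho_vec := by simp
  proj_proj y := by simp
  proj_vec := by simp
  rho_proj y := by simp

variable {n : ℕ} {M : Type*} [TopologicalSpace M] [ChartedSpace (EuclideanSpace ℝ (Fin n)) M]
  {z z₀ : M × (ℝ × ℝ)} {U : Set (M × (ℝ × ℝ))} {y : EuclideanSpace ℝ (Fin n) × (ℝ × ℝ)}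
  {s : ℝ}

@[simp] theorem ambFrame_rho (y : EuclideanSpace ℝ (Fin n) × (ℝ × ℝ)) :
    (ambFrame n).rho y = y.2.2 := rfl

@[simp] theorem ambFrame_vec : (ambFrame n).vec = (0, (0, 1)) := rfl

@[simp] theorem ambFrame_proj (y : EuclideanSpace ℝ (Fin n) × (ℝ × ℝ)) :
    (ambFrame n).proj y = (0, (y.2.1, 0)) := rfl

theorem ambFrame_dil (s : ℝ) (y : EuclideanSpace ℝ (Fin n) × (ℝ × ℝ)) :
    (ambFrame n).dil s y = (y.1, (s * y.2.1, y.2.2)) := by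
  rw [ConeFrame.dil_apply, ambFrame_proj]
  ext1
  · simp
  · ext1
    · simp; ring
    · simp

theorem extChartAt_amb (z₀ : M × (ℝ × ℝ)) :
    extChartAt (ambI n) z₀ = (extChartAt (𝓡 n) z₀.1).prod (PartialEquiv.refl (ℝ × ℝ)) := by
  rw [extChartAt_prod, extChartAt_model_space_eq_id]

theorem extChartAt_amb_apply : extChartAt (ambI n) z₀ z = (extChartAt (𝓡 n) z₀.1 z.1, z.2) := by
  rw [extChartAt_amb]; rfl

theorem extChartAt_amb_symm_apply :
    (extChartAt (ambI n) z₀).symm y = ((extChartAt (𝓡 n) z₀.1).symm y.1, y.2) := by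
  rw [extChartAt_amb]; rfl

theorem mem_extChartAt_amb_source :
    z ∈ (extChartAt (ambI n) z₀).source ↔ z.1 ∈ (extChartAt (𝓡 n) z₀.1).source := by
  rw [extChartAt_amb]; simp

theorem mem_extChartAt_amb_target :
    y ∈ (extChartAt (ambI n) z₀).target ↔ y.1 ∈ (extChartAt (𝓡 n) z₀.1).target := by
  rw [extChartAt_amb]; simp

theorem extChartAt_amb_dilation :
    extChartAt (ambI n) z₀ (dilation s z) = (ambFrame n).dil s (extChartAt (ambI n) z₀ z) := by
  rw [extChartAt_amb_apply, extChartAt_amb_apply, ambFrame_dil]; rfl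

theorem extChartAt_amb_symm_dil : (extChartAt (ambI n) z₀).symm ((ambFrame n).dil s y) =
    dilation s ((extChartAt (ambI n) z₀).symm y) := by
  rw [extChartAt_amb_symm_apply, extChartAt_amb_symm_apply, ambFrame_dil]; rfl

theorem dil_mem_chartDom (hd : ∀ z ∈ U, ∀ s : ℝ, 0 < s → dilation s z ∈ U)
    (hy : y ∈ chartDom (ambI n) z₀ U) (hs : 0 < s) :
    (ambFrame n).dil s y ∈ chartDom (ambI n) z₀ U := by
  refine ⟨?_, ?_⟩
  · rw [mem_extChartAt_amb_target, ambFrame_dil]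
    exact mem_extChartAt_amb_target.1 hy.1
  · rw [mem_preimage, extChartAt_amb_symm_dil]
    exact hd _ hy.2 s hs

theorem contMDiff_dilation (s : ℝ) :
    ContMDiff (ambI n) (ambI n) ∞ (dilation s : M × (ℝ × ℝ) → M × (ℝ × ℝ)) := by
  have h : ContDiff ℝ ∞ fun a : ℝ × ℝ => (s * a.1, a.2) := by fun_prop
  exact contMDiff_fst.prodMk (h.contMDiff.comp contMDiff_snd)

theorem contMDiff_coneIncl :
    ContMDiff (coneI n) (ambI n) ∞ (coneIncl : M × ℝ → M × (ℝ × ℝ)) := by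
  have h : ContDiff ℝ ∞ fun a : ℝ => (a, (0 : ℝ)) := by fun_prop
  exact contMDiff_fst.prodMk (h.contMDiff.comp contMDiff_snd)

variable {w : ℝ} {u v : M × (ℝ × ℝ) → ℝ}

theorem IsHomogeneous.mul {w' : ℝ} (hu : IsHomogeneous n U w u) (hv : IsHomogeneous n U w' v) :
    IsHomogeneous n U (w + w') (fun z => u z * v z) where
  smooth := hu.smooth.mul hv.smooth
  homogeneous z hz s hs := by
    rw [hu.homogeneous z hz s hs, hv.homogeneous z hz s hs, Real.rpow_add hs]; ring

theorem IsHomogeneous.sum_smul {ι : Type*} {J : Finset ι} {a : ι → ℝ} {F : ι → M × (ℝ × ℝ) → ℝ}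
    (hF : ∀ j ∈ J, IsHomogeneous n U w (F j)) :
    IsHomogeneous n U w (fun z => ∑ j ∈ J, a j * F j z) where
  smooth := contMDiffOn_finsetSum fun j hj => contMDiffOn_const.mul (hF j hj).smooth
  homogeneous z hz s hs := by
    rw [Finset.mul_sum]
    refine Finset.sum_congr rfl fun j hj => ?_
    rw [(hF j hj).homogeneous z hz s hs]; ring

variable [IsManifold (𝓡 n) ∞ M]

/-- The inverse chart intertwines the linear dilation with the dilation of the manifold, because the
chart leaves t and ρ untouched; differentiate this relation. -/
theorem chartDeriv_dil (hy : y ∈ (extChartAt (ambI n) z₀).target)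
    (Y : EuclideanSpace ℝ (Fin n) × (ℝ × ℝ)) :
    (chartDeriv (ambI n) z₀ ((ambFrame n).dil s y) ((ambFrame n).dil s Y) :
      EuclideanSpace ℝ (Fin n) × (ℝ × ℝ)) =
    mfderiv (ambI n) (ambI n) (dilation s) ((extChartAt (ambI n) z₀).symm y)
      (chartDeriv (ambI n) z₀ y Y) := by
  have hy' : (ambFrame n).dil s y ∈ (extChartAt (ambI n) z₀).target := by
    rw [mem_extChartAt_amb_target, ambFrame_dil]
    exact mem_extChartAt_amb_target.1 hy
  have hL : MDifferentiableAt 𝓘(ℝ, EuclideanSpace ℝ (Fin n) × (ℝ × ℝ))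
      𝓘(ℝ, EuclideanSpace ℝ (Fin n) × (ℝ × ℝ)) ((ambFrame n).dil s) y :=
    ((ambFrame n).dil s).differentiableAt.mdifferentiableAt
  have h1 := mfderiv_comp y (mdifferentiableAt_extChartAt_symm hy') hL
  have h2 := mfderiv_comp y ((contMDiff_dilation (M := M) s).mdifferentiableAt (by simp))
    (mdifferentiableAt_extChartAt_symm hy)
  have he : (extChartAt (ambI n) z₀).symm ∘ (ambFrame n).dil s =
      dilation s ∘ (extChartAt (ambI n) z₀).symm := funext fun y => extChartAt_amb_symm_dil
  have hL' : mfderiv 𝓘(ℝ, EuclideanSpace ℝ (Fin n) × (ℝ × ℝ))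
      𝓘(ℝ, EuclideanSpace ℝ (Fin n) × (ℝ × ℝ)) ((ambFrame n).dil s) y = (ambFrame n).dil s := by
    rw [mfderiv_eq_fderiv]; exact ((ambFrame n).dil s).fderiv
  rw [hL'] at h1
  rw [chartDeriv_eq_mfderiv, chartDeriv_eq_mfderiv]
  rw [he] at h1
  exact (congrArg (fun L : (EuclideanSpace ℝ (Fin n) × (ℝ × ℝ)) →L[ℝ]
    (EuclideanSpace ℝ (Fin n) × (ℝ × ℝ)) => L Y) h1).symm.trans
    (congrArg (fun L : (EuclideanSpace ℝ (Fin n) × (ℝ × ℝ)) →L[ℝ]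
    (EuclideanSpace ℝ (Fin n) × (ℝ × ℝ)) => L Y) h2)

variable {p q : ℕ} {g : BilinField (𝓡 n) M} {gt : BilinField (ambI n) (M × (ℝ × ℝ))}

theorem IsPreAmbientSpace.chartMetric_dil (h : IsPreAmbientSpace p q g U gt)
    (hy : y ∈ chartDom (ambI n) z₀ U) (hs : 0 < s) (Y Z : EuclideanSpace ℝ (Fin n) × (ℝ × ℝ)) :
    chartMetric (ambI n) gt z₀ ((ambFrame n).dil s y) ((ambFrame n).dil s Y)
      ((ambFrame n).dil s Z) = s ^ 2 * chartMetric (ambI n) gt z₀ y Y Z := by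
  rw [chartMetric_apply, chartMetric_apply, ← h.homogeneous _ hy.2 s hs]
  refine (BilinField.congr_point gt extChartAt_amb_symm_dil _ _).trans ?_
  exact congrArg₂ (fun a b : EuclideanSpace ℝ (Fin n) × (ℝ × ℝ) =>
    (gt (dilation s ((extChartAt (ambI n) z₀).symm y)) : (EuclideanSpace ℝ (Fin n) × (ℝ × ℝ)) →L[ℝ]
      (EuclideanSpace ℝ (Fin n) × (ℝ × ℝ)) →L[ℝ] ℝ) a b)
    (chartDeriv_dil hy.1 Y) (chartDeriv_dil hy.1 Z)

theorem IsHomogeneous.isConeHom (hu : IsHomogeneous n U w u) (z₀ : M × (ℝ × ℝ)) :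
    IsConeHom (ambFrame n) (chartDom (ambI n) z₀ U) w
      (fun y => u ((extChartAt (ambI n) z₀).symm y)) where
  smooth := hu.smooth.comp_extChartAt_symm z₀
  hom y hy t ht := by rw [extChartAt_amb_symm_dil, hu.homogeneous _ hy.2 t ht]

theorem IsHomogeneous.laplacian (hu : IsHomogeneous n U w u) (h : IsPreAmbientSpace p q g U gt) :
    IsHomogeneous n U (w - 2) (_root_.laplacian (ambI n) gt u) where
  smooth := h.metric.smooth_laplacian h.isOpen hu.smooth
  homogeneous z hz s hs := by
    have hs' : dilation s z ∈ (extChartAt (ambI n) z).source := by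
      rw [mem_extChartAt_amb_source]; exact mem_extChartAt_source z.1
    rw [h.metric.laplacian_eq h.isOpen hu.smooth (h.dilation_mem z hz s hs) hs',
      h.metric.laplacian_eq h.isOpen hu.smooth hz (mem_extChartAt_source z),
      extChartAt_amb_dilation]
    exact ((hu.isConeHom z).laplacian (h.metric.isMetricOn_chartMetric h.isOpen z)
      (fun y hy t ht => dil_mem_chartDom h.dilation_mem hy ht)
      (fun y hy t ht => h.chartMetric_dil hy ht)).hom _ (mem_chartDom_self hz) s hs

theorem IsHomogeneous.iterate (hu : IsHomogeneous n U w u) (h : IsPreAmbientSpace p q g U gt)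
    (j : ℕ) : IsHomogeneous n U (w - 2 * j) ((_root_.laplacian (ambI n) gt)^[j] u) := by
  induction j with
  | zero => simpa using hu
  | succ j ih =>
    rw [Function.iterate_succ_apply']
    convert ih.laplacian h using 1
    push_cast
    ring

theorem IsPreAmbientSpace.isHomogeneous_ambientOp (h : IsPreAmbientSpace p q g U gt) {w' : ℝ}
    {f : M × (ℝ × ℝ) → ℝ} (hf : IsHomogeneous n U w' f) (hu : IsHomogeneous n U w u) (k : ℕ) :
    IsHomogeneous n U (w + w' - 2 * k) (ambientOp gt k w w' f u) := by
  refine IsHomogeneous.sum_smul fun j hj => ?_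
  convert (hf.mul (hu.iterate h j)).iterate h (k - j) using 1
  rw [Nat.cast_sub (by simpa [Nat.lt_succ_iff] using hj)]
  ring

theorem IsPreAmbientSpace.ambientOp_eq (h : IsPreAmbientSpace p q g U gt) {w' : ℝ}
    {f : M × (ℝ × ℝ) → ℝ} (hf : IsHomogeneous n U w' f) (hu : IsHomogeneous n U w u) (k : ℕ)
    (hy : y ∈ chartDom (ambI n) z₀ U) :
    ambientOp gt k w w' f u ((extChartAt (ambI n) z₀).symm y) =
      coordOp (chartMetric (ambI n) gt z₀) n k w w'
        (fun y => f ((extChartAt (ambI n) z₀).symm y))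
        (fun y => u ((extChartAt (ambI n) z₀).symm y)) y := by
  refine Finset.sum_congr rfl fun j _ => congrArg _ ?_
  have h1 := h.metric.iterate_eq h.isOpen (hf.mul (hu.iterate h j)).smooth z₀ (k - j) hy
  refine h1.trans (iterate_laplacian_congr (isOpen_chartDom h.isOpen) _ (fun z hz => ?_) hy)
  have h2 := h.metric.iterate_eq h.isOpen hu.smooth z₀ j hz
  exact congrArg _ h2

end AmbientChart

/-! ### The cone, the Ricci conditions and straightness in a chart -/

section AmbientCone

set_option synthInstance.maxHeartbeats 400000

variable {n : ℕ} {M : Type*} [TopologicalSpace M] [ChartedSpace (EuclideanSpace ℝ (Fin n)) M]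
  {z z₀ : M × (ℝ × ℝ)} {U : Set (M × (ℝ × ℝ))} {y Z : EuclideanSpace ℝ (Fin n) × (ℝ × ℝ)}

/-- The parametrization of `M × ℝ` by the inverse of the preferred chart of `M` at `x`. -/
def coneParam (x : M) (v : EuclideanSpace ℝ (Fin n) × ℝ) : M × ℝ :=
  ((extChartAt (𝓡 n) x).symm v.1, v.2)

variable (n) in
/-- The coordinate expression of `coneIncl`. -/
def coneLin : (EuclideanSpace ℝ (Fin n) × ℝ) →L[ℝ] EuclideanSpace ℝ (Fin n) × (ℝ × ℝ) :=
  (ContinuousLinearMap.id ℝ (EuclideanSpace ℝ (Fin n))).prodMap (ContinuousLinearMap.inl ℝ ℝ ℝ)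

@[simp] theorem coneLin_apply (v : EuclideanSpace ℝ (Fin n) × ℝ) :
    coneLin n v = (v.1, (v.2, 0)) := rfl

/-- In a product chart a dilation orbit is an affine line with velocity X at s = 1, so the geodesic
equation there reduces to its Christoffel term. -/
theorem IsStraight.christoffel_eq_zero {gt : BilinField (ambI n) (M × (ℝ × ℝ))}
    (hs : IsStraight U gt) (hz : z ∈ U) :
    coordChristoffel (chartMetric (ambI n) gt z) (extChartAt (ambI n) z z)
      ((ambFrame n).proj (extChartAt (ambI n) z z))
      ((ambFrame n).proj (extChartAt (ambI n) z z)) = 0 := by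
  have h1 := hs z hz 1 one_pos
  have e : dilation 1 z = z := by simp [dilation]
  simp only [GeodesicAt, e] at h1
  have hd : ∀ s : ℝ, HasDerivAt (fun r => extChartAt (ambI n) z (dilation r z))
      ((ambFrame n).proj (extChartAt (ambI n) z z)) s := by
    intro s
    simp only [extChartAt_amb_dilation, ConeFrame.dil_apply]
    simpa using (((hasDerivAt_id s).sub_const 1).smul_const
      ((ambFrame n).proj (extChartAt (ambI n) z z))).const_add (extChartAt (ambI n) z z)
  have e2 : deriv (fun r => extChartAt (ambI n) z (dilation r z)) =
      fun _ => (ambFrame n).proj (extChartAt (ambI n) z z) := funext fun s => (hd s).deriv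
  rw [e2] at h1
  simpa using h1

variable [IsManifold (𝓡 n) ∞ M] {x : M} {v : EuclideanSpace ℝ (Fin n) × ℝ}

theorem mdifferentiableAt_coneParam (hv : v.1 ∈ (extChartAt (𝓡 n) x).target) :
    MDifferentiableAt 𝓘(ℝ, EuclideanSpace ℝ (Fin n) × ℝ) (coneI n) (coneParam x) v := by
  have h1 : MDifferentiableAt 𝓘(ℝ, EuclideanSpace ℝ (Fin n) × ℝ) 𝓘(ℝ, EuclideanSpace ℝ (Fin n))
      Prod.fst v := differentiableAt_fst.mdifferentiableAt
  have h2 : MDifferentiableAt 𝓘(ℝ, EuclideanSpace ℝ (Fin n) × ℝ) 𝓘(ℝ, ℝ)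
      Prod.snd v := differentiableAt_snd.mdifferentiableAt
  exact ((mdifferentiableAt_extChartAt_symm hv).comp v h1).prodMk h2

theorem coneProj_mfderiv_coneParam (hv : v.1 ∈ (extChartAt (𝓡 n) x).target) (τ : ℝ) :
    coneProj (coneParam x v) (mfderiv 𝓘(ℝ, EuclideanSpace ℝ (Fin n) × ℝ) (coneI n)
      (coneParam x) v ((0, τ) : EuclideanSpace ℝ (Fin n) × ℝ)) = 0 := by
  have hf : MDifferentiableAt (coneI n) (𝓡 n) (Prod.fst : M × ℝ → M) (coneParam x v) :=
    mdifferentiableAt_fst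
  have h1 := mfderiv_comp v hf (mdifferentiableAt_coneParam hv)
  have h3 : MDifferentiableAt 𝓘(ℝ, EuclideanSpace ℝ (Fin n) × ℝ) 𝓘(ℝ, EuclideanSpace ℝ (Fin n))
      Prod.fst v := differentiableAt_fst.mdifferentiableAt
  have h2 := mfderiv_comp v (mdifferentiableAt_extChartAt_symm hv) h3
  have h4 : mfderiv 𝓘(ℝ, EuclideanSpace ℝ (Fin n) × ℝ) 𝓘(ℝ, EuclideanSpace ℝ (Fin n))
      Prod.fst v = ContinuousLinearMap.fst ℝ (EuclideanSpace ℝ (Fin n)) ℝ := by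
    rw [mfderiv_eq_fderiv]; exact fderiv_fst
  rw [h4] at h2
  have h5 : (Prod.fst : M × ℝ → M) ∘ coneParam x = (extChartAt (𝓡 n) x).symm ∘ Prod.fst := rfl
  rw [h5, h2] at h1
  refine (congrArg (fun L : (EuclideanSpace ℝ (Fin n) × ℝ) →L[ℝ] EuclideanSpace ℝ (Fin n) =>
    L (0, τ)) h1).symm.trans ?_
  exact (mfderiv 𝓘(ℝ, EuclideanSpace ℝ (Fin n)) (𝓡 n) (extChartAt (𝓡 n) x).symm v.1).map_zero

theorem chartDeriv_coneLin (hv : v.1 ∈ (extChartAt (𝓡 n) z₀.1).target)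
    (b : EuclideanSpace ℝ (Fin n) × ℝ) :
    (chartDeriv (ambI n) z₀ (coneLin n v) (coneLin n b) :
      EuclideanSpace ℝ (Fin n) × (ℝ × ℝ)) =
    mfderiv (coneI n) (ambI n) coneIncl (coneParam z₀.1 v)
      (mfderiv 𝓘(ℝ, EuclideanSpace ℝ (Fin n) × ℝ) (coneI n) (coneParam z₀.1) v b) := by
  have hy : coneLin n v ∈ (extChartAt (ambI n) z₀).target := mem_extChartAt_amb_target.2 hv
  have hL : MDifferentiableAt 𝓘(ℝ, EuclideanSpace ℝ (Fin n) × ℝ)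
      𝓘(ℝ, EuclideanSpace ℝ (Fin n) × (ℝ × ℝ)) (coneLin n) v :=
    (coneLin n).differentiableAt.mdifferentiableAt
  have h1 := mfderiv_comp v (mdifferentiableAt_extChartAt_symm hy) hL
  have h2 := mfderiv_comp v ((contMDiff_coneIncl (M := M)).mdifferentiableAt (by simp))
    (mdifferentiableAt_coneParam hv)
  have he : (extChartAt (ambI n) z₀).symm ∘ coneLin n = coneIncl ∘ coneParam z₀.1 :=
    funext fun y => extChartAt_amb_symm_apply
  have hL' : mfderiv 𝓘(ℝ, EuclideanSpace ℝ (Fin n) × ℝ)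
      𝓘(ℝ, EuclideanSpace ℝ (Fin n) × (ℝ × ℝ)) (coneLin n) v = coneLin n := by
    rw [mfderiv_eq_fderiv]; exact (coneLin n).fderiv
  rw [hL', he] at h1
  rw [chartDeriv_eq_mfderiv]
  exact (congrArg (fun L : (EuclideanSpace ℝ (Fin n) × ℝ) →L[ℝ]
    (EuclideanSpace ℝ (Fin n) × (ℝ × ℝ)) => L b) h1).symm.trans
    (congrArg (fun L : (EuclideanSpace ℝ (Fin n) × ℝ) →L[ℝ]
    (EuclideanSpace ℝ (Fin n) × (ℝ × ℝ)) => L b) h2)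

/-- Lets the intrinsic conditions on pullbacks to the cone, for the metric and for the leading Ricci
coefficient, be read off in coordinates. -/
theorem chartMetric_coneLin (S : BilinField (ambI n) (M × (ℝ × ℝ)))
    (hv : v.1 ∈ (extChartAt (𝓡 n) z₀.1).target) (b b' : EuclideanSpace ℝ (Fin n) × ℝ) :
    chartMetric (ambI n) S z₀ (coneLin n v) (coneLin n b) (coneLin n b') =
      conePullback S (coneParam z₀.1 v)
        (mfderiv 𝓘(ℝ, EuclideanSpace ℝ (Fin n) × ℝ) (coneI n) (coneParam z₀.1) v b)
        (mfderiv 𝓘(ℝ, EuclideanSpace ℝ (Fin n) × ℝ) (coneI n) (coneParam z₀.1) v b') := by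
  rw [chartMetric_apply, conePullback]
  have hp : (extChartAt (ambI n) z₀).symm (coneLin n v) = coneIncl (coneParam z₀.1 v) :=
    extChartAt_amb_symm_apply
  refine (BilinField.congr_point S hp _ _).trans ?_
  exact congrArg₂ (fun a b : EuclideanSpace ℝ (Fin n) × (ℝ × ℝ) =>
    (S (coneIncl (coneParam z₀.1 v)) : (EuclideanSpace ℝ (Fin n) × (ℝ × ℝ)) →L[ℝ]
      (EuclideanSpace ℝ (Fin n) × (ℝ × ℝ)) →L[ℝ] ℝ) a b)
    (chartDeriv_coneLin hv b) (chartDeriv_coneLin hv b')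

/-- A bilinear form whose pullback to the cone is horizontal is degenerate along the dilations. -/
theorem chartMetric_proj_eq_zero {S : BilinField (ambI n) (M × (ℝ × ℝ))}
    (hy : y ∈ (extChartAt (ambI n) z₀).target) (h0 : y.2.2 = 0)
    {B : TangentSpace (𝓡 n) (coneParam z₀.1 (y.1, y.2.1)).1 →L[ℝ]
      TangentSpace (𝓡 n) (coneParam z₀.1 (y.1, y.2.1)).1 →L[ℝ] ℝ}
    (hS : ∀ Y Z, conePullback S (coneParam z₀.1 (y.1, y.2.1)) Y Z =
      B (coneProj _ Y) (coneProj _ Z)) (hZ : Z.2.2 = 0) :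
    chartMetric (ambI n) S z₀ y Z ((ambFrame n).proj y) = 0 := by
  have ey : y = coneLin n (y.1, y.2.1) := by
    rw [coneLin_apply, ← h0]
  have eZ : Z = coneLin n (Z.1, Z.2.1) := by
    rw [coneLin_apply, ← hZ]
  have eX : (ambFrame n).proj y = coneLin n (0, y.2.1) := rfl
  have ht : (y.1, y.2.1).1 ∈ (extChartAt (𝓡 n) z₀.1).target := mem_extChartAt_amb_target.1 hy
  rw [eX, eZ]
  nth_rw 1 [ey]
  rw [chartMetric_coneLin S ht, hS, coneProj_mfderiv_coneParam ht]
  exact map_zero _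

variable {p q : ℕ} {g : BilinField (𝓡 n) M} {gt : BilinField (ambI n) (M × (ℝ × ℝ))}

/-- The orthogonality of X to the cone comes from the pullback condition: t²π^*g is horizontal and X
is vertical. -/
theorem IsPreAmbientSpace.isConeMetric (h : IsPreAmbientSpace p q g U gt) (z₀ : M × (ℝ × ℝ)) :
    IsConeMetric (ambFrame n) (chartMetric (ambI n) gt z₀)
      ((ambFrame n).starCore (chartDom (ambI n) z₀ U)) where
  domain := (ambFrame n).isDomain_starCore (isOpen_chartDom h.isOpen)
    fun y hy s hs => dil_mem_chartDom h.dilation_mem hy hs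
  metric := (h.metric.isMetricOn_chartMetric h.isOpen z₀).mono
    ((ambFrame n).isDomain_starCore (isOpen_chartDom h.isOpen)
      fun y hy s hs => dil_mem_chartDom h.dilation_mem hy hs).isOpen
    ((ambFrame n).starCore_subset _)
  proj_ne y hy h0 := by
    have hp := h.pos _ ((ambFrame n).starCore_subset _ hy).2
    rw [extChartAt_amb_symm_apply] at hp
    simp only [ambFrame_proj, Prod.mk_eq_zero] at h0
    exact hp.ne' h0.2.1
  homogeneous y hy s hs Y Z := h.chartMetric_dil ((ambFrame n).starCore_subset _ hy) hs Y Z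
  null y hy h0 Z hZ := by
    have hy := (ambFrame n).starCore_subset _ hy
    have hp := h.pos _ hy.2
    rw [extChartAt_amb_symm_apply] at hp
    rw [(h.metric.isMetricOn_chartMetric h.isOpen z₀).symm y hy]
    exact chartMetric_proj_eq_zero (B := y.2.1 ^ 2 • g _) hy.1 h0
      (fun Y Z => h.pullback _ _ hp Y Z) hZ

/-- The radial limit of the Ricci tensor of a metric whose Ricci tensor vanishes to order `m`. -/
theorem IsPreAmbientSpace.tendsto_ricci (h : IsPreAmbientSpace p q g U gt)
    {S : BilinField (ambI n) (M × (ℝ × ℝ))} {m k : ℕ}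
    (hS : IsQuotientByRho U m (ricci (ambI n) gt) S) (hkm : k ≤ m)
    (hy : y ∈ chartDom (ambI n) z₀ U) (h0 : y.2.2 = 0) (W : EuclideanSpace ℝ (Fin n) × (ℝ × ℝ))
    (hZ : k < m ∨ chartMetric (ambI n) S z₀ y Z W = 0) :
    Filter.Tendsto (fun r : ℝ => coordRicci (chartMetric (ambI n) gt z₀)
      (y + r • (ambFrame n).vec) Z W / r ^ k) (nhdsWithin 0 {0}ᶜ) (nhds 0) := by
  have hO := isOpen_chartDom (I := ambI n) (p := z₀) h.isOpen
  have hc : Filter.Tendsto (fun r : ℝ => y + r • (ambFrame n).vec) (nhds 0) (nhds y) := by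
    have : Continuous fun r : ℝ => y + r • (ambFrame n).vec := by fun_prop
    simpa using this.tendsto 0
  have hC : Filter.Tendsto (fun r : ℝ => r ^ (m - k) *
      chartMetric (ambI n) S z₀ (y + r • (ambFrame n).vec) Z W) (nhds 0) (nhds 0) := by
    -- After division by r^k the Ricci tensor is r^{m-k} times a continuous function, so the limit
    -- vanishes if an order is left over or if the leading coefficient does.
    have h1 : ContinuousAt (fun y => chartMetric (ambI n) S z₀ y Z W) y :=
      (((hS.1.chartMetric z₀).continuousAt (hO.mem_nhds hy)).clm_apply
        continuousAt_const).clm_apply continuousAt_const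
    have h2 : Filter.Tendsto (fun r : ℝ => r ^ (m - k)) (nhds 0) (nhds (0 ^ (m - k))) :=
      (continuous_pow _).tendsto 0
    have h3 := h2.mul (h1.tendsto.comp hc)
    have h4 : (0 : ℝ) ^ (m - k) * chartMetric (ambI n) S z₀ y Z W = 0 := by
      rcases hZ with hZ | hZ
      · rw [zero_pow (by omega), zero_mul]
      · rw [hZ, mul_zero]
    rw [h4] at h3
    exact h3
  refine (hC.mono_left nhdsWithin_le_nhds).congr' ?_
  filter_upwards [nhdsWithin_le_nhds (hc.eventually (hO.mem_nhds hy)), self_mem_nhdsWithin]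
    with r hr hr0
  have hr0 : r ≠ 0 := hr0
  rw [h.metric.coordRicci_eq h.isOpen hr, hS.2 _ hr.2, chartMetric_apply]
  have e : ((extChartAt (ambI n) z₀).symm (y + r • (ambFrame n).vec)).2.2 = r := by
    rw [extChartAt_amb_symm_apply]; simp [h0]
  rw [e, ← pow_sub_mul_pow r hkm]
  field_simp

/-- The change of chart involves only the factor M, so lines in the direction ∂_t are merely
translated. -/
theorem fderiv_chartChange_proj {z' : M × (ℝ × ℝ)}
    (hy : y ∈ chartDom (ambI n) z₀ (extChartAt (ambI n) z').source)
    (W : EuclideanSpace ℝ (Fin n) × (ℝ × ℝ)) :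
    fderiv ℝ (chartChange (ambI n) z₀ z') y ((ambFrame n).proj W) = (ambFrame n).proj W := by
  have hd := (contDiffOn_chartChange z₀ z').differentiableAt_infty
    (isOpen_chartDom_source (I := ambI n) z₀ z') hy
  have h1 : HasDerivAt (fun s : ℝ => y + s • (ambFrame n).proj W) ((ambFrame n).proj W) 0 := by
    simpa using ((hasDerivAt_id (0 : ℝ)).smul_const ((ambFrame n).proj W)).const_add y
  have h2 := hd.hasFDerivAt
  rw [show y = y + (0 : ℝ) • (ambFrame n).proj W by simp] at h2
  have h3 := h2.comp_hasDerivAt (0 : ℝ) h1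
  have e : (chartChange (ambI n) z₀ z') ∘ (fun s : ℝ => y + s • (ambFrame n).proj W) =
      fun s => chartChange (ambI n) z₀ z' y + s • (ambFrame n).proj W := by
    funext s
    simp only [Function.comp_def, chartChange, extChartAt_amb_apply, extChartAt_amb_symm_apply,
      ambFrame_proj]
    simp
  rw [e] at h3
  have h4 : HasDerivAt (fun s : ℝ => chartChange (ambI n) z₀ z' y + s • (ambFrame n).proj W)
      ((ambFrame n).proj W) 0 := by
    simpa using ((hasDerivAt_id (0 : ℝ)).smul_const ((ambFrame n).proj W)).const_add
      (chartChange (ambI n) z₀ z' y)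
  simpa using h3.unique h4

theorem IsPreAmbientSpace.defect_eq_zero (h : IsPreAmbientSpace p q g U gt)
    (hs : IsStraight U gt) (hy : y ∈ (ambFrame n).starCore (chartDom (ambI n) z₀ U)) :
    coneDefect (ambFrame n) (chartMetric (ambI n) gt z₀) y = 0 := by
  have hc := h.isConeMetric z₀
  have hy' := (ambFrame n).starCore_subset _ hy
  set z := (extChartAt (ambI n) z₀).symm y with hz
  have iso := h.metric.isIsometryOn_chartChange h.isOpen z₀ z
  have hm : y ∈ chartDom (ambI n) z₀ (U ∩ (extChartAt (ambI n) z).source) :=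
    ⟨hy'.1, hy'.2, mem_extChartAt_source z⟩
  have hO := isOpen_chartDom_source (I := ambI n) z₀ z
  have hm' : y ∈ chartDom (ambI n) z₀ (extChartAt (ambI n) z).source := ⟨hm.1, hm.2.2⟩
  -- The differential of the coordinate change is constant on the direction of X, so the
  -- inhomogeneous term in the transformation of Γ(X, X) vanishes.
  have h2 : fderiv ℝ (fderiv ℝ (chartChange (ambI n) z₀ z)) y ((ambFrame n).proj y)
      ((ambFrame n).proj y) = 0 := by
    have := fderiv_congr_on hO (fun y' hy' => fderiv_chartChange_proj hy' y) hm'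
    rw [fderiv_clm_apply (((contDiffOn_chartChange z₀ z).fderiv_infty hO).differentiableAt_infty
      hO hm') (by fun_prop)] at this
    simpa using congrArg (fun L => L ((ambFrame n).proj y)) this
  have hψ : chartChange (ambI n) z₀ z y = extChartAt (ambI n) z z := rfl
  have hpr : (ambFrame n).proj (extChartAt (ambI n) z z) = (ambFrame n).proj y := by
    rw [extChartAt_amb_apply, hz, extChartAt_amb_symm_apply]; rfl
  have h3 := iso.christoffel hm ((ambFrame n).proj y) ((ambFrame n).proj y)
  have h4 := hs.christoffel_eq_zero (z := z) hy'.2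
  rw [hpr] at h4
  rw [h2, fderiv_chartChange_proj hm', hψ, h4, add_zero] at h3
  have h5 : coordChristoffel (chartMetric (ambI n) gt z₀) y ((ambFrame n).proj y)
      ((ambFrame n).proj y) = 0 := iso.injective hm (by rw [h3, map_zero])
  -- With Γ(X, X) = 0 in this chart, ∇_X X = X; comparing with ∇_X X = X + β^♯ gives β = 0.
  have h6 := congrArg (fun L => L ((ambFrame n).proj y)) (hc.covD_proj hy)
  simp only [IsConeMetric.covD_proj_apply, h5, ConeFrame.proj_proj, add_zero, _root_.add_apply,
    ContinuousLinearMap.id_apply, hc.skew_proj hy] at h6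
  have h7 : sharp (chartMetric (ambI n) gt z₀)
      (coneDefect (ambFrame n) (chartMetric (ambI n) gt z₀)) y = 0 := by
    simpa using h6.symm
  rw [← hc.metric.sharp_spec hy (coneDefect _ _), h7, map_zero]

end AmbientCone

theorem lemma2p4 {n : ℕ} (hn : 0 < n)
    {M : Type*} [TopologicalSpace M] [ChartedSpace (EuclideanSpace ℝ (Fin n)) M]
    [IsManifold (𝓡 n) ∞ M]
    (p q : ℕ) (g : BilinField (𝓡 n) M) (hg : IsPseudoRiemannianOn (𝓡 n) p q g Set.univ)
    (U : Set (M × (ℝ × ℝ))) (gt : BilinField (ambI n) (M × (ℝ × ℝ)))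
    (hgt : IsAmbientSpace p q g U gt)
    (k : ℕ) (hstraight : Even n → n < 2 * k → IsStraight U gt)
    (w w' : ℝ) (f : M × (ℝ × ℝ) → ℝ) (hf : IsHomogeneous n U w' f) :
    (∀ u : M × (ℝ × ℝ) → ℝ, IsHomogeneous n U w u →
      IsHomogeneous n U (w + w' - 2 * k) (ambientOp gt k w w' f u)) ∧
    (∀ u₁ u₂ : M × (ℝ × ℝ) → ℝ, IsHomogeneous n U w u₁ → IsHomogeneous n U w u₂ →
      (∀ (x : M) (t : ℝ), 0 < t → u₁ (coneIncl (x, t)) = u₂ (coneIncl (x, t))) →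
      ∀ (x : M) (t : ℝ), 0 < t →
        ambientOp gt k w w' f u₁ (coneIncl (x, t)) =
          ambientOp gt k w w' f u₂ (coneIncl (x, t))) := by
  have h := hgt.toIsPreAmbientSpace
  refine ⟨fun u hu => h.isHomogeneous_ambientOp hf hu k, fun u₁ u₂ h₁ h₂ h12 x t ht => ?_⟩
  obtain _ | l := k
  · simp [ambientOp, h12 x t ht]
  set z₀ : M × (ℝ × ℝ) := coneIncl (x, t)
  set c := ambFrame n
  set G := chartMetric (ambI n) gt z₀
  have hz₀ : z₀ ∈ U := h.cone_mem x t ht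
  have hN : Module.finrank ℝ (EuclideanSpace ℝ (Fin n) × (ℝ × ℝ)) = n + 2 := by simp
  have hdom := mem_chartDom_self (I := ambI n) hz₀
  have h0 : c.rho (extChartAt (ambI n) z₀ z₀) = 0 := by
    rw [extChartAt_amb_apply]; rfl
  have hcore := c.starCore_subset (chartDom (ambI n) z₀ U)
  have hor : (∀ y ∈ c.starCore (chartDom (ambI n) z₀ U), coneDefect c G y = 0) ∨
      ((∀ y ∈ c.starCore (chartDom (ambI n) z₀ U), c.rho y = 0 → ∀ Z, c.rho Z = 0 →
        Filter.Tendsto (fun r : ℝ => coordRicci G (y + r • c.vec) Z (c.proj y) / r ^ l)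
          (nhdsWithin 0 {0}ᶜ) (nhds 0)) ∧
      ∀ m : ℕ, m < l →
        2 * (m + 1) ≠ Module.finrank ℝ (EuclideanSpace ℝ (Fin n) × (ℝ × ℝ)) ∧
        2 * (m + 1) + 2 ≠ Module.finrank ℝ (EuclideanSpace ℝ (Fin n) × (ℝ × ℝ))) := by
    rw [hN]
    rcases Nat.even_or_odd n with he | ho
    · rcases lt_or_ge n (2 * (l + 1)) with hl | hl
      · exact Or.inl fun y hy => h.defect_eq_zero (hstraight he hl) hy
      -- Here l + 1 ≤ n/2, so order n/2 - 1 suffices for l. In the borderline case the leading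
      -- coefficient vanishes on (Z, X), as its pullback to the cone is horizontal; both exceptional
      -- dimensions are avoided.
      · obtain ⟨S, hS, hS'⟩ := hgt.ricci_even he
        refine Or.inr ⟨fun y hy hy0 Z hZ => h.tendsto_ricci hS (by omega) (hcore hy) hy0 _
          (Or.inr ?_), fun m hm => by omega⟩
        have hp := h.pos _ (hcore hy).2
        rw [extChartAt_amb_symm_apply] at hp
        obtain ⟨s, -, -, hs⟩ := hS' ((extChartAt (𝓡 n) z₀.1).symm y.1) y.2.1 hp
        exact chartMetric_proj_eq_zero (B := s) (hcore hy).1 hy0 hs hZ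
    -- One order more than l is taken, so no leading coefficient has to vanish; parity excludes both
    -- exceptional equalities with n + 2.
    · obtain ⟨S, hS⟩ := hgt.ricci_odd ho (l + 1)
      obtain ⟨a, ha⟩ := ho
      exact Or.inr ⟨fun y hy hy0 Z _ => h.tendsto_ricci hS (by omega) (hcore hy) hy0 _
        (Or.inl (by omega)), fun m _ => by omega⟩
  obtain ⟨Ω, hΩ, hcone, Q, γ, hq⟩ :=
    -- Positivity of n enters through n + 2 > 2. The exponent obtained is l + 1, the order of the
    -- operator in powers of Δ.
    (h.isConeMetric z₀).exists_isDefectQuotient (by rw [hN]; omega) l hor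
  have hmem := hcone _ (c.mem_starCore hdom h0) h0
  have hsub : Ω ⊆ chartDom (ambI n) z₀ U := hΩ.trans hcore
  have key := hq.coordOp_congr hN ((hf.isConeHom z₀).mono hsub) ((h₁.isConeHom z₀).mono hsub)
    ((h₂.isConeHom z₀).mono hsub) (fun y hy hy0 => ?_) hmem h0
  · have e : (extChartAt (ambI n) z₀).symm (extChartAt (ambI n) z₀ z₀) = z₀ :=
      extChartAt_to_inv z₀
    rw [← e, h.ambientOp_eq hf h₁ _ hdom, h.ambientOp_eq hf h₂ _ hdom]
    exact key
  · have hp := h.pos _ (hsub hy).2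
    have e : (extChartAt (ambI n) z₀).symm y =
        coneIncl ((extChartAt (𝓡 n) z₀.1).symm y.1, y.2.1) := by
      rw [extChartAt_amb_symm_apply, coneIncl, ← show y.2.2 = 0 from hy0]
    rw [extChartAt_amb_symm_apply] at hp
    rw [e]
    exact h12 _ _ hp

end
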